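/- **Setting.** Let $(D,\mathcal M,\mu)$ be a measure space, $p\in(1,\infty)$, $X=L^p(D,\mathcal M,\mu)$, with topological dual $X^*=L^{p^*}(D,\mathcal M,\mu)$ ($1/p+1/p^*=1$), duality pairing $\langle\cdot,\cdot\rangle$ and nonnegative cones $K_+\subset X$, $K_+^*\subset X^*$. Let $\mathcal A$ generate a $C_0$-group $(e^{t\mathcal A})_{t\in\mathbb R}$ of positivity-preserving operators on $X$; $e^{t\mathcal A^*}$ denotes the adjoint of $e^{t\mathcal A}$. Let $T\in[0,\infty]$ (with $[s,T]:=[s,\infty)$ if $T=\infty$), let $q$ be a finite nonnegative Borel measure on $[0,T]$, and let $(\Omega,\mathcal F,(\mathcal F_t)_{t\in[0,T]},\mathsf P)$ be a filtered probability space satisfying the usual conditions. Path properties below are understood $\mathsf P$-a.s. Let $\mathcal S$ be the set of adapted $K_+$-valued processes $\nu$ with nondecreasing, right-continuous paths of finite variation on compact time intervals, with the convention $\nu_{0^-}=0$. Let $|\nu|$ be the variation measure of $\mathrm d\nu$ on $[0,T]$ (with an atom of mass $|\nu_0|_X$ at $0$), and let $\rho\ge 0$ be the density with $\mathrm d\nu=\rho\,\mathrm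 d|\nu|$. Put $\int_0^T\langle f_s,\mathrm d\nu_s\rangle:=\int_{[0,T]}\langle f_s,\rho_s\rangle\,\mathrm d|\nu|_s$ and $\int_0^t\Theta_s\,\mathrm d\nu_s:=\int_{[0,t]}\Theta_s\rho_s\,\mathrm d|\nu|_s$. Let $\mathbf y\in K_+$, let $\Phi^*$ be an adapted $K_+^*$-valued càdlàg process, and let $\Pi:\Omega\times[0,T]\times K_+\to[0,\infty)$ be measurable, with $\Pi(\cdot,\cdot,z)$ progressively measurable for each $z\in K_+$, and with $\Pi(\omega,t,\cdot)$ concave, nondecreasing, and of class $C^1$ on $\{k\in K_+: k\ge e^{t\mathcal A}\mathbf y\}$ for all $(\omega,t)$; $\nabla\Pi$ denotes the gradient in the last variable, relative to this set. Let $\mathcal C$ be the set of $\nu\in\mathcal S$ with $\mathsf E\big[\int_0^T\langle\Phi^*_t,\mathrm d\nu_t\rangle\big]<\infty$ and assume that, for every $\nu\in\mathcal C$, $$\mathcal J(\mathbf y,\nu):=\mathsf E\Big[\int_0^T\Pi\big(t,Y^{\mathbf y,\nu}_t\big)\,q(\mathrm dt)-\int_0^T\langle\Phi^*_t,\mathrm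 d\nu_t\rangle\Big]<\infty,\qquad Y^{\mathbf y,\nu}_t=e^{t\mathcal A}\mathbf y+\int_0^te^{(t-s)\mathcal A}\,\mathrm d\nu_s .$$ **Reformulated problem** (in terms of $\widehat\nu_t=\int_0^te^{-s\mathcal A}\mathrm d\nu_s$). Let $\widehat{\mathcal C}$ be the set of $\widehat\nu\in\mathcal S$ with $\mathsf E\big[\int_0^T\langle e^{t\mathcal A^*}\Phi^*_t,\mathrm d\widehat\nu_t\rangle\big]<\infty$. The problem is $$\sup_{\widehat\nu\in\widehat{\mathcal C}}\ \mathsf E\Big[\int_0^T\Pi\big(t,e^{t\mathcal A}(\mathbf y+\widehat\nu_t)\big)\,q(\mathrm dt)-\int_0^T\langle e^{t\mathcal A^*}\Phi^*_t,\mathrm d\widehat\nu_t\rangle\Big],\tag{$\widehat{\mathrm P}$}$$ and a control in $\widehat{\mathcal C}$ is optimal if it attains the supremum. **Statement.** Let $\widehat\nu^\star\in\widehat{\mathcal C}$ and let $$g_s=\mathsf E\Big[\int_{[s,T]}e^{(t-s)\mathcal A^*}\,\nabla\Pi\big(t,e^{t\mathcal A}(\mathbf y+\widehat\nu^\star_t)\big)\,q(\mathrm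 dt)\,\Big|\,\mathcal F_s\Big],\qquad s\in[0,T].$$ Here the integral is understood through its $[0,\infty]$-valued pairings with nonnegative vectors, and $g$ is any progressively measurable version of the process of conditional expectations, i.e. the identity holds also at all stopping times $s=\tau$ on $\{\tau<\infty\}$. Then $\widehat\nu^\star$ is optimal for $(\widehat{\mathrm P})$ if and only if both of the following hold: 1. for every $\widehat\nu\in\widehat{\mathcal C}$: $\displaystyle\ \mathsf E\Big[\int_0^T\big\langle e^{s\mathcal A^*}g_s-e^{s\mathcal A^*}\Phi^*_s,\ \mathrm d\widehat\nu_s\big\rangle\Big]\le 0$; 2. $\displaystyle\ \mathsf E\Big[\int_0^T\big\langle e^{s\mathcal A^*}g_s-e^{s\mathcal A^*}\Phi^*_s,\ \mathrm d\widehat\nu^\star_s\big\rangle\Big]=0$. (These expectations are well defined, with values in $(-\infty,\infty]$.) -/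

import Mathlib

open MeasureTheory Set Filter Topology
open scoped ENNReal NNReal

noncomputable section

namespace SingularControl

/-! ### The time interval -/

/-- The time interval `[0, T]`, which is `[0, ∞)` when `T = ∞`. -/
def horizon (T : ℝ≥0∞) : Set ℝ≥0 := {t | (t : ℝ≥0∞) ≤ T}

instance horizon_ordConnected (T : ℝ≥0∞) : (horizon T).OrdConnected :=
  ⟨fun _ _ _ hy _ hz => le_trans (ENNReal.coe_le_coe.2 hz.2) hy⟩

instance horizon_compactIccSpace (T : ℝ≥0∞) : CompactIccSpace (horizon T) where
  isCompact_Icc {a b} := by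
    rw [Subtype.isCompact_iff]
    have h : (Subtype.val '' Icc a b : Set ℝ≥0) = Icc (a : ℝ≥0) b := by
      ext x
      constructor
      · rintro ⟨z, hz, rfl⟩
        exact hz
      · intro hx
        exact ⟨⟨x, (horizon_ordConnected T).out a.2 b.2 hx⟩, hx, rfl⟩
    rw [h]
    exact isCompact_Icc

instance horizon_orderBot (T : ℝ≥0∞) : OrderBot (horizon T) where
  bot := ⟨0, by simp [horizon]⟩
  bot_le t := zero_le (a := (t : ℝ≥0))

/-- The usual conditions: the filtration is right-continuous, and its initial σ-algebra
contains every set of outer measure zero. -/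
structure UsualConditions {Ω : Type*} {mΩ : MeasurableSpace Ω} {T : ℝ≥0∞}
    (F : Filtration (horizon T) mΩ) (P : Measure Ω) : Prop where
  rightContinuous : F.IsRightContinuous
  complete : ∀ N : Set Ω, P N = 0 → MeasurableSet[F ⊥] N

/-! ### Extended integrals -/

/-- The integral, with values in `[-∞, ∞]`, of an extended real function: the integral of the
positive part minus that of the negative part.  It is the usual integral whenever one of the two
is finite. -/
def extIntegral {α : Type*} {mα : MeasurableSpace α} (m : Measure α) (f : α → EReal) : EReal :=
  ((∫⁻ a, (f a).toENNReal ∂m : ℝ≥0∞) : EReal) - ((∫⁻ a, (-f a).toENNReal ∂m : ℝ≥0∞) : EReal)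

/-! ### Groups of operators -/

/-- A strongly continuous one-parameter group of bounded operators. -/
structure IsC0Group {X : Type*} [NormedAddCommGroup X] [NormedSpace ℝ X]
    (S : ℝ → X →L[ℝ] X) : Prop where
  zero : S 0 = ContinuousLinearMap.id ℝ X
  add : ∀ s t, S (s + t) = (S s).comp (S t)
  continuous : ∀ x, Continuous fun t => S t x

/-- `A` is the generator of the group `S`: `A x = y` exactly when `(S t x - x) / t → y` as
`t → 0`; in particular the domain of `A` is the set of all `x` for which the limit exists. -/
def IsGenerator {X : Type*} [NormedAddCommGroup X] [NormedSpace ℝ X]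
    (A : X →ₗ.[ℝ] X) (S : ℝ → X →L[ℝ] X) : Prop :=
  ∀ x y, (x, y) ∈ A.graph ↔ Tendsto (fun t : ℝ => t⁻¹ • (S t x - x)) (𝓝[≠] 0) (𝓝 y)

/-! ### Integration with respect to a nondecreasing path of finite variation -/

section Paths

variable {X : Type*} [NormedAddCommGroup X] {T : ℝ≥0∞}

lemma monotone_variation (n : horizon T → X) (h : ∀ t, eVariationOn n (Iic t) ≠ ∞) :
    Monotone fun t => (eVariationOn n (Iic t)).toReal :=
  fun _ t hst => ENNReal.toReal_mono (h t) (eVariationOn.mono n (Iic_subset_Iic.2 hst))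

open Classical in
/-- The variation `|n|` of the vector measure `dn` on `[0, T]` attached to a right-continuous path
`n` of finite variation on compact intervals, with the convention `n(0-) = 0`: the Stieltjes
measure of `t ↦ Var(n; [0, t])`, plus an atom of mass `‖n 0‖` at time `0`. -/
def variationMeasure (n : horizon T → X) : Measure (horizon T) :=
  if h : ∀ t, eVariationOn n (Iic t) ≠ ∞ then
    (monotone_variation n h).stieltjesFunction.measure + ‖n ⊥‖ₑ • Measure.dirac ⊥
  else 0

variable [NormedSpace ℝ X] [PartialOrder X]

/-- `ρ` is a density of `dn` with respect to its variation: `dn = ρ d|n|`, with values in the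
nonnegative cone. -/
structure IsDensity (n ρ : horizon T → X) : Prop where
  stronglyMeasurable : StronglyMeasurable ρ
  nonneg : ∀ s, 0 ≤ ρ s
  integrableOn : ∀ t, IntegrableOn ρ (Iic t) (variationMeasure n)
  eq_integral : ∀ t, n t = ∫ s in Iic t, ρ s ∂(variationMeasure n)

open Classical in
/-- A density of `dn` with respect to `|n|` (unique up to `|n|`-null sets). -/
def density (n : horizon T → X) : horizon T → X :=
  if h : ∃ ρ, IsDensity n ρ then h.choose else 0

/-- `∫_0^T ⟨f s, dn s⟩ = ∫_[0,T] ⟨f s, ρ s⟩ d|n|_s` in `[0, ∞]`, for `f` with values in the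
nonnegative cone of the dual space. -/
def pairingIntegral (f : horizon T → X →L[ℝ] ℝ) (n : horizon T → X) : ℝ≥0∞ :=
  ∫⁻ s, ENNReal.ofReal (f s (density n s)) ∂(variationMeasure n)

/-- The mild solution of `dY = A Y dt + dn`, `Y(0-) = y`:
`Y t = e^{tA} y + ∫_[0,t] e^{(t-s)A} dn s`. -/
def mildSolution (S : ℝ → X →L[ℝ] X) (y : X) (n : horizon T → X) (t : horizon T) : X :=
  S ((t : ℝ≥0) : ℝ) y +
    ∫ s in Iic t, S (((t : ℝ≥0) : ℝ) - ((s : ℝ≥0) : ℝ)) (density n s) ∂(variationMeasure n)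

end Paths

/-! ### The control problem -/

section Control

variable {X : Type*} [NormedAddCommGroup X] [NormedSpace ℝ X] [PartialOrder X]
  {Ω : Type*} {mΩ : MeasurableSpace Ω} {T : ℝ≥0∞}

/-- The set `𝒮` of controls: adapted processes with values in the nonnegative cone, whose paths are
nondecreasing, right-continuous, and of finite variation on compact time intervals. -/
structure IsControl (F : Filtration (horizon T) mΩ) (P : Measure Ω)
    (ν : horizon T → Ω → X) : Prop where
  adapted : StronglyAdapted F ν
  nonneg : ∀ᵐ ω ∂P, ∀ t, 0 ≤ ν t ω
  monotone : ∀ᵐ ω ∂P, Monotone fun t => ν t ω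
  rightContinuous : ∀ᵐ ω ∂P, ∀ t, ContinuousWithinAt (fun s => ν s ω) (Ici t) t
  finiteVariation : ∀ᵐ ω ∂P, ∀ t, eVariationOn (fun s => ν s ω) (Iic t) ≠ ∞

/-- The cost `Φ`: an adapted càdlàg process with values in the nonnegative cone of the dual. -/
structure IsCostProcess (F : Filtration (horizon T) mΩ) (P : Measure Ω)
    (Φ : horizon T → Ω → X →L[ℝ] ℝ) : Prop where
  adapted : StronglyAdapted F Φ
  nonneg : ∀ᵐ ω ∂P, ∀ t v, 0 ≤ v → 0 ≤ Φ t ω v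
  rightContinuous : ∀ᵐ ω ∂P, ∀ t, ContinuousWithinAt (fun s => Φ s ω) (Ici t) t
  leftLimits : ∀ᵐ ω ∂P, ∀ t, ∃ l, Tendsto (fun s => Φ s ω) (𝓝[<] t) (𝓝 l)

/-- The set of nonnegative states `k` with `k ≥ e^{tA} y`. -/
def feasible (S : ℝ → X →L[ℝ] X) (y : X) (t : horizon T) : Set X :=
  {k | 0 ≤ k ∧ S ((t : ℝ≥0) : ℝ) y ≤ k}

/-- The standing assumptions on the running profit `Pi : Ω × [0,T] × K₊ → ℝ₊`
(only its values on the nonnegative cone `K₊` matter). -/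
structure IsRunningProfit (F : Filtration (horizon T) mΩ) (S : ℝ → X →L[ℝ] X) (y : X)
    (Pi : Ω → horizon T → X → ℝ) : Prop where
  measurable : @Measurable (Ω × horizon T × {k : X // 0 ≤ k}) ℝ
    (mΩ.prod (Subtype.instMeasurableSpace.prod (borel {k : X // 0 ≤ k}))) (borel ℝ)
    (fun z => Pi z.1 z.2.1 z.2.2)
  nonneg : ∀ ω t k, 0 ≤ k → 0 ≤ Pi ω t k
  concave : ∀ ω t, ConcaveOn ℝ {k | 0 ≤ k} (Pi ω t)
  monotone : ∀ ω t, MonotoneOn (Pi ω t) {k | 0 ≤ k}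
  contDiff : ∀ ω t, ContDiffOn ℝ 1 (Pi ω t) (feasible S y t)
  progressive : ∀ k, 0 ≤ k → IsProgressive F fun t ω => Pi ω t k

/-- The admissible controls for the cost `Φ`: those with `E[∫_0^T ⟨Φ t, dν t⟩] < ∞`. -/
def IsAdmissible (F : Filtration (horizon T) mΩ) (P : Measure Ω)
    (Φ : horizon T → Ω → X →L[ℝ] ℝ) (ν : horizon T → Ω → X) : Prop :=
  IsControl F P ν ∧ ∫⁻ ω, pairingIntegral (fun t => Φ t ω) (fun t => ν t ω) ∂P < ∞

/-- `E[∫_0^T Pi(t, Y t) q(dt) - ∫_0^T ⟨Φ t, dν t⟩]`. -/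
def netProfit (P : Measure Ω) (q : Measure (horizon T)) (Pi : Ω → horizon T → X → ℝ)
    (Y : horizon T → Ω → X) (Φ : horizon T → Ω → X →L[ℝ] ℝ) (ν : horizon T → Ω → X) : EReal :=
  extIntegral P fun ω =>
    ((∫⁻ t, ENNReal.ofReal (Pi ω t (Y t ω)) ∂q : ℝ≥0∞) : EReal) -
      ((pairingIntegral (fun t => Φ t ω) (fun t => ν t ω) : ℝ≥0∞) : EReal)

/-- The performance criterion `J(y, ν)` of the original problem. -/
def performance (P : Measure Ω) (q : Measure (horizon T)) (S : ℝ → X →L[ℝ] X) (y : X)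
    (Pi : Ω → horizon T → X → ℝ) (Φ : horizon T → Ω → X →L[ℝ] ℝ)
    (ν : horizon T → Ω → X) : EReal :=
  netProfit P q Pi (fun t ω => mildSolution S y (fun s => ν s ω) t) Φ ν

/-- The transformed cost `e^{tA*} Φ t`. -/
def hatCost (S : ℝ → X →L[ℝ] X) (Φ : horizon T → Ω → X →L[ℝ] ℝ) :
    horizon T → Ω → X →L[ℝ] ℝ :=
  fun t ω => (Φ t ω).comp (S ((t : ℝ≥0) : ℝ))

/-- The transformed state `e^{tA} (y + ν t)`. -/
def hatState (S : ℝ → X →L[ℝ] X) (y : X) (ν : horizon T → Ω → X) : horizon T → Ω → X :=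
  fun t ω => S ((t : ℝ≥0) : ℝ) (y + ν t ω)

/-- The performance criterion of the reformulated problem. -/
def hatPerformance (P : Measure Ω) (q : Measure (horizon T)) (S : ℝ → X →L[ℝ] X) (y : X)
    (Pi : Ω → horizon T → X → ℝ) (Φ : horizon T → Ω → X →L[ℝ] ℝ)
    (ν : horizon T → Ω → X) : EReal :=
  netProfit P q Pi (hatState S y ν) (hatCost S Φ) ν

/-- `ν` is optimal for the reformulated problem: it attains the supremum of the performance
criterion over the controls that are admissible for the transformed cost. -/
def IsHatOptimal (F : Filtration (horizon T) mΩ) (P : Measure Ω) (q : Measure (horizon T))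
    (S : ℝ → X →L[ℝ] X) (y : X) (Pi : Ω → horizon T → X → ℝ)
    (Φ : horizon T → Ω → X →L[ℝ] ℝ) (ν : horizon T → Ω → X) : Prop :=
  IsAdmissible F P (hatCost S Φ) ν ∧
    hatPerformance P q S y Pi Φ ν =
      ⨆ (η : horizon T → Ω → X) (_ : IsAdmissible F P (hatCost S Φ) η),
        hatPerformance P q S y Pi Φ η

/-- The gradient `∇Pi(t, k)` in the state variable, at a point `k ≥ e^{tA} y`, where `Pi(t, ·)` is
differentiable relative to the convex set `{k ≥ e^{tA} y}`; the derivative is unique since the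
feasible directions span the space. -/
def gradient (S : ℝ → X →L[ℝ] X) (y : X) (Pi : Ω → horizon T → X → ℝ) (ω : Ω) (t : horizon T)
    (k : X) : X →L[ℝ] ℝ :=
  fderivWithin ℝ (Pi ω t) (feasible S y t) k

/-- The marginal profit `∫_[s,T] e^{(t-s)A*} ∇Pi(t, e^{tA}(y + ν t)) q(dt)`, a priori only an
extended element of the nonnegative cone of the dual, i.e. given by its pairings in `[0, ∞]` with
nonnegative `v`. -/
def marginalProfit (q : Measure (horizon T)) (S : ℝ → X →L[ℝ] X) (y : X)
    (Pi : Ω → horizon T → X → ℝ) (ν : horizon T → Ω → X) :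
    horizon T → Ω → X → ℝ≥0∞ :=
  fun s ω v => ∫⁻ t in Ici s,
    ENNReal.ofReal (gradient S y Pi ω t (hatState S y ν t ω)
      (S (((t : ℝ≥0) : ℝ) - ((s : ℝ≥0) : ℝ)) v)) ∂q

/-- `g` is a version of the process `s ↦ E[G s | F s]`, where `G` (and `g`) take values in the
extended nonnegative cone of the dual, whose elements are given by their pairings in `[0, ∞]` with
nonnegative vectors.  As usual, the process of conditional expectations is the optional projection
(only this makes its integral against `dν` meaningful): `g` is progressively measurable and
`g τ = E[G τ | F τ]` on `{τ < ∞}` for each stopping time `τ`.  Both are stated through pairings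
with nonnegative vectors `V τ` known at time `τ`; taking `V = v 1_E` on `[τ, T]`, with `E` in
`F τ` and `v ≥ 0` fixed, gives `⟨g τ, v⟩ = E[⟨G τ, v⟩ | F τ]` on `{τ < ∞}`. -/
structure IsCondExpProcess (F : Filtration (horizon T) mΩ) (P : Measure Ω)
    (G g : horizon T → Ω → X → ℝ≥0∞) : Prop where
  progressive : ∀ V : horizon T → Ω → X, IsStronglyProgressive F V → (∀ s ω, 0 ≤ V s ω) →
    IsProgressive F fun s ω => g s ω (V s ω)
  stopping : ∀ V : horizon T → Ω → X, IsStronglyProgressive F V → (∀ s ω, 0 ≤ V s ω) →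
    ∀ τ : Ω → WithTop (horizon T), IsStoppingTime F τ →
      ∫⁻ ω in {ω | τ ω ≠ ⊤}, stoppedValue (fun s ω => g s ω (V s ω)) τ ω ∂P =
        ∫⁻ ω in {ω | τ ω ≠ ⊤}, stoppedValue (fun s ω => G s ω (V s ω)) τ ω ∂P

/-- `E[∫_0^T ⟨e^{sA*} g s - e^{sA*} Φ s, dν s⟩]`, where `⟨e^{sA*} g s, v⟩ = ⟨g s, e^{sA} v⟩`. -/
def focValue (P : Measure Ω) (S : ℝ → X →L[ℝ] X) (Φ : horizon T → Ω → X →L[ℝ] ℝ)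
    (g : horizon T → Ω → X → ℝ≥0∞) (ν : horizon T → Ω → X) : EReal :=
  extIntegral P fun ω =>
    extIntegral (variationMeasure fun t => ν t ω) fun s =>
      ((g s ω (S ((s : ℝ≥0) : ℝ) (density (fun t => ν t ω) s)) : ℝ≥0∞) : EReal) -
        ((hatCost S Φ s ω (density (fun t => ν t ω) s) : ℝ) : EReal)

end Control

end SingularControl

end

/-!
# First order conditions for singular control

For a control `ν` let `A ν` be its expected gain (`runningGain`), `B ν` its expected cost
(`expectedCost`), and `K ν` the derivative of the gain at the candidate `ν⋆` in the direction `ν`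
(`marginalGain`).  The performance of `ν` is `A ν - B ν` (`hatPerformance_eq`), where `A` is concave
and `B` is linear on the cone of controls, and the expectation in the first order condition is
`K ν - B ν` (`focValue_eq`).  The theorem is thus the variational inequality on a convex cone,
`forall_runningGain_le_iff`.  If `K ≤ B` with equality at `ν⋆`, then concavity,
`A ν + K ν⋆ ≤ A ν⋆ + K ν`, gives optimality.  Conversely, comparing `ν⋆` with `ν⋆ + c ν` gives
`K ν ≤ B ν` by Fatou's lemma (`marginalGain_le_of_forall`), and comparing it with `(1 - c) ν⋆` gives
`B ν⋆ ≤ K ν⋆` by dominated convergence (`le_marginalGain_of_forall`).  All gains involved are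
finite (`runningGain_ne_top`): `dν̃ = e^{sA} dν` defines a control `ν̃` of the original problem with
the same cost and the same state, and the performance of `ν̃` is finite by assumption.

What takes most of the work is that the integrals against `dν` behave as expected.

* Every control has a density `ρ`, with `dν = ρ d|ν|`, which can be chosen progressive
  (`IsRegularControl.exists_progressive_density`).  The dyadic difference quotients of `ν` with
  respect to `|ν|` form a martingale for `|ν|` on the time interval, bounded by `1`; uniform
  convexity of the norm of `Lᵖ` makes them converge in `L¹(|ν|)` on bounded intervals
  (`IsDominated.eventually_lintegral_dyadicQuot_sub_le`).  Along a sequence of meshes that does not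
  depend on the path they converge almost everywhere (`IsRegularControl.exists_mesh`), and the limit
  is progressive since the filtration is right-continuous.
* Pairings with `dν` do not depend on the measure with respect to which `ν` is represented
  (`IsRepresentation.lintegral_eq`), hence they are additive in `ν`.
* The process `g` is only known through its values at stopping times.  The time change by the levels
  of `t ↦ |ν| [0, t]` (`map_levelTime`) writes an integral against `d|ν|` as a mixture of
  evaluations at stopping times, so that `g` may be replaced by the process of which it is the
  optional projection (`IsAdaptedMeasure.lintegral_lintegral_congr`); Fubini's theorem then
  identifies the outcome as `K ν` (`lintegral_condExpProcess_eq`, `focValue_eq`).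

All this takes place in an abstract ordered Banach space `X`; only uniform convexity
(`uniformlyConvexNormPow_Lp`) is specific to `Lᵖ` with `1 < p < ∞`.
-/

noncomputable section

namespace SingularControl

/-! ### The dyadic grid on the time interval -/

section Grid

variable {T : ℝ≥0∞}

/-- The point `min x T` of `[0, T]`. -/
def clamp (T : ℝ≥0∞) (x : ℝ≥0) : horizon T :=
  if h : (x : ℝ≥0∞) ≤ T then ⟨x, h⟩ else ⟨T.toNNReal, ENNReal.coe_toNNReal_le_self⟩

lemma le_clamp_iff {s : horizon T} {x : ℝ≥0} : s ≤ clamp T x ↔ (s : ℝ≥0) ≤ x := by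
  unfold clamp
  split_ifs with h
  · exact Iff.rfl
  · have hs : (s : ℝ≥0∞) ≤ T := s.2
    have hT : T ≠ ∞ := fun h' => h (h' ▸ le_top)
    have h1 : (s : ℝ≥0) ≤ T.toNNReal := by
      rw [← ENNReal.coe_le_coe, ENNReal.coe_toNNReal hT]; exact hs
    refine ⟨fun _ => ?_, fun _ => h1⟩
    exact ENNReal.coe_le_coe.1 (hs.trans (not_le.1 h).le)

lemma clamp_mono : Monotone (clamp T) := fun _ _ h =>
  le_clamp_iff.2 ((le_clamp_iff.1 le_rfl).trans h)

lemma clamp_coe_le (x : ℝ≥0) : (clamp T x : ℝ≥0) ≤ x := le_clamp_iff.1 le_rfl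

/-- The point `min (k 2⁻ⁿ) T` of the dyadic grid of mesh `2⁻ⁿ`. -/
def gridPt (T : ℝ≥0∞) (n k : ℕ) : horizon T := clamp T (k / 2 ^ n)

/-- The index `k` of the cell `((k - 1) 2⁻ⁿ, k 2⁻ⁿ]` that contains `s`; the cell of index `0`
is `{0}`. -/
def cellIdx (n : ℕ) (s : horizon T) : ℕ := ⌈(s : ℝ≥0) * 2 ^ n⌉₊

lemma le_gridPt_iff {n k : ℕ} {s : horizon T} : s ≤ gridPt T n k ↔ cellIdx n s ≤ k := by
  rw [gridPt, le_clamp_iff, cellIdx, Nat.ceil_le, le_div_iff₀ (by positivity)]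

lemma gridPt_lt_iff {n k : ℕ} {s : horizon T} : gridPt T n k < s ↔ k < cellIdx n s := by
  rw [← not_le, le_gridPt_iff, not_le]

lemma gridPt_mono (n : ℕ) : Monotone (gridPt T n) := fun _ _ h =>
  clamp_mono (by gcongr)

lemma gridPt_zero (n : ℕ) : gridPt T n 0 = ⊥ := by
  apply le_antisymm _ bot_le
  have := clamp_coe_le (T := T) (((0 : ℕ) : ℝ≥0) / 2 ^ n)
  simp only [Nat.cast_zero, zero_div] at this
  simp only [gridPt, Nat.cast_zero, zero_div]
  exact this

lemma gridPt_refine {n n' : ℕ} (h : n ≤ n') (k : ℕ) :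
    gridPt T n k = gridPt T n' (k * 2 ^ (n' - n)) := by
  unfold gridPt
  congr 1
  obtain ⟨d, rfl⟩ := Nat.exists_eq_add_of_le h
  rw [Nat.add_sub_cancel_left, pow_add]
  push_cast
  field_simp

lemma clamp_natCast (n K : ℕ) : clamp T K = gridPt T n (K * 2 ^ n) := by
  unfold gridPt
  congr 1
  push_cast
  field_simp

lemma preimage_cellIdx_zero (n : ℕ) : cellIdx n ⁻¹' {0} = ({⊥} : Set (horizon T)) := by
  ext s
  rw [mem_preimage, mem_singleton_iff, mem_singleton_iff, ← Nat.le_zero, ← le_gridPt_iff,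
    gridPt_zero, le_bot_iff]

lemma preimage_cellIdx_succ (n k : ℕ) :
    cellIdx n ⁻¹' {k + 1} = Ioc (gridPt T n k) (gridPt T n (k + 1)) := by
  ext s
  rw [mem_preimage, mem_singleton_iff, mem_Ioc, gridPt_lt_iff, le_gridPt_iff]
  omega

lemma Iic_gridPt (n k : ℕ) : Iic (gridPt T n k) = cellIdx n ⁻¹' Iic k := by
  ext s; exact le_gridPt_iff

lemma measurable_cellIdx (n : ℕ) : Measurable (cellIdx n : horizon T → ℕ) := by
  refine measurable_of_Iic fun k => ?_
  rw [← Iic_gridPt]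
  exact measurableSet_Iic

/-- The right end point of the cell of `s` in the dyadic grid of mesh `2⁻ⁿ`. -/
def roundUp (n : ℕ) (s : horizon T) : horizon T := gridPt T n (cellIdx n s)

lemma le_roundUp (n : ℕ) (s : horizon T) : s ≤ roundUp n s := le_gridPt_iff.2 le_rfl

lemma roundUp_mono (n : ℕ) : Monotone (roundUp n : horizon T → horizon T) := fun _ t h =>
  gridPt_mono n (le_gridPt_iff.1 (h.trans (le_roundUp n t)))

lemma roundUp_coe_le (n : ℕ) (s : horizon T) :
    (roundUp n s : ℝ≥0) ≤ (s : ℝ≥0) + 1 / 2 ^ n := by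
  refine (clamp_coe_le _).trans ?_
  have h : ((cellIdx n s : ℕ) : ℝ≥0) ≤ (s : ℝ≥0) * 2 ^ n + 1 :=
    (Nat.ceil_lt_add_one (by positivity)).le
  calc ((cellIdx n s : ℕ) : ℝ≥0) / 2 ^ n ≤ ((s : ℝ≥0) * 2 ^ n + 1) / 2 ^ n := by gcongr
    _ = _ := by field_simp

lemma tendsto_roundUp (s : horizon T) : Tendsto (fun n => roundUp n s) atTop (𝓝[≥] s) := by
  rw [tendsto_nhdsWithin_iff]
  refine ⟨?_, Eventually.of_forall fun n => le_roundUp n s⟩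
  rw [tendsto_subtype_rng]
  have h : Tendsto (fun n : ℕ => (s : ℝ≥0) + 1 / 2 ^ n) atTop (𝓝 ((s : ℝ≥0) + 0)) := by
    refine tendsto_const_nhds.add ?_
    have := tendsto_pow_atTop_nhds_zero_of_lt_one (r := (1 / 2 : ℝ≥0)) (by positivity)
      (by rw [← NNReal.coe_lt_coe]; norm_num)
    simpa [div_pow] using this
  rw [add_zero] at h
  exact tendsto_of_tendsto_of_tendsto_of_le_of_le tendsto_const_nhds h
    (fun n => le_roundUp n s) (fun n => roundUp_coe_le n s)

lemma tendsto_clamp_add (t : horizon T) :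
    Tendsto (fun N : ℕ => clamp T ((t : ℝ≥0) + 1 / 2 ^ N)) atTop (𝓝[≥] t) := by
  rw [tendsto_nhdsWithin_iff]
  refine ⟨?_, Eventually.of_forall fun N => le_clamp_iff.2 (le_add_right le_rfl)⟩
  rw [tendsto_subtype_rng]
  have hlim : Tendsto (fun N : ℕ => (t : ℝ≥0) + 1 / 2 ^ N) atTop (𝓝 ((t : ℝ≥0) + 0)) := by
    refine tendsto_const_nhds.add ?_
    have := tendsto_pow_atTop_nhds_zero_of_lt_one (r := (1 / 2 : ℝ≥0)) (by positivity)
      (by rw [← NNReal.coe_lt_coe]; norm_num)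
    simpa [div_pow] using this
  rw [add_zero] at hlim
  exact tendsto_of_tendsto_of_tendsto_of_le_of_le tendsto_const_nhds hlim
    (fun N => show t ≤ _ from le_clamp_iff.2 (le_add_right le_rfl)) (fun N => clamp_coe_le _)

lemma roundUp_le_clamp_add {n N : ℕ} (h : N ≤ n) (t : horizon T) :
    roundUp n t ≤ clamp T ((t : ℝ≥0) + 1 / 2 ^ N) := by
  refine le_clamp_iff.2 ((roundUp_coe_le n t).trans ?_)
  gcongr
  norm_num

lemma exists_le_clamp_natCast (s : horizon T) : ∃ N : ℕ, ∀ n, N ≤ n → s ≤ clamp T n := by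
  obtain ⟨N, hN⟩ := exists_nat_ge (s : ℝ≥0)
  exact ⟨N, fun n hn => le_clamp_iff.2 (hN.trans (by exact_mod_cast hn))⟩

lemma iUnion_Iic_clamp : (⋃ n : ℕ, Iic (clamp T n)) = univ := by
  refine eq_univ_of_forall fun s => ?_
  obtain ⟨N, hN⟩ := exists_le_clamp_natCast s
  exact mem_iUnion.2 ⟨N, hN N le_rfl⟩

end Grid

/-! ### Right-continuous filtrations -/

section Filtration

variable {T : ℝ≥0∞} {Ω : Type*} {mΩ : MeasurableSpace Ω} {F : Filtration (horizon T) mΩ}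

/-- For a right-continuous filtration, `F t` contains every event that is known at all times of a
sequence tending to `t` from the right. -/
lemma measurableSet_of_tendsto (hF : F.IsRightContinuous) {t : horizon T} {u : ℕ → horizon T}
    (hu : Tendsto u atTop (𝓝[≥] t)) {A : Set Ω} (hA : ∀ᶠ n in atTop, MeasurableSet[F (u n)] A) :
    MeasurableSet[F t] A := by
  rw [tendsto_nhdsWithin_iff] at hu
  by_cases ht : IsMax t
  · obtain ⟨n, hn, hn'⟩ := (hA.and hu.2).exists
    rwa [le_antisymm (ht hn') hn'] at hn
  · apply hF.measurableSet
    rw [Filtration.rightCont_eq_of_not_isMax _ ht]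
    rw [MeasurableSpace.measurableSet_iInf]
    intro j
    rw [MeasurableSpace.measurableSet_iInf]
    intro hj
    obtain ⟨n, hn, hn'⟩ := (hA.and (hu.1.eventually_lt_const hj)).exists
    exact F.mono hn'.le _ hn

lemma measurable_of_tendsto_right (hF : F.IsRightContinuous) {t : horizon T} {u : ℕ → horizon T}
    (hu : Tendsto u atTop (𝓝[≥] t)) {β : Type*} [MeasurableSpace β] {f : Ω → β}
    (hf : ∀ᶠ n in atTop, Measurable[F (u n)] f) : Measurable[F t] f := fun _ hs =>
  measurableSet_of_tendsto hF hu (hf.mono fun _ hn => hn hs)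

lemma stronglyMeasurable_of_tendsto_right (hF : F.IsRightContinuous) {t : horizon T}
    {u : ℕ → horizon T} (hu : Tendsto u atTop (𝓝[≥] t)) {β : Type*} [TopologicalSpace β]
    [TopologicalSpace.PseudoMetrizableSpace β] {f : Ω → β}
    (hf : ∀ᶠ n in atTop, StronglyMeasurable[F (u n)] f) : StronglyMeasurable[F t] f := by
  borelize β
  rw [stronglyMeasurable_iff_measurable_separable]
  obtain ⟨n, hn⟩ := hf.exists
  exact ⟨measurable_of_tendsto_right hF hu (hf.mono fun _ hn => hn.measurable),
    hn.isSeparable_range⟩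

end Filtration

/-- A family of strongly measurable functions indexed by a natural number, evaluated at a
measurable index. -/
lemma stronglyMeasurable_of_nat_index {α β γ : Type*} {mα : MeasurableSpace α}
    {mγ : MeasurableSpace γ} [TopologicalSpace β] [TopologicalSpace.PseudoMetrizableSpace β]
    {h : ℕ → γ → β} (hh : ∀ k, StronglyMeasurable (h k)) {i : α → ℕ} (hi : Measurable i)
    {f : α → γ} (hf : Measurable f) : StronglyMeasurable fun a => h (i a) (f a) := by
  borelize β
  rw [stronglyMeasurable_iff_measurable_separable]
  constructor
  · have : Measurable fun z : ℕ × γ => h z.1 z.2 :=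
      measurable_from_prod_countable_right fun k => (hh k).measurable
    exact this.comp (hi.prodMk hf)
  · refine (TopologicalSpace.IsSeparable.iUnion fun k => (hh k).isSeparable_range).mono ?_
    rintro _ ⟨a, rfl⟩
    exact mem_iUnion.2 ⟨i a, f a, rfl⟩

/-! ### Uniform convexity of `Lᵖ` -/

/-- Uniform convexity of the function `‖·‖ʳ` on the nonnegative part of the unit ball. -/
def UniformlyConvexNormPow (X : Type*) [NormedAddCommGroup X] [NormedSpace ℝ X] [PartialOrder X]
    (r : ℝ) : Prop :=
  ∀ ε > 0, ∃ δ > 0, ∀ f g : X, 0 ≤ f → 0 ≤ g → ‖f‖ ≤ 1 → ‖g‖ ≤ 1 → ε ≤ ‖f - g‖ →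
    ‖(1 / 2 : ℝ) • (f + g)‖ ^ r + δ ≤ (‖f‖ ^ r + ‖g‖ ^ r) / 2

lemma half_add_rpow_lt {r : ℝ} (hr : 1 < r) {t : ℝ} (ht : 0 ≤ t) (ht1 : t ≠ 1) :
    ((1 + t) / 2) ^ r < (1 + t ^ r) / 2 := by
  have h := (strictConvexOn_rpow hr).2 (show (1 : ℝ) ∈ Ici 0 by simp) (mem_Ici.2 ht) ht1.symm
    (show (0 : ℝ) < 1 / 2 by norm_num) (show (0 : ℝ) < 1 / 2 by norm_num) (by norm_num)
  simp only [smul_eq_mul, Real.one_rpow] at h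
  calc ((1 + t) / 2) ^ r = (1 / 2 * 1 + 1 / 2 * t) ^ r := by ring_nf
    _ < _ := h
    _ = _ := by ring

/-- The modulus of convexity of `a ↦ aʳ`, which by homogeneity and compactness is uniform over all
pairs of comparable distance. -/
lemma exists_rpow_modulus {r : ℝ} (hr : 1 < r) {η : ℝ} (hη : 0 < η) :
    ∃ δ > 0, ∀ a b : ℝ, 0 ≤ b → b ≤ a → η * a ≤ a - b →
      ((a + b) / 2) ^ r + δ * (a ^ r + b ^ r) ≤ (a ^ r + b ^ r) / 2 := by
  have hr0 : 0 < r := by linarith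
  let φ : ℝ → ℝ := fun t => (1 + t ^ r) / 2 - ((1 + t) / 2) ^ r
  have hφ : Continuous φ := by
    have h1 : Continuous fun t : ℝ => t ^ r := continuous_id.rpow_const fun _ => Or.inr hr0.le
    have h2 : Continuous fun t : ℝ => ((1 + t) / 2) ^ r :=
      (by fun_prop : Continuous fun t : ℝ => (1 + t) / 2).rpow_const fun _ => Or.inr hr0.le
    exact ((continuous_const.add h1).div_const _).sub h2
  obtain ⟨δ, hδ, hmin⟩ : ∃ δ > 0, ∀ t ∈ Icc (0 : ℝ) (1 - η), δ ≤ φ t := by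
    rcases (Icc (0 : ℝ) (1 - η)).eq_empty_or_nonempty with h | h
    · exact ⟨1, one_pos, by simp [h]⟩
    · obtain ⟨t, ht, hmin⟩ := isCompact_Icc.exists_isMinOn h hφ.continuousOn
      refine ⟨φ t, sub_pos.2 (half_add_rpow_lt hr ht.1 (by linarith [ht.2])), fun s hs => hmin hs⟩
  refine ⟨δ / 2, half_pos hδ, fun a b hb hba hab => ?_⟩
  rcases (hb.trans hba).eq_or_lt with rfl | ha
  · obtain rfl : b = 0 := le_antisymm hba hb
    simp [Real.zero_rpow hr0.ne']
  · have ht0 : 0 ≤ b / a := by positivity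
    have ht : b / a ∈ Icc (0 : ℝ) (1 - η) := ⟨ht0, by
      rw [div_le_iff₀ ha]; linarith⟩
    have h1 : b / a ≤ 1 := (div_le_one ha).2 hba
    have key := hmin _ ht
    have h2 : (b / a) ^ r ≤ 1 := Real.rpow_le_one ht0 h1 hr0.le
    have h3 : (b / a) ^ r = b ^ r / a ^ r := Real.div_rpow hb ha.le r
    have h4 : ((1 + b / a) / 2) ^ r = ((a + b) / 2) ^ r / a ^ r := by
      rw [← Real.div_rpow (by positivity) ha.le]
      congr 1
      field_simp
    have har : 0 < a ^ r := Real.rpow_pos_of_pos ha r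
    simp only [φ] at key
    rw [h4, h3] at key
    rw [h3, div_le_one har] at h2
    have key' : δ * a ^ r ≤ (a ^ r + b ^ r) / 2 - ((a + b) / 2) ^ r := by
      have := mul_le_mul_of_nonneg_right key har.le
      calc δ * a ^ r ≤ _ := this
        _ = _ := by field_simp
    nlinarith

/-- A form of the modulus of convexity that can be integrated. -/
lemma exists_rpow_modulus' {r : ℝ} (hr : 1 < r) {η : ℝ} (hη : 0 < η) :
    ∃ δ > 0, ∀ a b : ℝ, 0 ≤ a → 0 ≤ b →
      ((a + b) / 2) ^ r + δ * (|a - b| ^ r - η ^ r * (a ^ r + b ^ r)) ≤ (a ^ r + b ^ r) / 2 := by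
  have hr0 : 0 < r := by linarith
  obtain ⟨δ, hδ, h⟩ := exists_rpow_modulus hr hη
  refine ⟨δ, hδ, ?_⟩
  have main : ∀ a b : ℝ, 0 ≤ b → b ≤ a →
      ((a + b) / 2) ^ r + δ * (|a - b| ^ r - η ^ r * (a ^ r + b ^ r)) ≤ (a ^ r + b ^ r) / 2 := by
    intro a b hb hba
    have ha := hb.trans hba
    have har : 0 ≤ a ^ r := Real.rpow_nonneg ha r
    have hbr : 0 ≤ b ^ r := Real.rpow_nonneg hb r
    have hηr : 0 ≤ η ^ r := Real.rpow_nonneg hη.le r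
    have hsub : 0 ≤ a - b := sub_nonneg.2 hba
    rw [abs_of_nonneg hsub]
    by_cases hE : η * a ≤ a - b
    · have h1 : (a - b) ^ r ≤ a ^ r := Real.rpow_le_rpow hsub (by linarith) hr0.le
      have h2 := h a b hb hba hE
      have h3 : (a - b) ^ r - η ^ r * (a ^ r + b ^ r) ≤ a ^ r + b ^ r := by
        nlinarith [mul_nonneg hηr (add_nonneg har hbr)]
      nlinarith [mul_le_mul_of_nonneg_left h3 hδ.le]
    · have h1 : (a - b) ^ r ≤ η ^ r * a ^ r := by
        rw [← Real.mul_rpow hη.le ha]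
        exact Real.rpow_le_rpow hsub (not_le.1 hE).le hr0.le
      have h2 : ((a + b) / 2) ^ r ≤ (a ^ r + b ^ r) / 2 := by
        have h := (convexOn_rpow hr.le).2 (mem_Ici.2 ha) (mem_Ici.2 hb)
          (show (0 : ℝ) ≤ 1 / 2 by norm_num) (show (0 : ℝ) ≤ 1 / 2 by norm_num) (by norm_num)
        simp only [smul_eq_mul] at h
        calc ((a + b) / 2) ^ r = (1 / 2 * a + 1 / 2 * b) ^ r := by ring_nf
          _ ≤ _ := h
          _ = _ := by ring
      have h3 : (a - b) ^ r - η ^ r * (a ^ r + b ^ r) ≤ 0 := by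
        nlinarith [mul_nonneg hηr hbr]
      nlinarith [mul_nonneg_of_nonpos_of_nonpos h3 (neg_nonpos.2 hδ.le)]
  intro a b ha hb
  rcases le_total b a with hba | hab
  · exact main a b hb hba
  · have := main b a ha hab
    rw [abs_sub_comm, add_comm a b, add_comm (a ^ r)]
    exact this

section Lp

variable {D : Type*} [MeasurableSpace D] {μ : Measure D} {p : ℝ≥0∞}

lemma integrable_abs_rpow (hp0 : p ≠ 0) (hp_top : p ≠ ∞) (f : Lp ℝ p μ) :
    Integrable (fun x => |f x| ^ p.toReal) μ :=
  (Lp.memLp f).integrable_norm_rpow hp0 hp_top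

lemma norm_rpow_eq_integral (hp0 : p ≠ 0) (hp_top : p ≠ ∞) (f : Lp ℝ p μ) :
    ‖f‖ ^ p.toReal = ∫ x, |f x| ^ p.toReal ∂μ := by
  have hp : 0 < p.toReal := ENNReal.toReal_pos hp0 hp_top
  have h0 : 0 ≤ ∫ x, |f x| ^ p.toReal ∂μ :=
    integral_nonneg fun x => Real.rpow_nonneg (abs_nonneg _) _
  rw [Lp.norm_def, (Lp.memLp f).eLpNorm_eq_integral_rpow_norm hp0 hp_top,
    ENNReal.toReal_ofReal (Real.rpow_nonneg (by exact h0) _), Real.rpow_inv_rpow (by exact h0) hp.ne']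
  rfl

lemma uniformlyConvexNormPow_Lp [Fact (1 ≤ p)] (hp_one : 1 < p) (hp_top : p ≠ ∞) :
    UniformlyConvexNormPow (Lp ℝ p μ) p.toReal := by
  have hp0 : p ≠ 0 := (zero_lt_one.trans hp_one).ne'
  have hr : 1 < p.toReal := by
    rw [← ENNReal.toReal_one]; exact (ENNReal.toReal_lt_toReal (by simp) hp_top).2 hp_one
  have hN : ∀ f : Lp ℝ p μ, ‖f‖ ^ p.toReal = ∫ x, |f x| ^ p.toReal ∂μ :=
    norm_rpow_eq_integral hp0 hp_top
  have hI : ∀ f : Lp ℝ p μ, Integrable (fun x => |f x| ^ p.toReal) μ :=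
    integrable_abs_rpow hp0 hp_top
  generalize p.toReal = r at hr hN hI ⊢
  have hr0 : 0 < r := by linarith
  intro ε hε
  have hεr : 0 < ε ^ r := Real.rpow_pos_of_pos hε r
  -- `η` is chosen with `2 ηʳ = εʳ / 2`
  obtain ⟨η, hη, hηr⟩ : ∃ η : ℝ, 0 < η ∧ η ^ r = ε ^ r / 4 :=
    ⟨(ε ^ r / 4) ^ r⁻¹, by positivity, Real.rpow_inv_rpow (by positivity) hr0.ne'⟩
  obtain ⟨δ, hδ, h⟩ := exists_rpow_modulus' hr hη
  refine ⟨δ * (ε ^ r / 2), by positivity, fun f g hf hg hf1 hg1 hfg => ?_⟩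
  have key : ‖(1 / 2 : ℝ) • (f + g)‖ ^ r + δ * (‖f - g‖ ^ r - η ^ r * (‖f‖ ^ r + ‖g‖ ^ r)) ≤
      (‖f‖ ^ r + ‖g‖ ^ r) / 2 := by
    have I1 : Integrable (fun x => |f x| ^ r + |g x| ^ r) μ := (hI f).add (hI g)
    have I2 : Integrable (fun x => |(f - g : Lp ℝ p μ) x| ^ r - η ^ r * (|f x| ^ r + |g x| ^ r)) μ :=
      (hI (f - g)).sub (I1.const_mul _)
    have e1 : (‖f‖ ^ r + ‖g‖ ^ r) / 2 = ∫ x, (|f x| ^ r + |g x| ^ r) / 2 ∂μ := by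
      rw [integral_div, integral_add (hI f) (hI g), hN, hN]
    have e2 : ‖(1 / 2 : ℝ) • (f + g)‖ ^ r + δ * (‖f - g‖ ^ r - η ^ r * (‖f‖ ^ r + ‖g‖ ^ r)) =
        ∫ x, (|((1 / 2 : ℝ) • (f + g) : Lp ℝ p μ) x| ^ r +
          δ * (|(f - g : Lp ℝ p μ) x| ^ r - η ^ r * (|f x| ^ r + |g x| ^ r))) ∂μ := by
      rw [integral_add (hI _) (I2.const_mul _), integral_const_mul,
        integral_sub (hI _) (I1.const_mul _), integral_const_mul, integral_add (hI f) (hI g),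
        hN, hN, hN, hN]
    rw [e1, e2]
    refine integral_mono_ae ((hI _).add (I2.const_mul _)) (I1.div_const _) ?_
    have hf' := (Lp.coeFn_nonneg f).2 hf
    have hg' := (Lp.coeFn_nonneg g).2 hg
    filter_upwards [hf', hg', Lp.coeFn_sub f g, Lp.coeFn_smul (1 / 2 : ℝ) (f + g),
      Lp.coeFn_add f g] with x h1 h2 h3 h4 h5
    have h1' : 0 ≤ f x := h1
    have h2' : 0 ≤ g x := h2
    have := h (f x) (g x) h1' h2'
    simp only [Pi.add_apply, Pi.sub_apply, Pi.smul_apply, smul_eq_mul] at *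
    rw [h3, h4, h5, abs_of_nonneg h1', abs_of_nonneg h2',
      abs_of_nonneg (by positivity : 0 ≤ 1 / 2 * (f x + g x)),
      show 1 / 2 * (f x + g x) = (f x + g x) / 2 by ring]
    exact this
  have h1 : ‖f‖ ^ r ≤ 1 := Real.rpow_le_one (norm_nonneg _) hf1 hr0.le
  have h2 : ‖g‖ ^ r ≤ 1 := Real.rpow_le_one (norm_nonneg _) hg1 hr0.le
  have h3 : ε ^ r ≤ ‖f - g‖ ^ r := Real.rpow_le_rpow hε.le hfg hr0.le
  have h4 : ε ^ r / 2 ≤ ‖f - g‖ ^ r - η ^ r * (‖f‖ ^ r + ‖g‖ ^ r) := by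
    rw [hηr]; nlinarith
  nlinarith [mul_le_mul_of_nonneg_left h4 hδ.le]

lemma isOrderedModule_Lp [Fact (1 ≤ p)] : IsOrderedModule ℝ (Lp ℝ p μ) := by
  have h : ∀ (c : ℝ) (f : Lp ℝ p μ), 0 ≤ c → 0 ≤ f → 0 ≤ c • f := by
    intro c f hc hf
    rw [← Lp.coeFn_nonneg] at hf ⊢
    filter_upwards [hf, Lp.coeFn_smul c f] with x h1 h2
    rw [h2]
    exact mul_nonneg hc h1
  refine IsOrderedModule.of_smul_nonneg fun c hc f hf => h c f hc hf

end Lp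

/-! ### Dyadic difference quotients of a path -/

lemma integrableOn_of_bound {α E : Type*} [MeasurableSpace α] {m : Measure α}
    [NormedAddCommGroup E] {f : α → E} (hf : StronglyMeasurable f) {C : ℝ} (hC : ∀ s, ‖f s‖ ≤ C)
    {A : Set α} (hA : m A < ∞) : IntegrableOn f A m :=
  ⟨hf.aestronglyMeasurable, HasFiniteIntegral.restrict_of_bounded C hA (Eventually.of_forall hC)⟩

section Quotients

variable {X : Type*} [NormedAddCommGroup X] {T : ℝ≥0∞}

/-- The locally finite measure `m` dominates the increments of the path `n`, where `n(0-) = 0`. -/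
structure IsDominated (n : horizon T → X) (m : Measure (horizon T)) : Prop where
  finite : ∀ t, m (Iic t) < ∞
  bot_le : ‖n ⊥‖ₑ ≤ m {⊥}
  sub_le : ∀ a b, a ≤ b → ‖n b - n a‖ₑ ≤ m (Ioc a b)

/-- The increment of a path over a cell of the dyadic grid. -/
def cellIncr (n : horizon T → X) (N : ℕ) : ℕ → X
  | 0 => n ⊥
  | k + 1 => n (gridPt T N (k + 1)) - n (gridPt T N k)

variable [NormedSpace ℝ X]

/-- The quotient of the increment of a path and of the mass over a cell.  On a cell of mass `0` the
quotient is `0`, which is harmless as the increment vanishes there as well. -/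
def cellQuot (m : Measure (horizon T)) (n : horizon T → X) (N k : ℕ) : X :=
  (m (cellIdx N ⁻¹' {k})).toReal⁻¹ • cellIncr n N k

/-- The dyadic difference quotient, constant on the cells of the grid. -/
def dyadicQuot (m : Measure (horizon T)) (n : horizon T → X) (N : ℕ) (s : horizon T) : X :=
  cellQuot m n N (cellIdx N s)

lemma stronglyMeasurable_dyadicQuot (m : Measure (horizon T)) (n : horizon T → X) (N : ℕ) :
    StronglyMeasurable (dyadicQuot m n N) :=
  stronglyMeasurable_of_nat_index (h := fun k (_ : horizon T) => cellQuot m n N k)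
    (fun _ => stronglyMeasurable_const) (measurable_cellIdx N) (f := id) measurable_id

lemma measurableSet_cell (N k : ℕ) : MeasurableSet (cellIdx N ⁻¹' {k} : Set (horizon T)) :=
  measurable_cellIdx N (measurableSet_singleton k)

lemma Iic_gridPt_succ (N k : ℕ) :
    Iic (gridPt T N (k + 1)) = Iic (gridPt T N k) ∪ cellIdx N ⁻¹' {k + 1} := by
  rw [preimage_cellIdx_succ, Iic_union_Ioc_eq_Iic (gridPt_mono N (Nat.le_succ k))]

lemma disjoint_Iic_cell (N k : ℕ) :
    Disjoint (Iic (gridPt T N k)) (cellIdx N ⁻¹' {k + 1}) := by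
  rw [preimage_cellIdx_succ]
  exact Set.disjoint_left.2 fun s hs hs' => hs'.1.not_ge hs

lemma Iic_gridPt_zero (N : ℕ) : Iic (gridPt T N 0) = cellIdx N ⁻¹' {0} := by
  rw [preimage_cellIdx_zero, gridPt_zero, Iic_bot]

lemma dyadicQuot_nonneg [PartialOrder X] [IsOrderedAddMonoid X] [IsOrderedModule ℝ X]
    {m : Measure (horizon T)} {n : horizon T → X} (h0 : 0 ≤ n ⊥) (hn : Monotone n) (N : ℕ)
    (s : horizon T) : 0 ≤ dyadicQuot m n N s := by
  refine smul_nonneg (inv_nonneg.2 ENNReal.toReal_nonneg) ?_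
  rcases cellIdx N s with _ | k
  · exact h0
  · exact sub_nonneg.2 (hn (gridPt_mono N (Nat.le_succ k)))

variable {m : Measure (horizon T)} {n : horizon T → X}

namespace IsDominated

variable (h : IsDominated n m)

include h

omit [NormedSpace ℝ X] in
lemma cell_lt_top (N k : ℕ) : m (cellIdx N ⁻¹' {k}) < ∞ := by
  refine (measure_mono ?_).trans_lt (h.finite (gridPt T N k))
  rw [Iic_gridPt]
  exact preimage_mono (by simp)

omit [NormedSpace ℝ X] in
lemma norm_cellIncr_le (N k : ℕ) : ‖cellIncr n N k‖ ≤ (m (cellIdx N ⁻¹' {k})).toReal := by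
  rw [← toReal_enorm]
  refine ENNReal.toReal_mono (h.cell_lt_top N k).ne ?_
  rcases k with _ | k
  · rw [preimage_cellIdx_zero]
    exact h.bot_le
  · rw [preimage_cellIdx_succ]
    exact h.sub_le _ _ (gridPt_mono N (Nat.le_succ k))

lemma norm_dyadicQuot_le (N : ℕ) (s : horizon T) : ‖dyadicQuot m n N s‖ ≤ 1 := by
  unfold dyadicQuot cellQuot
  rw [norm_smul, norm_inv, Real.norm_of_nonneg ENNReal.toReal_nonneg]
  exact inv_mul_le_one_of_le₀ (h.norm_cellIncr_le _ _) ENNReal.toReal_nonneg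

lemma integrableOn_dyadicQuot (N : ℕ) {A : Set (horizon T)} (hA : m A < ∞) :
    IntegrableOn (dyadicQuot m n N) A m :=
  integrableOn_of_bound (stronglyMeasurable_dyadicQuot m n N) (h.norm_dyadicQuot_le N) hA

lemma smul_cellQuot (N k : ℕ) :
    (m (cellIdx N ⁻¹' {k})).toReal • cellQuot m n N k = cellIncr n N k := by
  unfold cellQuot
  rcases eq_or_ne (m (cellIdx N ⁻¹' {k})).toReal 0 with h0 | h0
  · have := h.norm_cellIncr_le N k
    rw [h0] at this ⊢
    rw [zero_smul, norm_le_zero_iff.1 this]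
  · rw [smul_inv_smul₀ h0]

lemma setIntegral_cell_dyadicQuot (N k : ℕ) [CompleteSpace X] :
    ∫ s in cellIdx N ⁻¹' {k}, dyadicQuot m n N s ∂m = cellIncr n N k := by
  have : ∫ s in cellIdx N ⁻¹' {k}, dyadicQuot m n N s ∂m =
      ∫ s in cellIdx N ⁻¹' {k}, cellQuot m n N k ∂m := by
    refine setIntegral_congr_fun (measurableSet_cell N k) fun s hs => ?_
    rw [mem_preimage, mem_singleton_iff] at hs
    simp only [dyadicQuot, hs]
  rw [this, setIntegral_const]
  exact h.smul_cellQuot N k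

lemma setIntegral_Iic_dyadicQuot [CompleteSpace X] (N k : ℕ) :
    ∫ s in Iic (gridPt T N k), dyadicQuot m n N s ∂m = n (gridPt T N k) := by
  induction k with
  | zero =>
    rw [Iic_gridPt_zero, h.setIntegral_cell_dyadicQuot, gridPt_zero]
    rfl
  | succ k ih =>
    rw [Iic_gridPt_succ, setIntegral_union (disjoint_Iic_cell N k) (measurableSet_cell N _)
      (h.integrableOn_dyadicQuot N (h.finite _)) (h.integrableOn_dyadicQuot N (h.cell_lt_top _ _)),
      ih, h.setIntegral_cell_dyadicQuot]
    simp [cellIncr]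

/-- The martingale property of the dyadic difference quotients. -/
lemma setIntegral_cell_dyadicQuot_of_le [CompleteSpace X] {N N' : ℕ} (hN : N ≤ N') (k : ℕ) :
    ∫ s in cellIdx N ⁻¹' {k}, dyadicQuot m n N' s ∂m = cellIncr n N k := by
  have hI : ∀ k, ∫ s in Iic (gridPt T N k), dyadicQuot m n N' s ∂m = n (gridPt T N k) := by
    intro k
    rw [gridPt_refine hN, h.setIntegral_Iic_dyadicQuot]
  rcases k with _ | k
  · rw [← Iic_gridPt_zero, hI, gridPt_zero]
    rfl
  · have := hI (k + 1)
    rw [Iic_gridPt_succ, setIntegral_union (disjoint_Iic_cell N k) (measurableSet_cell N _)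
      (h.integrableOn_dyadicQuot N' (h.finite _))
      (h.integrableOn_dyadicQuot N' (h.cell_lt_top _ _)), hI] at this
    rw [cellIncr, ← this, add_sub_cancel_left]

end IsDominated

lemma convexOn_norm_rpow {r : ℝ} (hr : 1 ≤ r) : ConvexOn ℝ univ fun x : X => ‖x‖ ^ r := by
  refine ⟨convex_univ, fun x _ y _ a b ha hb hab => ?_⟩
  have h := (convexOn_rpow hr).2 (mem_Ici.2 (norm_nonneg x)) (mem_Ici.2 (norm_nonneg y)) ha hb hab
  refine le_trans (Real.rpow_le_rpow (norm_nonneg _) ?_ (by linarith)) h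
  refine (norm_add_le _ _).trans ?_
  rw [norm_smul, norm_smul, Real.norm_of_nonneg ha, Real.norm_of_nonneg hb, smul_eq_mul,
    smul_eq_mul]

omit [NormedSpace ℝ X] in
lemma integrableOn_norm_rpow {r : ℝ} (hr : 1 ≤ r) {f : horizon T → X} (hf : StronglyMeasurable f)
    (hf1 : ∀ s, ‖f s‖ ≤ 1) {A : Set (horizon T)} (hA : m A < ∞) :
    IntegrableOn (fun s => ‖f s‖ ^ r) A m := by
  refine integrableOn_of_bound (C := 1) ?_ (fun s => ?_) hA
  · exact (hf.norm.measurable.pow_const r).stronglyMeasurable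
  · rw [Real.norm_of_nonneg (Real.rpow_nonneg (norm_nonneg _) _)]
    exact Real.rpow_le_one (norm_nonneg _) (hf1 s) (by linarith)

namespace IsDominated

variable (h : IsDominated n m) {r : ℝ}

include h

/-- Jensen's inequality on the cells of the grid: `D_N` minimizes `∫ ‖f‖ʳ` among all `f` that have
the same integrals over the cells. -/
lemma setIntegral_norm_rpow_le [CompleteSpace X] (hr : 1 ≤ r) (N : ℕ) {f : horizon T → X}
    (hf : StronglyMeasurable f) (hf1 : ∀ s, ‖f s‖ ≤ 1)
    (hcell : ∀ k, ∫ s in cellIdx N ⁻¹' {k}, f s ∂m = cellIncr n N k) (k : ℕ) :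
    ∫ s in Iic (gridPt T N k), ‖dyadicQuot m n N s‖ ^ r ∂m ≤
      ∫ s in Iic (gridPt T N k), ‖f s‖ ^ r ∂m := by
  have hD := stronglyMeasurable_dyadicQuot m n N
  have cell : ∀ k, ∫ s in cellIdx N ⁻¹' {k}, ‖dyadicQuot m n N s‖ ^ r ∂m ≤
      ∫ s in cellIdx N ⁻¹' {k}, ‖f s‖ ^ r ∂m := by
    intro k
    have e : ∫ s in cellIdx N ⁻¹' {k}, ‖dyadicQuot m n N s‖ ^ r ∂m =
        (m (cellIdx N ⁻¹' {k})).toReal • ‖cellQuot m n N k‖ ^ r := by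
      rw [← measureReal_def, ← setIntegral_const]
      refine setIntegral_congr_fun (measurableSet_cell N k) fun s hs => ?_
      rw [mem_preimage, mem_singleton_iff] at hs
      simp only [dyadicQuot, hs]
    rw [e]
    rcases eq_or_ne (m (cellIdx N ⁻¹' {k})) 0 with h0 | h0
    · rw [Measure.restrict_eq_zero.2 h0, h0]
      simp
    · have : IsFiniteMeasure (m.restrict (cellIdx N ⁻¹' {k})) := ⟨by
        rw [Measure.restrict_apply_univ]; exact h.cell_lt_top N k⟩
      have : NeZero (m.restrict (cellIdx N ⁻¹' {k})) := ⟨by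
        rwa [Ne, Measure.restrict_eq_zero]⟩
      have hm : 0 < (m (cellIdx N ⁻¹' {k})).toReal :=
        ENNReal.toReal_pos h0 (h.cell_lt_top N k).ne
      have J := (convexOn_norm_rpow (X := X) hr).map_average_le
        (μ := m.restrict (cellIdx N ⁻¹' {k})) (f := f)
        (Continuous.continuousOn (continuous_norm.rpow_const fun _ => Or.inr (by linarith)))
        isClosed_univ (by simp) (integrableOn_of_bound hf hf1 (h.cell_lt_top N k))
        (integrableOn_norm_rpow hr hf hf1 (h.cell_lt_top N k))
      rw [setAverage_eq, setAverage_eq, hcell] at J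
      rw [measureReal_def, smul_eq_mul, inv_mul_eq_div, le_div_iff₀ hm, mul_comm] at J
      exact J
  induction k with
  | zero => rw [Iic_gridPt_zero]; exact cell 0
  | succ k ih =>
    rw [Iic_gridPt_succ, setIntegral_union (disjoint_Iic_cell N k) (measurableSet_cell N _)
      (integrableOn_norm_rpow hr hD (h.norm_dyadicQuot_le N) (h.finite _))
      (integrableOn_norm_rpow hr hD (h.norm_dyadicQuot_le N) (h.cell_lt_top _ _)),
      setIntegral_union (disjoint_Iic_cell N k) (measurableSet_cell N _)
      (integrableOn_norm_rpow hr hf hf1 (h.finite _))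
      (integrableOn_norm_rpow hr hf hf1 (h.cell_lt_top _ _))]
    exact add_le_add ih (cell (k + 1))

/-- The dyadic difference quotients are a Cauchy sequence in `L¹` on bounded time intervals: by
uniform convexity, the distance of two of them is controlled by the increase of the bounded
nondecreasing sequence `∫ ‖D_N‖ʳ`. -/
lemma eventually_lintegral_dyadicQuot_sub_le [CompleteSpace X] [PartialOrder X]
    [IsOrderedAddMonoid X] [IsOrderedModule ℝ X] (hr : 1 ≤ r) (hX : UniformlyConvexNormPow X r)
    (h0 : 0 ≤ n ⊥) (hn : Monotone n) (K : ℕ) {ε : ℝ} (hε : 0 < ε) :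
    ∀ᶠ N in atTop, ∀ N', N ≤ N' →
      ∫⁻ s in Iic (clamp T K), ‖dyadicQuot m n N s - dyadicQuot m n N' s‖ₑ ∂m ≤
        ENNReal.ofReal ε := by
  set t := clamp T K with ht
  set D := dyadicQuot m n with hD_def
  have hD := stronglyMeasurable_dyadicQuot m n
  have hD1 := h.norm_dyadicQuot_le
  have hfin := h.finite t
  have hDint : ∀ N, IntegrableOn (fun s => ‖D N s‖ ^ r) (Iic t) m := fun N =>
    integrableOn_norm_rpow hr (hD N) (hD1 N) hfin
  set a : ℕ → ℝ := fun N => ∫ s in Iic t, ‖D N s‖ ^ r ∂m with ha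
  have hmono : ∀ {N N'}, N ≤ N' → a N ≤ a N' := by
    intro N N' hN
    have := h.setIntegral_norm_rpow_le hr N (hD N') (hD1 N')
      (h.setIntegral_cell_dyadicQuot_of_le hN) (K * 2 ^ N)
    rwa [← clamp_natCast] at this
  have hbdd : BddAbove (range a) := by
    refine ⟨(m (Iic t)).toReal, ?_⟩
    rintro _ ⟨N, rfl⟩
    calc a N ≤ ∫ s in Iic t, (1 : ℝ) ∂m := by
          refine setIntegral_mono (hDint N) (integrableOn_const hfin.ne) fun s => ?_
          exact Real.rpow_le_one (norm_nonneg _) (hD1 N s) (by linarith)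
      _ = _ := by simp [measureReal_def]
  have hlim := tendsto_atTop_ciSup (fun N N' => hmono) hbdd
  set M := (m (Iic t)).toReal with hM
  have hM0 : 0 ≤ M := ENNReal.toReal_nonneg
  obtain ⟨η, hη, hηM⟩ : ∃ η > 0, η * M ≤ ε / 2 := by
    refine ⟨ε / 2 / (M + 1), by positivity, ?_⟩
    rw [div_mul_eq_mul_div, div_le_iff₀ (by positivity)]
    nlinarith
  obtain ⟨δ, hδ, hUC⟩ := hX η hη
  have hev : ∀ᶠ N in atTop, (⨆ N, a N) - δ * (ε / 2) < a N :=
    hlim.eventually_const_lt (by linarith [mul_pos hδ (half_pos hε)])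
  filter_upwards [hev] with N hN N' hNN'
  have hN' : a N' - a N ≤ δ * (ε / 2) := by
    linarith [le_ciSup hbdd N']
  let H : horizon T → X := fun s => (1 / 2 : ℝ) • (D N s + D N' s)
  have hH : StronglyMeasurable H := ((hD N).add (hD N')).const_smul _
  have hH1 : ∀ s, ‖H s‖ ≤ 1 := by
    intro s
    have := norm_add_le (D N s) (D N' s)
    simp only [H, norm_smul]
    norm_num
    linarith [hD1 N s, hD1 N' s]
  have hHint : IntegrableOn (fun s => ‖H s‖ ^ r) (Iic t) m :=
    integrableOn_norm_rpow hr hH hH1 hfin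
  have hHa : a N ≤ ∫ s in Iic t, ‖H s‖ ^ r ∂m := by
    have := h.setIntegral_norm_rpow_le hr N hH hH1 (fun k => ?_) (K * 2 ^ N)
    · rwa [← clamp_natCast] at this
    · simp only [H]
      rw [integral_smul, integral_add (h.integrableOn_dyadicQuot N (h.cell_lt_top _ _))
        (h.integrableOn_dyadicQuot N' (h.cell_lt_top _ _)), h.setIntegral_cell_dyadicQuot,
        h.setIntegral_cell_dyadicQuot_of_le hNN', ← two_smul ℝ, smul_smul]
      norm_num
  have hgap0 : ∀ s, ‖H s‖ ^ r ≤ (‖D N s‖ ^ r + ‖D N' s‖ ^ r) / 2 := by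
    intro s
    have := (convexOn_norm_rpow (X := X) hr).2 (mem_univ (D N s)) (mem_univ (D N' s))
      (show (0 : ℝ) ≤ 1 / 2 by norm_num) (show (0 : ℝ) ≤ 1 / 2 by norm_num) (by norm_num)
    simp only [H, smul_add]
    refine this.trans_eq ?_
    simp only [smul_eq_mul]; ring
  have hpt : ∀ s, ‖D N s - D N' s‖ ≤
      η + 2 / δ * ((‖D N s‖ ^ r + ‖D N' s‖ ^ r) / 2 - ‖H s‖ ^ r) := by
    intro s
    have hg := hgap0 s
    by_cases hs : η ≤ ‖D N s - D N' s‖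
    · have h1 := hUC (D N s) (D N' s) (dyadicQuot_nonneg h0 hn N s) (dyadicQuot_nonneg h0 hn N' s)
        (hD1 N s) (hD1 N' s) hs
      have h2 : ‖D N s - D N' s‖ ≤ 2 := (norm_sub_le _ _).trans (by linarith [hD1 N s, hD1 N' s])
      have h3 : δ ≤ (‖D N s‖ ^ r + ‖D N' s‖ ^ r) / 2 - ‖H s‖ ^ r := by
        simp only [H]; linarith
      have h4 : 2 ≤ 2 / δ * ((‖D N s‖ ^ r + ‖D N' s‖ ^ r) / 2 - ‖H s‖ ^ r) := by
        rw [div_mul_eq_mul_div, le_div_iff₀ hδ]; linarith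
      linarith
    · have h4 : 0 ≤ 2 / δ * ((‖D N s‖ ^ r + ‖D N' s‖ ^ r) / 2 - ‖H s‖ ^ r) :=
        mul_nonneg (by positivity) (by linarith)
      linarith [not_le.1 hs]
  have hI1 : IntegrableOn (fun s => D N s - D N' s) (Iic t) m :=
    (h.integrableOn_dyadicQuot N hfin).sub (h.integrableOn_dyadicQuot N' hfin)
  have hgapint : IntegrableOn
      (fun s => (‖D N s‖ ^ r + ‖D N' s‖ ^ r) / 2 - ‖H s‖ ^ r) (Iic t) m :=
    (((hDint N).add (hDint N')).div_const 2).sub hHint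
  have hle : ∫ s in Iic t, ‖D N s - D N' s‖ ∂m ≤ ε := by
    calc ∫ s in Iic t, ‖D N s - D N' s‖ ∂m
        ≤ ∫ s in Iic t, (η + 2 / δ * ((‖D N s‖ ^ r + ‖D N' s‖ ^ r) / 2 - ‖H s‖ ^ r)) ∂m :=
          setIntegral_mono hI1.norm ((integrableOn_const hfin.ne).add (hgapint.const_mul _)) hpt
      _ = η * M + 2 / δ * ((a N + a N') / 2 - ∫ s in Iic t, ‖H s‖ ^ r ∂m) := by
          have e1 : ∫ s in Iic t, ((‖D N s‖ ^ r + ‖D N' s‖ ^ r) / 2 - ‖H s‖ ^ r) ∂m =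
              (a N + a N') / 2 - ∫ s in Iic t, ‖H s‖ ^ r ∂m := by
            have I : IntegrableOn (fun s => (‖D N s‖ ^ r + ‖D N' s‖ ^ r) / 2) (Iic t) m :=
              ((hDint N).add (hDint N')).div_const 2
            rw [integral_sub I hHint, integral_div, integral_add (hDint N) (hDint N')]
          have I : IntegrableOn (fun _ => η) (Iic t) m := integrableOn_const hfin.ne
          rw [integral_add I (hgapint.const_mul _), integral_const_mul,
            e1, setIntegral_const, smul_eq_mul, measureReal_def, mul_comm]
      _ ≤ ε / 2 + ε / 2 := by
          refine add_le_add hηM ?_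
          rw [div_mul_eq_mul_div, div_le_iff₀ hδ]
          linarith
      _ = ε := by ring
  have e2 : ∫⁻ s in Iic t, ‖D N s - D N' s‖ₑ ∂m =
      ENNReal.ofReal (∫ s in Iic t, ‖D N s - D N' s‖ ∂m) := by
    rw [ofReal_integral_norm_eq_lintegral_enorm hI1]
  rw [e2]
  exact ENNReal.ofReal_le_ofReal hle

/-- An almost everywhere limit of dyadic difference quotients, along any sequence of meshes tending
to `0`, is a density of a right-continuous path. -/
lemma isRepresented_of_tendsto [CompleteSpace X]
    (hrc : ∀ t, ContinuousWithinAt n (Ici t) t) {φ : ℕ → ℕ} (hφ : ∀ k, k ≤ φ k)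
    {ρ : horizon T → X} (hρ : StronglyMeasurable ρ)
    (hlim : ∀ᵐ s ∂m, Tendsto (fun k => dyadicQuot m n (φ k) s) atTop (𝓝 (ρ s))) (t : horizon T) :
    IntegrableOn ρ (Iic t) m ∧ n t = ∫ s in Iic t, ρ s ∂m := by
  have hρ1 : ∀ᵐ s ∂m, ‖ρ s‖ ≤ 1 := by
    filter_upwards [hlim] with s hs
    exact le_of_tendsto hs.norm (Eventually.of_forall fun k => h.norm_dyadicQuot_le _ _)
  have hint : ∀ t, IntegrableOn ρ (Iic t) m := fun t =>
    ⟨hρ.aestronglyMeasurable, HasFiniteIntegral.restrict_of_bounded_enorm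
      (C := 1) (by simp) (h.finite t).ne (by
        filter_upwards [ae_restrict_of_ae hρ1] with s hs
        rw [← ofReal_norm]; exact (ENNReal.ofReal_le_ofReal hs).trans_eq (by simp))⟩
  refine ⟨hint t, ?_⟩
  have hgrid : ∀ N k, n (gridPt T N k) = ∫ s in Iic (gridPt T N k), ρ s ∂m := by
    intro N k
    have : IsFiniteMeasure (m.restrict (Iic (gridPt T N k))) := ⟨by
      rw [Measure.restrict_apply_univ]; exact h.finite _⟩
    have hconv : Tendsto (fun j => ∫ s in Iic (gridPt T N k), dyadicQuot m n (φ j) s ∂m) atTop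
        (𝓝 (∫ s in Iic (gridPt T N k), ρ s ∂m)) :=
      tendsto_integral_of_dominated_convergence (fun _ => 1)
        (fun j => (stronglyMeasurable_dyadicQuot m n _).aestronglyMeasurable)
        (integrable_const _) (fun j => Eventually.of_forall (h.norm_dyadicQuot_le _))
        (ae_restrict_of_ae hlim)
    refine tendsto_nhds_unique (tendsto_const_nhds.congr' ?_) hconv
    filter_upwards [eventually_ge_atTop N] with j hj
    rw [gridPt_refine (hj.trans (hφ j)), h.setIntegral_Iic_dyadicQuot]
  -- Pass to the limit along the grid points that approach `t` from the right.
  have h1 : Tendsto (fun N => n (roundUp N t)) atTop (𝓝 (n t)) := (hrc t).tendsto.comp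
    (tendsto_roundUp t)
  have h2 : Tendsto (fun N => ∫ s in Iic (roundUp N t), ρ s ∂m) atTop
      (𝓝 (∫ s in Iic t, ρ s ∂m)) := by
    have hle : ∀ N, roundUp N t ≤ clamp T ((t : ℝ≥0) + 1) := fun N => le_clamp_iff.2
      ((roundUp_coe_le N t).trans (by
        gcongr
        exact div_le_one_of_le₀ (one_le_pow₀ (by norm_num)) (by positivity)))
    simp_rw [← integral_indicator (measurableSet_Iic (a := t)),
      ← fun N => integral_indicator (μ := m) (f := ρ) (measurableSet_Iic (a := roundUp N t))]
    refine tendsto_integral_of_dominated_convergence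
      (fun s => (Iic (clamp T ((t : ℝ≥0) + 1))).indicator (fun s => ‖ρ s‖) s)
      (fun N => (hρ.indicator measurableSet_Iic).aestronglyMeasurable)
      ((integrable_indicator_iff measurableSet_Iic).2 (hint _).norm)
      (fun N => Eventually.of_forall fun s => ?_) (Eventually.of_forall fun s => ?_)
    · rw [norm_indicator_eq_indicator_norm]
      exact indicator_le_indicator_of_subset (Iic_subset_Iic.2 (hle N)) (fun _ => norm_nonneg _) s
    · by_cases hs : s ≤ t
      · refine tendsto_const_nhds.congr fun N => ?_
        rw [indicator_of_mem (mem_Iic.2 hs), indicator_of_mem (mem_Iic.2 (hs.trans (le_roundUp N t)))]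
      · have := ((tendsto_nhdsWithin_iff.1 (tendsto_roundUp t)).1).eventually_lt_const
          (not_le.1 hs)
        refine tendsto_const_nhds.congr' ?_
        filter_upwards [this] with N hN
        rw [indicator_of_notMem (by simpa using hs), indicator_of_notMem (by simpa using hN)]
  refine tendsto_nhds_unique h1 (h2.congr fun N => ?_)
  exact (hgrid N _).symm

end IsDominated

end Quotients

/-! ### Representations of a path by a measure and a density -/

section Representation

variable {T : ℝ≥0∞}

lemma sigmaFinite_of_Iic {m : Measure (horizon T)} (h : ∀ t, m (Iic t) < ∞) : SigmaFinite m :=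
  ⟨⟨fun n => Iic (clamp T n), fun _ => trivial, fun _ => h _, iUnion_Iic_clamp⟩⟩

lemma ae_of_forall_ae_restrict_Iic {m : Measure (horizon T)} {p : horizon T → Prop}
    (h : ∀ K : ℕ, ∀ᵐ s ∂(m.restrict (Iic (clamp T K))), p s) : ∀ᵐ s ∂m, p s := by
  rw [← Measure.restrict_univ (μ := m), ← iUnion_Iic_clamp (T := T), ae_restrict_iUnion_iff]
  exact h

variable {X : Type*} [NormedAddCommGroup X] [NormedSpace ℝ X]

/-- A locally integrable function is determined almost everywhere by its integrals over the
intervals `[0, t]`. -/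
lemma ae_eq_of_forall_setIntegral_Iic_eq [CompleteSpace X] {m : Measure (horizon T)}
    {f f' : horizon T → X} (hf : ∀ t, IntegrableOn f (Iic t) m)
    (hf' : ∀ t, IntegrableOn f' (Iic t) m)
    (h : ∀ t, ∫ s in Iic t, f s ∂m = ∫ s in Iic t, f' s ∂m) : f =ᵐ[m] f' := by
  refine ae_of_forall_ae_restrict_Iic fun K => ?_
  set t := clamp T K
  refine Integrable.ae_eq_of_forall_setIntegral_eq _ _ (hf t) (hf' t) fun A hA _ => ?_
  have key : ∀ A : Set (horizon T), MeasurableSet A →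
      ∫ s in A, f s ∂(m.restrict (Iic t)) = ∫ s in A, f' s ∂(m.restrict (Iic t)) := by
    refine MeasurableSpace.induction_on_inter
      (C := fun A _ => ∫ s in A, f s ∂(m.restrict (Iic t)) = ∫ s in A, f' s ∂(m.restrict (Iic t)))
      ((BorelSpace.measurable_eq (α := horizon T)).trans (borel_eq_generateFrom_Iic _))
      isPiSystem_Iic (by simp) ?_ ?_ ?_
    · rintro _ ⟨u, rfl⟩
      rw [Measure.restrict_restrict measurableSet_Iic, Iic_inter_Iic]
      exact h _
    · intro B hB e
      rw [setIntegral_compl hB (hf t), setIntegral_compl hB (hf' t), e]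
      congr 1
      exact h t
    · intro B hd hB e
      rw [integral_iUnion hB hd (hf t).integrableOn,
        integral_iUnion hB hd (hf' t).integrableOn]
      exact tsum_congr e
  exact key A hA

variable [PartialOrder X]

/-- The path `n` is `t ↦ ∫_[0,t] ρ dm` for a locally finite measure `m` and a nonnegative locally
integrable `ρ`, that is, `dn = ρ dm`.  Unlike in `IsDensity`, the measure `m` is arbitrary. -/
structure IsRepresentation (n : horizon T → X) (m : Measure (horizon T)) (ρ : horizon T → X) :
    Prop where
  finite : ∀ t, m (Iic t) < ∞
  stronglyMeasurable : StronglyMeasurable ρ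
  nonneg : ∀ s, 0 ≤ ρ s
  integrableOn : ∀ t, IntegrableOn ρ (Iic t) m
  eq_integral : ∀ t, n t = ∫ s in Iic t, ρ s ∂m

namespace IsRepresentation

variable {n n' : horizon T → X} {m m' Λ : Measure (horizon T)} {ρ ρ' : horizon T → X}

lemma ae_eq [CompleteSpace X] (h : IsRepresentation n m ρ) (h' : IsRepresentation n m ρ') :
    ρ =ᵐ[m] ρ' :=
  ae_eq_of_forall_setIntegral_Iic_eq h.integrableOn h'.integrableOn fun t => by
    rw [← h.eq_integral, ← h'.eq_integral]

/-- Change of the reference measure. -/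
lemma rnDeriv [IsOrderedModule ℝ X] (h : IsRepresentation n m ρ) (hΛ : ∀ t, Λ (Iic t) < ∞)
    (hac : m ≪ Λ) : IsRepresentation n Λ fun s => (m.rnDeriv Λ s).toReal • ρ s := by
  have := sigmaFinite_of_Iic h.finite
  have := sigmaFinite_of_Iic hΛ
  have e : ∀ t, (fun s => (m.rnDeriv Λ s).toReal • (Iic t).indicator ρ s) =
      (Iic t).indicator fun s => (m.rnDeriv Λ s).toReal • ρ s := fun t => by
    ext s; by_cases hs : s ∈ Iic t <;> simp [hs]
  refine ⟨hΛ, ?_, fun s => smul_nonneg ENNReal.toReal_nonneg (h.nonneg s), fun t => ?_,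
    fun t => ?_⟩
  · exact (Measure.measurable_rnDeriv m Λ).ennreal_toReal.stronglyMeasurable.smul
      h.stronglyMeasurable
  · rw [← integrable_indicator_iff measurableSet_Iic, ← e, integrable_rnDeriv_smul_iff hac,
      integrable_indicator_iff measurableSet_Iic]
    exact h.integrableOn t
  · rw [← integral_indicator measurableSet_Iic, ← e, integral_rnDeriv_smul hac,
      integral_indicator measurableSet_Iic]
    exact h.eq_integral t

lemma lintegral_rnDeriv (h : IsRepresentation n m ρ) (hΛ : ∀ t, Λ (Iic t) < ∞)
    (hac : m ≪ Λ) {φ : horizon T → X → ℝ≥0∞}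
    (hφ : ∀ s c v, 0 ≤ c → φ s (c • v) = ENNReal.ofReal c * φ s v)
    (hφm : Measurable fun s => φ s (ρ s)) :
    ∫⁻ s, φ s ((m.rnDeriv Λ s).toReal • ρ s) ∂Λ = ∫⁻ s, φ s (ρ s) ∂m := by
  have := sigmaFinite_of_Iic h.finite
  have := sigmaFinite_of_Iic hΛ
  rw [← lintegral_rnDeriv_mul hac hφm.aemeasurable]
  refine lintegral_congr_ae ?_
  filter_upwards [Measure.rnDeriv_lt_top m Λ] with s hs
  rw [hφ _ _ _ ENNReal.toReal_nonneg, ENNReal.ofReal_toReal hs.ne]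

/-- The integral of a positively homogeneous function against `dn` does not depend on the
representation of the path. -/
lemma lintegral_eq [CompleteSpace X] [IsOrderedModule ℝ X] (h : IsRepresentation n m ρ)
    (h' : IsRepresentation n m' ρ') {φ : horizon T → X → ℝ≥0∞}
    (hφ : ∀ s c v, 0 ≤ c → φ s (c • v) = ENNReal.ofReal c * φ s v)
    (hφm : Measurable fun s => φ s (ρ s)) (hφm' : Measurable fun s => φ s (ρ' s)) :
    ∫⁻ s, φ s (ρ s) ∂m = ∫⁻ s, φ s (ρ' s) ∂m' := by
  have hΛ : ∀ t, (m + m') (Iic t) < ∞ := fun t => ENNReal.add_lt_top.2 ⟨h.finite t, h'.finite t⟩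
  have hac : m ≪ m + m' := Measure.absolutelyContinuous_of_le (Measure.le_add_right le_rfl)
  have hac' : m' ≪ m + m' := Measure.absolutelyContinuous_of_le (Measure.le_add_left le_rfl)
  rw [← h.lintegral_rnDeriv hΛ hac hφ hφm, ← h'.lintegral_rnDeriv hΛ hac' hφ hφm']
  refine lintegral_congr_ae ?_
  filter_upwards [(h.rnDeriv hΛ hac).ae_eq (h'.rnDeriv hΛ hac')] with s hs
  rw [hs]

lemma setIntegral_apply_eq [CompleteSpace X] [IsOrderedModule ℝ X] {Y : Type*}
    [NormedAddCommGroup Y] [NormedSpace ℝ Y] (h : IsRepresentation n m ρ)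
    (h' : IsRepresentation n m' ρ') (L : horizon T → X →L[ℝ] Y) (t : horizon T) :
    ∫ s in Iic t, L s (ρ s) ∂m = ∫ s in Iic t, L s (ρ' s) ∂m' := by
  have hΛ : ∀ t, (m + m') (Iic t) < ∞ := fun t => ENNReal.add_lt_top.2 ⟨h.finite t, h'.finite t⟩
  have hac : m ≪ m + m' := Measure.absolutelyContinuous_of_le (Measure.le_add_right le_rfl)
  have hac' : m' ≪ m + m' := Measure.absolutelyContinuous_of_le (Measure.le_add_left le_rfl)
  have := sigmaFinite_of_Iic h.finite
  have := sigmaFinite_of_Iic h'.finite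
  rw [← integral_indicator measurableSet_Iic, ← integral_indicator measurableSet_Iic,
    ← integral_rnDeriv_smul hac, ← integral_rnDeriv_smul hac']
  refine integral_congr_ae ?_
  filter_upwards [(h.rnDeriv hΛ hac).ae_eq (h'.rnDeriv hΛ hac')] with s hs
  by_cases hst : s ∈ Iic t
  · simp only [indicator_of_mem hst, ← map_smul]
    rw [hs]
  · simp [indicator_of_notMem hst]

lemma add [IsOrderedAddMonoid X] [IsOrderedModule ℝ X] (h : IsRepresentation n m ρ)
    (h' : IsRepresentation n' m ρ') : IsRepresentation (n + n') m (ρ + ρ') where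
  finite := h.finite
  stronglyMeasurable := h.stronglyMeasurable.add h'.stronglyMeasurable
  nonneg s := add_nonneg (h.nonneg s) (h'.nonneg s)
  integrableOn t := (h.integrableOn t).add (h'.integrableOn t)
  eq_integral t := by
    simp only [Pi.add_apply]
    rw [integral_add (h.integrableOn t) (h'.integrableOn t), ← h.eq_integral, ← h'.eq_integral]

lemma smul [IsOrderedModule ℝ X] (h : IsRepresentation n m ρ) {c : ℝ} (hc : 0 ≤ c) :
    IsRepresentation (c • n) m (c • ρ) where
  finite := h.finite
  stronglyMeasurable := h.stronglyMeasurable.const_smul c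
  nonneg s := smul_nonneg hc (h.nonneg s)
  integrableOn t := (h.integrableOn t).smul c
  eq_integral t := by
    simp only [Pi.smul_apply]
    rw [integral_smul, ← h.eq_integral]

end IsRepresentation

/-- A density with respect to the variation measure is a representation. -/
lemma IsDensity.isRepresentation {n ρ : horizon T → X}
    (hfin : ∀ t, variationMeasure n (Iic t) < ∞) (h : IsDensity n ρ) :
    IsRepresentation n (variationMeasure n) ρ :=
  ⟨hfin, h.stronglyMeasurable, h.nonneg, h.integrableOn, h.eq_integral⟩

lemma IsRepresentation.isDensity {n ρ : horizon T → X}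
    (h : IsRepresentation n (variationMeasure n) ρ) : IsDensity n ρ :=
  ⟨h.stronglyMeasurable, h.nonneg, h.integrableOn, h.eq_integral⟩

lemma isDensity_density {n : horizon T → X} (h : ∃ ρ, IsDensity n ρ) : IsDensity n (density n) := by
  unfold density
  rw [dif_pos h]
  exact h.choose_spec

/-- A path that has a density, with respect to a locally finite variation measure. -/
def HasDensity (n : horizon T → X) : Prop :=
  (∀ t, variationMeasure n (Iic t) < ∞) ∧ ∃ ρ, IsDensity n ρ

lemma HasDensity.isRepresentation {n : horizon T → X} (h : HasDensity n) :
    IsRepresentation n (variationMeasure n) (density n) :=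
  (isDensity_density h.2).isRepresentation h.1

lemma stronglyMeasurable_clm_apply {α Y Z : Type*} [MeasurableSpace α] [NormedAddCommGroup Y]
    [NormedSpace ℝ Y] [NormedAddCommGroup Z] [NormedSpace ℝ Z] {f : α → Y →L[ℝ] Z} {v : α → Y}
    (hf : StronglyMeasurable f) (hv : StronglyMeasurable v) :
    StronglyMeasurable fun a => f a (v a) :=
  isBoundedBilinearMap_apply.continuous.comp_stronglyMeasurable (hf.prodMk hv)

variable [CompleteSpace X] [IsOrderedModule ℝ X] {f : horizon T → X →L[ℝ] ℝ}

lemma pairingIntegral_eq {n : horizon T → X} (hn : HasDensity n)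
    {m : Measure (horizon T)} {ρ : horizon T → X} (h : IsRepresentation n m ρ)
    (hf : ∀ v : horizon T → X, StronglyMeasurable v → Measurable fun s => f s (v s)) :
    pairingIntegral f n = ∫⁻ s, ENNReal.ofReal (f s (ρ s)) ∂m := by
  refine hn.isRepresentation.lintegral_eq h (φ := fun s v => ENNReal.ofReal (f s v))
    (fun s c v hc => ?_) (hf _ hn.isRepresentation.stronglyMeasurable).ennreal_ofReal
    (hf _ h.stronglyMeasurable).ennreal_ofReal
  rw [map_smul, smul_eq_mul, ENNReal.ofReal_mul hc]

lemma pairingIntegral_smul {n : horizon T → X} (hn : HasDensity n)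
    {c : ℝ} (hc : 0 ≤ c) (hcn : HasDensity (c • n))
    (hf : ∀ v : horizon T → X, StronglyMeasurable v → Measurable fun s => f s (v s)) :
    pairingIntegral f (c • n) = ENNReal.ofReal c * pairingIntegral f n := by
  rw [pairingIntegral_eq hcn (hn.isRepresentation.smul hc) hf, pairingIntegral,
    ← lintegral_const_mul _ (hf _ hn.isRepresentation.stronglyMeasurable).ennreal_ofReal]
  refine lintegral_congr fun s => ?_
  rw [Pi.smul_apply, map_smul, smul_eq_mul, ENNReal.ofReal_mul hc]

lemma pairingIntegral_add [IsOrderedAddMonoid X] {n n' : horizon T → X} (hn : HasDensity n)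
    (hn' : HasDensity n') (hnn : HasDensity (n + n'))
    (hf : ∀ v : horizon T → X, StronglyMeasurable v → Measurable fun s => f s (v s))
    (hf0 : ∀ s v, 0 ≤ v → 0 ≤ f s v) :
    pairingIntegral f (n + n') = pairingIntegral f n + pairingIntegral f n' := by
  have h := hn.isRepresentation
  have h' := hn'.isRepresentation
  set m := variationMeasure n
  set m' := variationMeasure n'
  have hΛ : ∀ t, (m + m') (Iic t) < ∞ := fun t => ENNReal.add_lt_top.2 ⟨h.finite t, h'.finite t⟩
  have R := h.rnDeriv hΛ (Measure.absolutelyContinuous_of_le (Measure.le_add_right le_rfl))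
  have R' := h'.rnDeriv hΛ (Measure.absolutelyContinuous_of_le (Measure.le_add_left le_rfl))
  rw [pairingIntegral_eq hnn (R.add R') hf, pairingIntegral_eq hn R hf,
    pairingIntegral_eq hn' R' hf,
    ← lintegral_add_left (hf _ R.stronglyMeasurable).ennreal_ofReal]
  refine lintegral_congr fun s => ?_
  rw [Pi.add_apply, map_add, ENNReal.ofReal_add (hf0 s _ (R.nonneg s)) (hf0 s _ (R'.nonneg s))]

end Representation

/-! ### The variation measure of a nondecreasing path -/

section Variation

variable {X : Type*} [NormedAddCommGroup X] {T : ℝ≥0∞}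

/-- A nonnegative, nondecreasing, right-continuous path of locally finite variation. -/
structure IsControlPath [PartialOrder X] (n : horizon T → X) : Prop where
  nonneg : ∀ t, 0 ≤ n t
  monotone : Monotone n
  rightContinuous : ∀ t, ContinuousWithinAt n (Ici t) t
  finiteVariation : ∀ t, eVariationOn n (Iic t) ≠ ∞

lemma Iic_clamp_add_one_mem_nhds (t : horizon T) : Iic (clamp T ((t : ℝ≥0) + 1)) ∈ 𝓝 t := by
  have h : (fun s : horizon T => (s : ℝ≥0)) ⁻¹' Iio ((t : ℝ≥0) + 1) ∈ 𝓝 t :=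
    continuous_subtype_val.continuousAt.preimage_mem_nhds
      (Iio_mem_nhds (lt_add_of_pos_right _ one_pos))
  filter_upwards [h] with s hs
  exact le_clamp_iff.2 (le_of_lt hs)

lemma eVariationOn_Iic_add_Icc (n : horizon T → X) {s t : horizon T} (h : s ≤ t) :
    eVariationOn n (Iic s) + eVariationOn n (Icc s t) = eVariationOn n (Iic t) := by
  rw [← eVariationOn.union n (x := s) ⟨self_mem_Iic, fun _ h => h⟩
    ⟨left_mem_Icc.2 h, fun _ h => h.1⟩, Iic_union_Icc_eq_Iic h]

/-- The variation of a right-continuous path is right-continuous. -/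
lemma continuousWithinAt_variation {n : horizon T → X}
    (hfin : ∀ t, eVariationOn n (Iic t) ≠ ∞) (hrc : ∀ t, ContinuousWithinAt n (Ici t) t)
    (t : horizon T) :
    ContinuousWithinAt (fun t => (eVariationOn n (Iic t)).toReal) (Ici t) t := by
  set t' := clamp T ((t : ℝ≥0) + 1)
  have ht' : Iic t' ∈ 𝓝 t := Iic_clamp_add_one_mem_nhds t
  have h0 : Tendsto (fun y => eVariationOn n (Iic t' ∩ Icc t y)) (𝓝[Iic t'] t) (𝓝 0) :=
    BoundedVariationOn.tendsto_eVariationOn_Icc_zero_right (hfin t') t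
      ((hrc t).mono inter_subset_right)
  rw [nhdsWithin_eq_nhds.2 ht'] at h0
  have h1 : Tendsto (fun y => (eVariationOn n (Iic t)).toReal +
      (eVariationOn n (Iic t' ∩ Icc t y)).toReal) (𝓝[≥] t)
      (𝓝 ((eVariationOn n (Iic t)).toReal + 0)) := by
    refine tendsto_const_nhds.add ?_
    exact (ENNReal.tendsto_toReal ENNReal.zero_ne_top).comp
      (h0.mono_left (nhdsWithin_le_nhds (s := Ici t)))
  rw [add_zero] at h1
  refine h1.congr' ?_
  filter_upwards [self_mem_nhdsWithin, mem_nhdsWithin_of_mem_nhds ht'] with y hy hy'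
  have e : Iic t' ∩ Icc t y = Icc t y :=
    inter_eq_right.2 fun z hz => hz.2.trans hy'
  rw [e, ← ENNReal.toReal_add (hfin t), eVariationOn_Iic_add_Icc n hy]
  exact ne_top_of_le_ne_top (hfin y) (eVariationOn.mono n Icc_subset_Iic_self)

section Measure

variable {n : horizon T → X} (hfin : ∀ t, eVariationOn n (Iic t) ≠ ∞)
  (hrc : ∀ t, ContinuousWithinAt n (Ici t) t)

include hfin hrc

lemma stieltjesFunction_variation (t : horizon T) :
    (monotone_variation n hfin).stieltjesFunction t = (eVariationOn n (Iic t)).toReal :=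
  ((monotone_variation n hfin).stieltjesFunction_eq t).trans
    (continuousWithinAt_variation hfin hrc t).rightLim_eq

lemma variationMeasure_Ioc (a b : horizon T) :
    variationMeasure n (Ioc a b) =
      ENNReal.ofReal ((eVariationOn n (Iic b)).toReal - (eVariationOn n (Iic a)).toReal) := by
  rw [variationMeasure, dif_pos hfin, Measure.add_apply, StieltjesFunction.measure_Ioc,
    Measure.smul_apply, Measure.dirac_apply' _ measurableSet_Ioc, indicator_of_notMem (by simp),
    smul_zero, add_zero, stieltjesFunction_variation hfin hrc, stieltjesFunction_variation hfin hrc]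

omit hrc in
lemma variationMeasure_bot : variationMeasure n {⊥} = ‖n ⊥‖ₑ := by
  unfold variationMeasure
  rw [dif_pos hfin, Measure.add_apply, StieltjesFunction.measure_singleton, Measure.smul_apply,
    Measure.dirac_apply' _ (measurableSet_singleton _),
    leftLim_eq_of_isBot (fun x => bot_le)]
  simp

lemma variationMeasure_Iic (t : horizon T) :
    variationMeasure n (Iic t) = ‖n ⊥‖ₑ + eVariationOn n (Iic t) := by
  rw [← Icc_bot, ← Ioc_union_left (bot_le : ⊥ ≤ t), measure_union (by simp)
    (measurableSet_singleton _), variationMeasure_bot hfin, variationMeasure_Ioc hfin hrc,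
    eVariationOn.subsingleton n (s := Iic ⊥) (by simp), add_comm]
  simp [ENNReal.ofReal_toReal (hfin t), Icc_bot]

lemma isDominated_variationMeasure : IsDominated n (variationMeasure n) where
  finite t := by
    rw [variationMeasure_Iic hfin hrc]
    exact ENNReal.add_lt_top.2 ⟨enorm_lt_top, (hfin t).lt_top⟩
  bot_le := (variationMeasure_bot hfin).ge
  sub_le a b hab := by
    have hI : eVariationOn n (Icc a b) ≠ ∞ :=
      ne_top_of_le_ne_top (hfin b) (eVariationOn.mono n Icc_subset_Iic_self)
    rw [variationMeasure_Ioc hfin hrc, ← eVariationOn_Iic_add_Icc n hab,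
      ENNReal.toReal_add (hfin a) hI, add_sub_cancel_left, ENNReal.ofReal_toReal hI,
      ← edist_eq_enorm_sub]
    exact eVariationOn.edist_le n (right_mem_Icc.2 hab) (left_mem_Icc.2 hab)

end Measure

/-- The dyadic points of `[0, t]`, together with `t`. -/
def dyadicPts (t : horizon T) : Set (horizon T) :=
  range fun z : ℕ × ℕ => min (gridPt T z.1 z.2) t

lemma countable_dyadicPts (t : horizon T) : (dyadicPts t).Countable := countable_range _

/-- The variation of a right-continuous path can be computed along dyadic partitions. -/
lemma eVariationOn_dyadicPts {n : horizon T → X} (hrc : ∀ t, ContinuousWithinAt n (Ici t) t)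
    (t : horizon T) : eVariationOn n (dyadicPts t) = eVariationOn n (Iic t) := by
  apply le_antisymm
  · exact eVariationOn.mono n (by rintro _ ⟨z, rfl⟩; exact mem_Iic.2 (min_le_right _ _))
  · refine le_of_forall_lt fun v hv => ?_
    let φ : ℕ → horizon T → horizon T := fun N s => min (roundUp N s) t
    have hlim : ∀ s ∈ Iic t, Tendsto (fun N => (n ∘ φ N) s) atTop (𝓝 (n s)) := by
      intro s hs
      refine (hrc s).tendsto.comp (f := fun N => φ N s) (tendsto_nhdsWithin_iff.2 ⟨?_, ?_⟩)
      · have := ((tendsto_nhdsWithin_iff.1 (tendsto_roundUp s)).1).min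
          (tendsto_const_nhds (x := t))
        rwa [min_eq_left (mem_Iic.1 hs)] at this
      · exact Eventually.of_forall fun N => le_min (le_roundUp N s) hs
    obtain ⟨N, hN⟩ := (eVariationOn.lowerSemicontinuous_aux hlim hv).exists
    refine hN.trans_le (eVariationOn.comp_le_of_monotoneOn (t := Iic t) n (φ N) ?_ ?_)
    · exact fun a _ b _ hab => min_le_min_right t (roundUp_mono N hab)
    · exact fun s _ => ⟨(N, cellIdx N s), rfl⟩

/-- Over a countable set, the variation is a countable supremum. -/
lemma eVariationOn_eq_iSup_fin (n : horizon T → X) (C : Set (horizon T)) :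
    eVariationOn n C = ⨆ (N : ℕ) (v : {v : Fin (N + 1) → C // Monotone v}),
      ∑ i : Fin N, edist (n (v.1 i.succ)) (n (v.1 i.castSucc)) := by
  apply le_antisymm
  · refine iSup_le fun ⟨N, u, hu, huC⟩ => ?_
    refine le_iSup_of_le N (le_iSup_of_le ⟨fun i => ⟨u i, huC i⟩, fun i j hij => hu hij⟩ ?_)
    rw [Finset.sum_range]
    simp
  · refine iSup_le fun N => iSup_le fun v => ?_
    let u : ℕ → horizon T := fun i => v.1 ⟨min i N, by omega⟩
    have hu : Monotone u := fun i j hij => v.2 (by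
      rw [Fin.mk_le_mk]; exact min_le_min_right N hij)
    refine le_trans (le_of_eq ?_) (eVariationOn.sum_le (f := n) (n := N) hu fun i => (v.1 _).2)
    rw [Finset.sum_range]
    refine Finset.sum_congr rfl fun i _ => ?_
    have h1 : (⟨min ((i : ℕ) + 1) N, by omega⟩ : Fin (N + 1)) = i.succ := by
      ext; simp
    have h2 : (⟨min (i : ℕ) N, by omega⟩ : Fin (N + 1)) = i.castSucc := by
      ext; simp
    simp only [u, h1, h2]

/-- The variation over `[0, t]` of a right-continuous adapted process is known at time `t`. -/
lemma measurable_eVariationOn {Ω : Type*} {mΩ : MeasurableSpace Ω}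
    {F : Filtration (horizon T) mΩ} {ν : horizon T → Ω → X} (hν : StronglyAdapted F ν)
    (hrc : ∀ ω t, ContinuousWithinAt (fun s => ν s ω) (Ici t) t) (t : horizon T) :
    Measurable[F t] fun ω => eVariationOn (fun s => ν s ω) (Iic t) := by
  simp_rw [← fun ω => eVariationOn_dyadicPts (hrc ω) t, eVariationOn_eq_iSup_fin]
  have : Countable (dyadicPts t) := (countable_dyadicPts t).to_subtype
  have hm : ∀ s : dyadicPts t, StronglyMeasurable[F t] (ν s) := by
    rintro ⟨_, z, rfl⟩
    exact (hν _).mono (F.mono (min_le_right _ _))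
  refine Measurable.iSup fun N => Measurable.iSup fun v => ?_
  refine Finset.measurable_fun_sum _ fun i _ => ?_
  exact (continuous_edist.comp_stronglyMeasurable
    ((hm (v.1 i.succ)).prodMk (hm (v.1 i.castSucc)))).measurable

end Variation

/-! ### Controls with regular paths -/

section Controls

variable {X : Type*} [NormedAddCommGroup X] [NormedSpace ℝ X] [PartialOrder X]
  {Ω : Type*} {mΩ : MeasurableSpace Ω} {T : ℝ≥0∞} {F : Filtration (horizon T) mΩ}

/-- A control all of whose paths are regular, without exceptional event. -/
structure IsRegularControl (F : Filtration (horizon T) mΩ) (ν : horizon T → Ω → X) : Prop where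
  adapted : StronglyAdapted F ν
  path : ∀ ω, IsControlPath fun t => ν t ω

omit [NormedSpace ℝ X] in
lemma IsRegularControl.isControl {ν : horizon T → Ω → X} (h : IsRegularControl F ν)
    (P : Measure Ω) : IsControl F P ν :=
  ⟨h.adapted, Eventually.of_forall fun ω => (h.path ω).nonneg,
    Eventually.of_forall fun ω => (h.path ω).monotone,
    Eventually.of_forall fun ω => (h.path ω).rightContinuous,
    Eventually.of_forall fun ω => (h.path ω).finiteVariation⟩

omit [NormedSpace ℝ X] in
lemma isControlPath_zero : IsControlPath (0 : horizon T → X) where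
  nonneg _ := le_rfl
  monotone := monotone_const
  rightContinuous _ := continuousWithinAt_const
  finiteVariation t := by
    rw [eVariationOn.constant_on]
    · simp
    · rintro _ ⟨_, _, rfl⟩ _ ⟨_, _, rfl⟩
      rfl

lemma stronglyMeasurable_indicator_compl_null {P : Measure Ω} (hF : UsualConditions F P) {N : Set Ω}
    (hN : P N = 0) {β : Type*} [TopologicalSpace β] [Zero β] {t : horizon T} {f : Ω → β}
    (hf : StronglyMeasurable[F t] f) : StronglyMeasurable[F t] (Nᶜ.indicator f) :=
  hf.indicator (F.mono bot_le _ (hF.complete N hN)).compl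

omit [NormedSpace ℝ X] in
/-- Since null events are known at time `0`, a control can be made regular by changing it to `0` on
a null event. -/
lemma IsControl.exists_regular {P : Measure Ω} (hF : UsualConditions F P)
    {ν : horizon T → Ω → X} (h : IsControl F P ν) :
    ∃ ν', IsRegularControl F ν' ∧ ∀ᵐ ω ∂P, ∀ t, ν' t ω = ν t ω := by
  have hae : ∀ᵐ ω ∂P, IsControlPath fun t => ν t ω := by
    filter_upwards [h.nonneg, h.monotone, h.rightContinuous, h.finiteVariation] with ω h1 h2 h3 h4
    exact ⟨h1, h2, h3, h4⟩
  set N : Set Ω := {ω | ¬ IsControlPath fun t => ν t ω} with hN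
  refine ⟨fun t => Nᶜ.indicator (ν t), ⟨fun t => ?_, fun ω => ?_⟩, ?_⟩
  · exact stronglyMeasurable_indicator_compl_null hF (ae_iff.1 hae) (h.adapted t)
  · by_cases hω : ω ∈ N
    · simp only [indicator_of_notMem (show ω ∉ Nᶜ by simpa using hω)]
      exact isControlPath_zero
    · simp only [indicator_of_mem (show ω ∈ Nᶜ from hω)]
      exact not_not.1 hω
  · filter_upwards [hae] with ω hω t
    rw [indicator_of_mem]
    exact fun h => h hω

end Controls

/-! ### Time change along an increasing process -/

section Level

variable {T : ℝ≥0∞}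

lemma tendsto_measure_Iic_add (m : Measure (horizon T)) (hm : ∀ t, m (Iic t) < ∞)
    (t : horizon T) :
    Tendsto (fun N : ℕ => m (Iic (clamp T ((t : ℝ≥0) + 1 / 2 ^ N)))) atTop (𝓝 (m (Iic t))) := by
  have h : Iic t = ⋂ N : ℕ, Iic (clamp T ((t : ℝ≥0) + 1 / 2 ^ N)) := by
    ext s
    simp only [mem_Iic, mem_iInter, le_clamp_iff]
    exact ⟨fun h N => le_add_right h, fun h => ge_of_tendsto
      (tendsto_nhdsWithin_iff.1 (tendsto_clamp_add t)).1
      (Eventually.of_forall fun N => le_clamp_iff.2 (h N))⟩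
  have hanti : Antitone fun N : ℕ => Iic (clamp T ((t : ℝ≥0) + 1 / 2 ^ N)) := by
    intro N N' hN
    refine Iic_subset_Iic.2 (clamp_mono ?_)
    gcongr
    norm_num
  rw [show m (Iic t) = _ from congrArg m h]
  exact tendsto_measure_iInter_atTop (fun N => measurableSet_Iic.nullMeasurableSet) hanti
    ⟨0, (hm _).ne⟩

lemma exists_isLeast_level {m : Measure (horizon T)} (hm : ∀ t, m (Iic t) < ∞) {u : ℝ≥0∞}
    (h : ∃ s, u ≤ m (Iic s)) : ∃ s, IsLeast {s | u ≤ m (Iic s)} s := by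
  set A : Set (horizon T) := {s | u ≤ m (Iic s)} with hA
  obtain ⟨s₁, hs₁⟩ := h
  let B : Set ℝ≥0 := Subtype.val '' A
  have hB : B.Nonempty := ⟨s₁, s₁, hs₁, rfl⟩
  have hle : sInf B ≤ (s₁ : ℝ≥0) := csInf_le' ⟨s₁, hs₁, rfl⟩
  let s₀ : horizon T := ⟨sInf B, le_trans (ENNReal.coe_le_coe.2 hle) s₁.2⟩
  have hlow : ∀ s ∈ A, s₀ ≤ s := fun s hs => csInf_le' (s := B) ⟨s, hs, rfl⟩
  refine ⟨s₀, ?_, hlow⟩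
  refine ge_of_tendsto (tendsto_measure_Iic_add m hm s₀) (Eventually.of_forall fun N => ?_)
  have : sInf B < sInf B + 1 / 2 ^ N := lt_add_of_pos_right _ (by positivity)
  obtain ⟨_, ⟨s, hs, rfl⟩, hlt⟩ := exists_lt_of_csInf_lt hB this
  exact le_trans hs (measure_mono (Iic_subset_Iic.2 (le_clamp_iff.2 hlt.le)))

open Classical in
/-- The first time at which the mass `m [0, s]` reaches the level `u`; it is `⊤` if this never
happens.  Levels are real numbers, so that they can be integrated; only `u > 0` matters. -/
def level (m : Measure (horizon T)) (u : ℝ) : WithTop (horizon T) :=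
  if h : ∃ s, IsLeast {s | ENNReal.ofReal u ≤ m (Iic s)} s then (h.choose : WithTop (horizon T))
  else ⊤

lemma level_le_iff {m : Measure (horizon T)} (hm : ∀ t, m (Iic t) < ∞) {u : ℝ} {t : horizon T} :
    level m u ≤ t ↔ ENNReal.ofReal u ≤ m (Iic t) := by
  unfold level
  split_ifs with h
  · rw [WithTop.coe_le_coe]
    exact ⟨fun ht => le_trans h.choose_spec.1 (measure_mono (Iic_subset_Iic.2 ht)),
      fun ht => h.choose_spec.2 ht⟩
  · refine ⟨fun ht => absurd ht (by simp), fun ht => ?_⟩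
    exact absurd (exists_isLeast_level hm ⟨t, ht⟩) h

lemma level_ne_top_iff {m : Measure (horizon T)} (hm : ∀ t, m (Iic t) < ∞) {u : ℝ} :
    level m u ≠ ⊤ ↔ ∃ K : ℕ, ENNReal.ofReal u ≤ m (Iic (clamp T K)) := by
  constructor
  · intro h
    obtain ⟨s, hs⟩ := WithTop.ne_top_iff_exists.1 h
    obtain ⟨N, hN⟩ := exists_le_clamp_natCast s
    exact ⟨N, (level_le_iff hm).1 (hs ▸ WithTop.coe_le_coe.2 (hN N le_rfl))⟩
  · rintro ⟨K, hK⟩ h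
    have := (level_le_iff hm).2 hK
    rw [h] at this
    exact absurd this (by simp)

/-- The value of `level m u`, and `0` if it is `⊤`. -/
def levelTime (m : Measure (horizon T)) (u : ℝ) : horizon T := (level m u).untopD ⊥

lemma coe_levelTime {m : Measure (horizon T)} {u : ℝ} (h : level m u ≠ ⊤) :
    (levelTime m u : WithTop (horizon T)) = level m u := by
  obtain ⟨s, hs⟩ := WithTop.ne_top_iff_exists.1 h
  rw [levelTime, ← hs, WithTop.untopD_coe]

lemma levelTime_le_iff {m : Measure (horizon T)} (hm : ∀ t, m (Iic t) < ∞) {u : ℝ}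
    {t : horizon T} (h : level m u ≠ ⊤) : levelTime m u ≤ t ↔ ENNReal.ofReal u ≤ m (Iic t) := by
  rw [← WithTop.coe_le_coe, coe_levelTime h, level_le_iff hm]

section Measurable

variable {Ω : Type*} [MeasurableSpace Ω] {m : Ω → Measure (horizon T)}

lemma measurableSet_level_ne_top (hfin : ∀ ω t, m ω (Iic t) < ∞)
    (hm : ∀ t, Measurable fun ω => m ω (Iic t)) :
    MeasurableSet {z : Ω × ℝ | level (m z.1) z.2 ≠ ⊤} := by
  simp only [level_ne_top_iff (hfin _), ofPred_exists]
  exact MeasurableSet.iUnion fun K => measurableSet_le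
    (ENNReal.measurable_ofReal.comp measurable_snd) ((hm _).comp measurable_fst)

lemma measurable_levelTime (hfin : ∀ ω t, m ω (Iic t) < ∞)
    (hm : ∀ t, Measurable fun ω => m ω (Iic t)) :
    Measurable fun z : Ω × ℝ => levelTime (m z.1) z.2 := by
  refine measurable_of_Iic fun t => ?_
  have e : (fun z : Ω × ℝ => levelTime (m z.1) z.2) ⁻¹' Iic t =
      {z | ENNReal.ofReal z.2 ≤ m z.1 (Iic t)} ∪ {z : Ω × ℝ | level (m z.1) z.2 ≠ ⊤}ᶜ := by
    ext z
    simp only [mem_preimage, mem_Iic, mem_union, mem_ofPred_eq, mem_compl_iff, not_not]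
    by_cases h : level (m z.1) z.2 = ⊤
    · simp [h, levelTime]
    · rw [levelTime_le_iff (hfin _) h]
      simp [h]
  rw [e]
  exact (measurableSet_le (ENNReal.measurable_ofReal.comp measurable_snd)
    ((hm _).comp measurable_fst)).union (measurableSet_level_ne_top hfin hm).compl

end Measurable

lemma measurable_levelTime_right {m : Measure (horizon T)} (hm : ∀ t, m (Iic t) < ∞) :
    Measurable (levelTime m) :=
  (measurable_levelTime (Ω := Unit) (m := fun _ => m) (fun _ => hm)
    (fun _ => measurable_const)).comp (measurable_prodMk_left (x := ()))

lemma measurableSet_level_ne_top_right {m : Measure (horizon T)} (hm : ∀ t, m (Iic t) < ∞) :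
    MeasurableSet {u | level m u ≠ ⊤} :=
  (measurable_prodMk_left (x := ())) (measurableSet_level_ne_top (Ω := Unit) (m := fun _ => m)
    (fun _ => hm) (fun _ => measurable_const))

/-- The time change transports the Lebesgue measure to `m`. -/
lemma map_levelTime {m : Measure (horizon T)} (hm : ∀ t, m (Iic t) < ∞) :
    Measure.map (levelTime m) (volume.restrict ({u | level m u ≠ ⊤} ∩ Ioi 0)) = m := by
  have hIic : ∀ t, Measure.map (levelTime m) (volume.restrict ({u | level m u ≠ ⊤} ∩ Ioi 0))
      (Iic t) = m (Iic t) := by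
    intro t
    rw [Measure.map_apply (measurable_levelTime_right hm) measurableSet_Iic,
      Measure.restrict_apply (measurable_levelTime_right hm measurableSet_Iic)]
    have e : levelTime m ⁻¹' Iic t ∩ ({u | level m u ≠ ⊤} ∩ Ioi 0) =
        Ioc 0 (m (Iic t)).toReal := by
      ext u
      simp only [mem_inter_iff, mem_preimage, mem_Iic, mem_ofPred_eq, mem_Ioi, mem_Ioc]
      constructor
      · rintro ⟨h1, h2, h3⟩
        exact ⟨h3, (ENNReal.ofReal_le_iff_le_toReal (hm t).ne).1
          ((levelTime_le_iff hm h2).1 h1)⟩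
      · rintro ⟨h1, h2⟩
        have h3 := (ENNReal.ofReal_le_iff_le_toReal (hm t).ne).2 h2
        have h4 : level m u ≠ ⊤ := fun h => by
          have := (level_le_iff hm).2 h3
          rw [h] at this
          exact absurd this (by simp)
        exact ⟨(levelTime_le_iff hm h4).2 h3, h4, h1⟩
    rw [e, Real.volume_Ioc, sub_zero, ENNReal.ofReal_toReal (hm t).ne]
  refine Measure.ext_of_generateFrom_of_iUnion (range Iic) (fun n : ℕ => Iic (clamp T n))
    ((BorelSpace.measurable_eq (α := horizon T)).trans (borel_eq_generateFrom_Iic _))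
    isPiSystem_Iic iUnion_Iic_clamp (fun n => mem_range_self _) (fun n => ?_) ?_
  · rw [hIic]; exact (hm _).ne
  · rintro _ ⟨t, rfl⟩
    exact hIic t

end Level

section AdaptedMeasure

variable {T : ℝ≥0∞} {Ω : Type*} {mΩ : MeasurableSpace Ω} {F : Filtration (horizon T) mΩ}
  {m : Ω → Measure (horizon T)}

/-- A random locally finite measure `m` on `[0, T]` such that the increasing process
`t ↦ m [0, t]` is adapted. -/
structure IsAdaptedMeasure (F : Filtration (horizon T) mΩ) (m : Ω → Measure (horizon T)) :
    Prop where
  finite : ∀ ω t, m ω (Iic t) < ∞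
  adapted : ∀ t, Measurable[F t] fun ω => m ω (Iic t)

namespace IsAdaptedMeasure

lemma measurable (h : IsAdaptedMeasure F m) (t : horizon T) : Measurable fun ω => m ω (Iic t) :=
  (h.adapted t).mono (F.le t) le_rfl

lemma isStoppingTime (h : IsAdaptedMeasure F m) (u : ℝ) :
    IsStoppingTime F fun ω => level (m ω) u := fun t => by
  simp only [level_le_iff (h.finite _)]
  exact @measurableSet_le _ _ _ _ _ (F t) _ _ _ _ _ (@measurable_const _ _ _ (F t) _) (h.adapted t)

lemma lintegral_eq (h : IsAdaptedMeasure F m) {f : horizon T → ℝ≥0∞} (hf : Measurable f) (ω : Ω) :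
    ∫⁻ s, f s ∂(m ω) =
      ∫⁻ u in Ioi 0, {u | level (m ω) u ≠ ⊤}.indicator (fun u => f (levelTime (m ω) u)) u := by
  conv_lhs => rw [← map_levelTime (h.finite ω)]
  rw [lintegral_map hf (measurable_levelTime_right (h.finite ω)),
    lintegral_indicator (measurableSet_level_ne_top_right (h.finite ω)),
    Measure.restrict_restrict (measurableSet_level_ne_top_right (h.finite ω))]

lemma measurable_indicator (h : IsAdaptedMeasure F m) {f : horizon T → Ω → ℝ≥0∞}
    (hf : Measurable fun z : horizon T × Ω => f z.1 z.2) :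
    Measurable fun z : Ω × ℝ => {u | level (m z.1) u ≠ ⊤}.indicator
      (fun u => f (levelTime (m z.1) u) z.1) z.2 :=
  Measurable.indicator (f := fun z : Ω × ℝ => f (levelTime (m z.1) z.2) z.1)
    (hf.comp ((measurable_levelTime h.finite h.measurable).prodMk measurable_fst))
    (measurableSet_level_ne_top h.finite h.measurable)

lemma measurable_lintegral (h : IsAdaptedMeasure F m) {f : horizon T → Ω → ℝ≥0∞}
    (hf : Measurable fun z : horizon T × Ω => f z.1 z.2) :
    Measurable fun ω => ∫⁻ s, f s ω ∂(m ω) := by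
  rw [funext fun ω => h.lintegral_eq (f := fun s => f s ω)
    (hf.comp (measurable_prodMk_right (y := ω))) ω]
  exact (h.measurable_indicator hf).lintegral_prod_right'

/-- The time change turns the integral against `dm` into integrals at stopping times. -/
lemma lintegral_lintegral (h : IsAdaptedMeasure F m) (P : Measure Ω) [SFinite P]
    {f : horizon T → Ω → ℝ≥0∞} (hf : Measurable fun z : horizon T × Ω => f z.1 z.2) :
    ∫⁻ ω, ∫⁻ s, f s ω ∂(m ω) ∂P = ∫⁻ u in Ioi 0, ∫⁻ ω in {ω | level (m ω) u ≠ ⊤},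
      stoppedValue f (fun ω => level (m ω) u) ω ∂P := by
  rw [lintegral_congr fun ω => h.lintegral_eq (f := fun s => f s ω)
    (hf.comp (measurable_prodMk_right (y := ω))) ω]
  rw [lintegral_lintegral_swap (h.measurable_indicator hf).aemeasurable]
  refine lintegral_congr fun u => ?_
  rw [← lintegral_indicator]
  · refine lintegral_congr fun ω => ?_
    by_cases hω : level (m ω) u = ⊤
    · simp [hω]
    · have e : levelTime (m ω) u = (level (m ω) u).untopA := by
        obtain ⟨s, hs⟩ := WithTop.ne_top_iff_exists.1 hω
        rw [levelTime, ← hs]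
        rfl
      simp [hω, stoppedValue, e]
  · exact (measurable_prodMk_right (y := u)) (measurableSet_level_ne_top h.finite h.measurable)

/-- Two processes with the same expectation at every stopping time have the same expected integral
against an adapted random measure. -/
lemma lintegral_lintegral_congr (h : IsAdaptedMeasure F m) (P : Measure Ω) [SFinite P]
    {f f' : horizon T → Ω → ℝ≥0∞} (hf : Measurable fun z : horizon T × Ω => f z.1 z.2)
    (hf' : Measurable fun z : horizon T × Ω => f' z.1 z.2)
    (hff : ∀ τ : Ω → WithTop (horizon T), IsStoppingTime F τ →
      ∫⁻ ω in {ω | τ ω ≠ ⊤}, stoppedValue f τ ω ∂P =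
        ∫⁻ ω in {ω | τ ω ≠ ⊤}, stoppedValue f' τ ω ∂P) :
    ∫⁻ ω, ∫⁻ s, f s ω ∂(m ω) ∂P = ∫⁻ ω, ∫⁻ s, f' s ω ∂(m ω) ∂P := by
  rw [h.lintegral_lintegral P hf, h.lintegral_lintegral P hf']
  exact lintegral_congr fun u => hff _ (h.isStoppingTime u)

end IsAdaptedMeasure

variable {X : Type*} [NormedAddCommGroup X] [NormedSpace ℝ X]

lemma stronglyMeasurable_setIntegral {Ω : Type*} [MeasurableSpace Ω]
    {m : Ω → Measure (horizon T)} (hfin : ∀ ω t, m ω (Iic t) < ∞) (t : horizon T)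
    (hm : ∀ s ≤ t, Measurable fun ω => m ω (Iic s)) {V : horizon T → Ω → X}
    (hV : StronglyMeasurable fun z : Iic t × Ω => V z.1 z.2) :
    StronglyMeasurable fun ω => ∫ s in Iic t, V s ω ∂(m ω) := by
  let A : Set (Ω × ℝ) := {z | ENNReal.ofReal z.2 ≤ m z.1 (Iic t) ∧ 0 < z.2}
  have hA : MeasurableSet A := (measurableSet_le (ENNReal.measurable_ofReal.comp measurable_snd)
    ((hm t le_rfl).comp measurable_fst)).inter (measurable_snd measurableSet_Ioi)
  have hlt : ∀ {ω u s}, ENNReal.ofReal u ≤ m ω (Iic s) → level (m ω) u ≠ ⊤ := by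
    intro ω u s h h'
    have := (level_le_iff (hfin ω)).2 h
    rw [h'] at this
    exact absurd this (by simp)
  let σ : Ω × ℝ → Iic t := fun z => ⟨min (levelTime (m z.1) z.2) t, mem_Iic.2 (min_le_right _ _)⟩
  -- Below time `t`, the time change only depends on the masses `m [0, s]` with `s ≤ t`.
  let σ' : Ω × ℝ → Iic t := A.piecewise σ fun _ => ⟨t, mem_Iic.2 le_rfl⟩
  have hσ' : Measurable σ' := by
    refine Measurable.subtype_mk (f := fun z => (σ' z : horizon T)) (measurable_of_Iic fun s => ?_)
    rcases lt_or_ge s t with hs | hs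
    · have e : (fun z => (σ' z : horizon T)) ⁻¹' Iic s =
          A ∩ {z | ENNReal.ofReal z.2 ≤ m z.1 (Iic s)} := by
        ext z
        simp only [mem_preimage, mem_Iic, mem_inter_iff, mem_ofPred_eq, σ']
        by_cases hz : z ∈ A
        · simp [hz, σ, hs.not_ge, levelTime_le_iff (hfin z.1) (hlt hz.1)]
        · simp [hz, hs.not_ge]
      rw [e]
      exact hA.inter (measurableSet_le (ENNReal.measurable_ofReal.comp measurable_snd)
        ((hm s hs.le).comp measurable_fst))
    · have e : (fun z => (σ' z : horizon T)) ⁻¹' Iic s = univ :=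
        eq_univ_of_forall fun z => le_trans (σ' z).2 hs
      rw [e]
      exact MeasurableSet.univ
  have hW : StronglyMeasurable (A.indicator fun z => V (σ' z) z.1) :=
    (hV.comp_measurable (hσ'.prodMk measurable_fst)).indicator hA
  convert hW.integral_prod_right' (ν := volume) using 1
  funext ω
  symm
  have hsec : StronglyMeasurable fun s : Iic t => V s ω :=
    hV.comp_measurable (measurable_prodMk_right (y := ω))
  have hVt : StronglyMeasurable ((Iic t).indicator fun s => V s ω) := by
    have := (hsec.comp_measurable
      (g := fun s : horizon T => (⟨min s t, mem_Iic.2 (min_le_right _ _)⟩ : Iic t))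
      (Measurable.subtype_mk (measurable_id.min measurable_const))).indicator
      (measurableSet_Iic (a := t))
    convert this using 1
    funext s
    by_cases hs : s ∈ Iic t
    · simp [hs, min_eq_left (mem_Iic.1 hs)]
    · simp [hs]
  rw [← integral_indicator measurableSet_Iic]
  conv_rhs => rw [← map_levelTime (hfin ω)]
  rw [integral_map (measurable_levelTime_right (hfin ω)).aemeasurable hVt.aestronglyMeasurable,
    ← integral_indicator ((measurableSet_level_ne_top_right (hfin ω)).inter measurableSet_Ioi)]
  refine integral_congr_ae (Eventually.of_forall fun u => ?_)
  by_cases hz : (ω, u) ∈ A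
  · have h1 := hlt hz.1
    have h2 : levelTime (m ω) u ≤ t := (levelTime_le_iff (hfin ω) h1).2 hz.1
    have h3 : u ∈ {u | level (m ω) u ≠ ⊤} ∩ Ioi 0 := ⟨h1, hz.2⟩
    simp only [indicator_of_mem hz, indicator_of_mem h3, indicator_of_mem (mem_Iic.2 h2), σ',
      piecewise_eq_of_mem _ _ _ hz, σ, min_eq_left h2]
  · simp only [indicator_of_notMem hz]
    by_cases h3 : u ∈ {u | level (m ω) u ≠ ⊤} ∩ Ioi 0
    · rw [indicator_of_mem h3, indicator_of_notMem]
      intro h4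
      exact hz ⟨(levelTime_le_iff (hfin ω) h3.1).1 h4, h3.2⟩
    · rw [indicator_of_notMem h3]

/-- The integral of a progressive process against an adapted random measure is adapted. -/
lemma IsAdaptedMeasure.stronglyAdapted_setIntegral (h : IsAdaptedMeasure F m)
    {V : horizon T → Ω → X} (hV : IsStronglyProgressive F V) :
    StronglyAdapted F fun t ω => ∫ s in Iic t, V s ω ∂(m ω) := fun t =>
  @stronglyMeasurable_setIntegral T X _ _ Ω (F t) m h.finite t
    (fun s hs => (h.adapted s).mono (F.mono hs) le_rfl) V (hV t)

lemma stronglyMeasurable_of_isStronglyProgressive {β : Type*} [TopologicalSpace β]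
    [TopologicalSpace.PseudoMetrizableSpace β] {V : horizon T → Ω → β}
    (hV : IsStronglyProgressive F V) :
    StronglyMeasurable fun z : horizon T × Ω => V z.1 z.2 := by
  have h : ∀ K : ℕ, StronglyMeasurable fun z : horizon T × Ω => V (min z.1 (clamp T K)) z.2 := by
    intro K
    have h1 : StronglyMeasurable fun p : Iic (clamp T K) × Ω => V p.1 p.2 :=
      (hV (clamp T K)).mono (sup_le_sup le_rfl (MeasurableSpace.comap_mono (F.le _)))
    exact h1.comp_measurable (g := fun z : horizon T × Ω =>
      ((⟨min z.1 (clamp T K), mem_Iic.2 (min_le_right _ _)⟩ : Iic (clamp T K)), z.2))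
      ((Measurable.subtype_mk (measurable_fst.min measurable_const)).prodMk measurable_snd)
  refine stronglyMeasurable_of_tendsto atTop h (tendsto_pi_nhds.2 fun z => ?_)
  obtain ⟨N, hN⟩ := exists_le_clamp_natCast z.1
  refine tendsto_const_nhds.congr' ?_
  filter_upwards [eventually_ge_atTop N] with K hK
  rw [min_eq_left (hN K hK)]

end AdaptedMeasure

/-! ### Progressive densities -/

section SeqLim

variable {X : Type*} [NormedAddCommGroup X]

open Classical in
/-- The limit of a sequence, and `0` if there is none. -/
def seqLim (f : ℕ → X) : X := if ∃ c, Tendsto f atTop (𝓝 c) then limUnder atTop f else 0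

lemma seqLim_eq {f : ℕ → X} {c : X} (h : Tendsto f atTop (𝓝 c)) : seqLim f = c := by
  rw [seqLim, if_pos ⟨c, h⟩, h.limUnder_eq]

lemma tendsto_seqLim {f : ℕ → X} (h : ∃ c, Tendsto f atTop (𝓝 c)) :
    Tendsto f atTop (𝓝 (seqLim f)) := by
  obtain ⟨c, hc⟩ := h
  rwa [seqLim_eq hc]

lemma seqLim_congr {f f' : ℕ → X} (h : f =ᶠ[atTop] f') : seqLim f = seqLim f' := by
  by_cases hf : ∃ c, Tendsto f atTop (𝓝 c)
  · obtain ⟨c, hc⟩ := hf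
    rw [seqLim_eq hc, seqLim_eq (hc.congr' h)]
  · have hf' : ¬ ∃ c, Tendsto f' atTop (𝓝 c) := fun ⟨c, hc⟩ => hf ⟨c, hc.congr' h.symm⟩
    rw [seqLim, seqLim, if_neg hf, if_neg hf']

lemma seqLim_nonneg [PartialOrder X] [OrderClosedTopology X] {f : ℕ → X} (h : ∀ j, 0 ≤ f j) :
    0 ≤ seqLim f := by
  by_cases hf : ∃ c, Tendsto f atTop (𝓝 c)
  · exact ge_of_tendsto' (tendsto_seqLim hf) h
  · rw [seqLim, if_neg hf]

lemma stronglyMeasurable_seqLim [CompleteSpace X] {α : Type*} [MeasurableSpace α]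
    {f : ℕ → α → X} (hf : ∀ j, StronglyMeasurable (f j)) :
    StronglyMeasurable fun a => seqLim fun j => f j a := by
  unfold seqLim
  exact StronglyMeasurable.ite (StronglyMeasurable.measurableSet_exists_tendsto hf)
    (StronglyMeasurable.limUnder hf) stronglyMeasurable_const

end SeqLim

section Progressive

variable {X : Type*} [NormedAddCommGroup X] {T : ℝ≥0∞}

lemma stronglyMeasurable_seqLim_Iic [CompleteSpace X] {Ω : Type*} [MeasurableSpace Ω]
    (t : horizon T) {φ : ℕ → ℕ} (hφ : ∀ j, j ≤ φ j) {c : ℕ → ℕ → Ω → X}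
    (hc : ∀ j k, gridPt T (φ j) k ≤ t → StronglyMeasurable (c j k))
    (ht : StronglyMeasurable fun ω => seqLim fun j => c j (cellIdx (φ j) t) ω) :
    StronglyMeasurable fun p : Iic t × Ω => seqLim fun j => c j (cellIdx (φ j) (p.1 : horizon T)) p.2
    := by
  classical
  let c' : ℕ → ℕ → Ω → X := fun j k => if gridPt T (φ j) k ≤ t then c j k else 0
  have hc' : ∀ j k, StronglyMeasurable (c' j k) := by
    intro j k
    by_cases h : gridPt T (φ j) k ≤ t
    · simp only [c', if_pos h]; exact hc j k h
    · simp only [c', if_neg h]; exact stronglyMeasurable_zero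
  have h1 : StronglyMeasurable fun p : Iic t × Ω =>
      seqLim fun j => c' j (cellIdx (φ j) (p.1 : horizon T)) p.2 :=
    stronglyMeasurable_seqLim fun j => stronglyMeasurable_of_nat_index (hc' j)
      ((measurable_cellIdx (φ j)).comp (measurable_subtype_coe.comp measurable_fst)) measurable_snd
  have h2 : StronglyMeasurable fun p : Iic t × Ω => seqLim fun j => c j (cellIdx (φ j) t) p.2 :=
    ht.comp_measurable measurable_snd
  have hset : MeasurableSet {p : Iic t × Ω | (p.1 : horizon T) < t} :=
    (measurable_subtype_coe.comp measurable_fst) measurableSet_Iio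
  convert StronglyMeasurable.piecewise hset h1 h2 using 1
  funext p
  by_cases hp : (p.1 : horizon T) < t
  · rw [piecewise_eq_of_mem _ _ _ (show p ∈ {p : Iic t × Ω | (p.1 : horizon T) < t} from hp)]
    obtain ⟨N, hN⟩ := (((tendsto_nhdsWithin_iff.1
      (tendsto_clamp_add (p.1 : horizon T))).1).eventually_lt_const hp).exists
    refine seqLim_congr ?_
    filter_upwards [eventually_ge_atTop N] with j hj
    have h3 : gridPt T (φ j) (cellIdx (φ j) (p.1 : horizon T)) ≤ t :=
      (roundUp_le_clamp_add (hj.trans (hφ j)) _).trans hN.le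
    simp only [c', if_pos h3]
  · rw [piecewise_eq_of_notMem _ _ _ (show p ∉ {p : Iic t × Ω | (p.1 : horizon T) < t} from hp)]
    rw [le_antisymm (mem_Iic.1 p.1.2) (not_lt.1 hp)]

variable {Ω : Type*} {mΩ : MeasurableSpace Ω} {F : Filtration (horizon T) mΩ}

/-- The limit of processes that are constant in time on the cells of the grid and known at the right
end points of the cells is progressive: the look-ahead vanishes in the limit, and the filtration is
right-continuous. -/
lemma isStronglyProgressive_seqLim [CompleteSpace X] (hF : F.IsRightContinuous) {φ : ℕ → ℕ}
    (hφ : ∀ j, j ≤ φ j) {c : ℕ → ℕ → Ω → X}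
    (hc : ∀ j k, StronglyMeasurable[F (gridPt T (φ j) k)] (c j k)) :
    IsStronglyProgressive F fun s ω => seqLim fun j => c j (cellIdx (φ j) s) ω := by
  intro t
  refine @stronglyMeasurable_seqLim_Iic X _ T _ Ω (F t) t φ hφ c
    (fun j k hk => (hc j k).mono (F.mono hk)) ?_
  refine stronglyMeasurable_of_tendsto_right hF (tendsto_clamp_add t) (Eventually.of_forall ?_)
  intro N
  have e : (fun ω => seqLim fun j => c j (cellIdx (φ j) t) ω) =
      fun ω => seqLim fun j => if N ≤ j then c j (cellIdx (φ j) t) ω else 0 := by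
    funext ω
    refine seqLim_congr ?_
    filter_upwards [eventually_ge_atTop N] with j hj
    rw [if_pos hj]
  rw [e]
  refine @stronglyMeasurable_seqLim X _ _ Ω (F (clamp T ((t : ℝ≥0) + 1 / 2 ^ N)))
    (fun j ω => if N ≤ j then c j (cellIdx (φ j) t) ω else 0) fun j => ?_
  by_cases hj : N ≤ j
  · simp only [if_pos hj]
    exact (hc j _).mono (F.mono (roundUp_le_clamp_add (hj.trans (hφ j)) t))
  · simp only [if_neg hj]
    exact @stronglyMeasurable_const _ _ (F _) _ _

namespace IsAdaptedMeasure

variable {m : Ω → Measure (horizon T)}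

lemma measurable_Ioc (h : IsAdaptedMeasure F m) {a b : horizon T} (hab : a ≤ b) :
    Measurable[F b] fun ω => m ω (Ioc a b) := by
  have e : (fun ω => m ω (Ioc a b)) = fun ω => m ω (Iic b) - m ω (Iic a) := by
    funext ω
    rw [← measure_sdiff (Iic_subset_Iic.2 hab) measurableSet_Iic.nullMeasurableSet
      (h.finite ω a).ne, Iic_sdiff_Iic]
  rw [e]
  exact (h.adapted b).sub ((h.adapted a).mono (F.mono hab) le_rfl)

variable [NormedSpace ℝ X]

lemma stronglyMeasurable_cellQuot (h : IsAdaptedMeasure F m) {ν : horizon T → Ω → X}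
    (hν : StronglyAdapted F ν) (N k : ℕ) :
    StronglyMeasurable[F (gridPt T N k)] fun ω => cellQuot (m ω) (fun t => ν t ω) N k := by
  rcases k with _ | k
  · have h1 : Measurable[F (gridPt T N 0)] fun ω => m ω (cellIdx N ⁻¹' {0}) := by
      rw [← Iic_gridPt_zero]; exact h.adapted _
    refine StronglyMeasurable.smul (h1.ennreal_toReal.inv).stronglyMeasurable ?_
    rw [gridPt_zero]
    exact hν ⊥
  · have h1 : Measurable[F (gridPt T N (k + 1))] fun ω => m ω (cellIdx N ⁻¹' {k + 1}) := by
      rw [preimage_cellIdx_succ]; exact h.measurable_Ioc (gridPt_mono N (Nat.le_succ k))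
    exact StronglyMeasurable.smul (h1.ennreal_toReal.inv).stronglyMeasurable
      ((hν _).sub ((hν _).mono (F.mono (gridPt_mono N (Nat.le_succ k)))))

lemma stronglyMeasurable_dyadicQuot (h : IsAdaptedMeasure F m) {ν : horizon T → Ω → X}
    (hν : StronglyAdapted F ν) (N : ℕ) :
    StronglyMeasurable fun z : horizon T × Ω => dyadicQuot (m z.2) (fun t => ν t z.2) N z.1 :=
  stronglyMeasurable_of_nat_index (h := fun k ω => cellQuot (m ω) (fun t => ν t ω) N k)
    (fun k => (h.stronglyMeasurable_cellQuot hν N k).mono (F.le _))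
    ((measurable_cellIdx N).comp measurable_fst) measurable_snd

end IsAdaptedMeasure

variable [PartialOrder X]

lemma IsRegularControl.isDominated {ν : horizon T → Ω → X} (hν : IsRegularControl F ν) (ω : Ω) :
    IsDominated (fun t => ν t ω) (variationMeasure fun t => ν t ω) :=
  isDominated_variationMeasure (hν.path ω).finiteVariation (hν.path ω).rightContinuous

lemma IsRegularControl.isAdaptedMeasure {ν : horizon T → Ω → X} (hν : IsRegularControl F ν) :
    IsAdaptedMeasure F fun ω => variationMeasure fun t => ν t ω where
  finite ω := (hν.isDominated ω).finite
  adapted t := by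
    rw [funext fun ω => variationMeasure_Iic (hν.path ω).finiteVariation
      (hν.path ω).rightContinuous t]
    exact Measurable.add ((hν.adapted ⊥).mono (F.mono bot_le)).enorm
      (measurable_eVariationOn hν.adapted (fun ω => (hν.path ω).rightContinuous) t)

variable [NormedSpace ℝ X] [CompleteSpace X] [IsOrderedAddMonoid X] [IsOrderedModule ℝ X]

/-- The dyadic difference quotients of almost every path converge along a sequence of meshes that
does not depend on the path. -/
lemma IsRegularControl.exists_mesh {P : Measure Ω} [IsFiniteMeasure P] {r : ℝ} (hr : 1 ≤ r)
    (hX : UniformlyConvexNormPow X r) {ν : horizon T → Ω → X} (hν : IsRegularControl F ν) :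
    ∃ φ : ℕ → ℕ, (∀ j, j ≤ φ j) ∧ ∀ᵐ ω ∂P, ∀ᵐ s ∂(variationMeasure fun t => ν t ω),
      ∃ c, Tendsto (fun j => dyadicQuot (variationMeasure fun t => ν t ω) (fun t => ν t ω) (φ j) s)
        atTop (𝓝 c) := by
  have hm := hν.isAdaptedMeasure
  set m : Ω → Measure (horizon T) := fun ω => variationMeasure fun t => ν t ω with hm_def
  let Q : ℕ → horizon T → Ω → X := fun N s ω => dyadicQuot (m ω) (fun t => ν t ω) N s
  let I : ℕ → ℕ → ℕ → Ω → ℝ≥0∞ := fun K N N' ω =>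
    ∫⁻ s in Iic (clamp T K), ‖Q N s ω - Q N' s ω‖ₑ ∂(m ω)
  have hI : ∀ K N N', Measurable (I K N N') := by
    intro K N N'
    have h1 : Measurable fun z : horizon T × Ω =>
        (Iic (clamp T K)).indicator (fun s => ‖Q N s z.2 - Q N' s z.2‖ₑ) z.1 :=
      Measurable.indicator (f := fun z : horizon T × Ω => ‖Q N z.1 z.2 - Q N' z.1 z.2‖ₑ)
        ((hm.stronglyMeasurable_dyadicQuot hν.adapted N).sub
          (hm.stronglyMeasurable_dyadicQuot hν.adapted N')).enorm
        (measurable_fst measurableSet_Iic)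
    have h2 := hm.measurable_lintegral (f := fun s ω =>
      (Iic (clamp T K)).indicator (fun s => ‖Q N s ω - Q N' s ω‖ₑ) s) h1
    simp only [lintegral_indicator measurableSet_Iic] at h2
    exact h2
  -- the event that the Cauchy criterion with tolerance `2⁻ᵏ` on `[0, k]` fails beyond `N`
  let A : ℕ → ℕ → Set Ω := fun k N =>
    ⋃ N₁ : ℕ, ⋃ N₂ : ℕ, {ω | N ≤ N₁ ∧ N₁ ≤ N₂ ∧ ENNReal.ofReal ((1 / 2) ^ k) < I k N₁ N₂ ω}
  have hA : ∀ k N, MeasurableSet (A k N) := fun k N =>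
    MeasurableSet.iUnion fun N₁ => MeasurableSet.iUnion fun N₂ =>
      (MeasurableSet.const _).inter ((MeasurableSet.const _).inter
        (measurableSet_lt measurable_const (hI k N₁ N₂)))
  have hev : ∀ k, ∀ᶠ N in atTop, P (A k N) ≤ ENNReal.ofReal ((1 / 2) ^ k) := by
    intro k
    have hanti : Antitone (A k) := by
      intro N N' hN ω hω
      simp only [A, mem_iUnion, mem_ofPred_eq] at hω ⊢
      obtain ⟨N₁, N₂, h1, h2⟩ := hω
      exact ⟨N₁, N₂, hN.trans h1, h2⟩
    have hlim := tendsto_measure_iInter_atTop (μ := P) (fun N => (hA k N).nullMeasurableSet) hanti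
      ⟨0, measure_ne_top _ _⟩
    have hempty : ⋂ N, A k N = ∅ := by
      refine eq_empty_of_forall_notMem fun ω hω => ?_
      obtain ⟨N, hN⟩ := ((hν.isDominated ω).eventually_lintegral_dyadicQuot_sub_le hr hX
        ((hν.path ω).nonneg ⊥) (hν.path ω).monotone k
        (ε := (1 / 2) ^ k) (by positivity)).exists_forall_of_atTop
      have h1 := mem_iInter.1 hω N
      simp only [A, mem_iUnion, mem_ofPred_eq] at h1
      obtain ⟨N₁, N₂, h1, h2, h3⟩ := h1
      exact h3.not_ge (hN N₁ h1 N₂ h2)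
    rw [hempty, measure_empty] at hlim
    exact (hlim.eventually_lt_const (by positivity)).mono fun N hN => hN.le
  obtain ⟨φ, hφ, hPφ⟩ := extraction_forall_of_eventually hev
  refine ⟨φ, fun j => hφ.le_apply, ?_⟩
  have hsum : ∑' k, P (A k (φ k)) ≠ ∞ := by
    refine ne_top_of_le_ne_top ?_ (ENNReal.tsum_le_tsum hPφ)
    rw [← ENNReal.ofReal_tsum_of_nonneg (fun k => by positivity) summable_geometric_two]
    exact ENNReal.ofReal_ne_top
  filter_upwards [ae_eventually_notMem hsum] with ω hω
  obtain ⟨k₀, hk₀⟩ := hω.exists_forall_of_atTop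
  refine ae_of_forall_ae_restrict_Iic fun K => ?_
  set k₁ := max K k₀
  have hbound : ∀ j, ∫⁻ s in Iic (clamp T K), ‖Q (φ (j + k₁)) s ω - Q (φ (j + k₁ + 1)) s ω‖ₑ ∂(m ω)
      ≤ ENNReal.ofReal ((1 / 2) ^ (j + k₁)) := by
    intro j
    have h1 := hk₀ (j + k₁) ((le_max_right _ _).trans (Nat.le_add_left _ _))
    simp only [A, mem_iUnion, mem_ofPred_eq, not_exists, not_and, not_lt] at h1
    refine le_trans (lintegral_mono_set (Iic_subset_Iic.2 (clamp_mono ?_)))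
      (h1 _ _ le_rfl (hφ.monotone (Nat.le_succ _)))
    exact_mod_cast (le_max_left K k₀).trans (Nat.le_add_left _ _)
  have hQm : ∀ N, StronglyMeasurable fun s => Q N s ω := fun N =>
    SingularControl.stronglyMeasurable_dyadicQuot _ _ N
  have hEm : ∀ j, Measurable fun s => ‖Q (φ (j + k₁)) s ω - Q (φ (j + k₁ + 1)) s ω‖ₑ := fun j =>
    ((hQm _).sub (hQm _)).enorm
  have hfin : ∫⁻ s in Iic (clamp T K), ∑' j, ‖Q (φ (j + k₁)) s ω - Q (φ (j + k₁ + 1)) s ω‖ₑ ∂(m ω)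
      ≠ ∞ := by
    rw [lintegral_tsum fun j => (hEm j).aemeasurable]
    refine ne_top_of_le_ne_top ?_ (ENNReal.tsum_le_tsum hbound)
    rw [← ENNReal.ofReal_tsum_of_nonneg (fun k => by positivity)
      ((summable_nat_add_iff k₁).2 summable_geometric_two)]
    exact ENNReal.ofReal_ne_top
  filter_upwards [ae_lt_top (Measurable.tsum hEm) hfin] with s hs
  have hcauchy : CauchySeq fun j => Q (φ (j + k₁)) s ω := by
    refine cauchySeq_of_edist_le_of_tsum_ne_top
      (fun j => ‖Q (φ (j + k₁)) s ω - Q (φ (j + k₁ + 1)) s ω‖ₑ) (fun j => ?_) hs.ne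
    rw [edist_eq_enorm_sub, Nat.succ_add]
  obtain ⟨c, hc⟩ := cauchySeq_tendsto_of_complete hcauchy
  exact ⟨c, (tendsto_add_atTop_iff_nat (f := fun j => Q (φ j) s ω) k₁).1 hc⟩

omit [IsOrderedAddMonoid X] [IsOrderedModule ℝ X] in
lemma IsRegularControl.isStronglyProgressive_seqLim_dyadicQuot (hF : F.IsRightContinuous)
    {ν : horizon T → Ω → X} (hν : IsRegularControl F ν) {φ : ℕ → ℕ} (hφ : ∀ j, j ≤ φ j) :
    IsStronglyProgressive F fun s ω => seqLim fun j =>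
      dyadicQuot (variationMeasure fun t => ν t ω) (fun t => ν t ω) (φ j) s := by
  have hc := fun j => hν.isAdaptedMeasure.stronglyMeasurable_cellQuot hν.adapted (φ j)
  exact isStronglyProgressive_seqLim (c := fun j k ω =>
      cellQuot (variationMeasure fun t => ν t ω) (fun t => ν t ω) (φ j) k) hF hφ hc

/-- A control has a progressive density with respect to its variation. -/
lemma IsRegularControl.exists_progressive_density [OrderClosedTopology X] {P : Measure Ω}
    [IsFiniteMeasure P] (hF : F.IsRightContinuous) {r : ℝ} (hr : 1 ≤ r)
    (hX : UniformlyConvexNormPow X r) {ν : horizon T → Ω → X} (hν : IsRegularControl F ν) :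
    ∃ ρ : horizon T → Ω → X, IsStronglyProgressive F ρ ∧ (∀ s ω, 0 ≤ ρ s ω) ∧
      ∀ᵐ ω ∂P, IsRepresentation (fun t => ν t ω) (variationMeasure fun t => ν t ω)
        fun s => ρ s ω := by
  obtain ⟨φ, hφ, hlim⟩ := hν.exists_mesh (P := P) hr hX
  have hρ := hν.isStronglyProgressive_seqLim_dyadicQuot hF hφ
  have hρ0 : ∀ (s : horizon T) ω, 0 ≤ seqLim fun j =>
      dyadicQuot (variationMeasure fun t => ν t ω) (fun t => ν t ω) (φ j) s := fun s ω =>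
    seqLim_nonneg fun j => dyadicQuot_nonneg ((hν.path ω).nonneg ⊥) (hν.path ω).monotone _ _
  refine ⟨_, hρ, hρ0, ?_⟩
  filter_upwards [hlim] with ω hω
  have hρm := (stronglyMeasurable_of_isStronglyProgressive hρ).comp_measurable
    (measurable_prodMk_right (y := ω))
  have := (hν.isDominated ω).isRepresented_of_tendsto (hν.path ω).rightContinuous hφ hρm
    (hω.mono fun s hs => tendsto_seqLim hs)
  exact ⟨(hν.isDominated ω).finite, hρm, fun s => hρ0 s ω, fun t => (this t).1,
    fun t => (this t).2⟩

end Progressive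

/-! ### Extended integrals of differences -/

section ExtIntegral

variable {α : Type*} [MeasurableSpace α] {m : Measure α}

lemma extIntegral_congr_ae {f f' : α → EReal} (h : f =ᵐ[m] f') :
    extIntegral m f = extIntegral m f' := by
  unfold extIntegral
  rw [lintegral_congr_ae (h.mono fun a ha => by simp only [ha] :
      (fun a => (f a).toENNReal) =ᵐ[m] fun a => (f' a).toENNReal),
    lintegral_congr_ae (h.mono fun a ha => by simp only [ha] :
      (fun a => (-f a).toENNReal) =ᵐ[m] fun a => (-f' a).toENNReal)]

lemma ereal_sub_eq_of_add_eq {x z a b : ℝ≥0∞} (hz : z ≠ ∞) (hb : b ≠ ∞) (h : x + b = z + a) :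
    (x : EReal) - z = (a : EReal) - b := by
  lift z to ℝ≥0 using hz
  lift b to ℝ≥0 using hb
  induction x with
  | top =>
    have ha : a = ∞ := by
      by_contra ha
      exact ENNReal.add_ne_top.2 ⟨ENNReal.coe_ne_top, ha⟩ (by rw [← h, top_add])
    subst ha
    simp
  | coe x =>
    have ha : a ≠ ∞ := by
      rintro rfl
      rw [add_top] at h
      exact ENNReal.add_ne_top.2 ⟨ENNReal.coe_ne_top, ENNReal.coe_ne_top⟩ h
    lift a to ℝ≥0 using ha
    have h' : (x : ℝ) + b = z + a := by exact_mod_cast h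
    change ((x : ℝ) : EReal) - ((z : ℝ) : EReal) = ((a : ℝ) : EReal) - ((b : ℝ) : EReal)
    rw [← EReal.coe_sub, ← EReal.coe_sub]
    congr 1
    linarith

lemma toENNReal_coe_sub {a b : ℝ≥0∞} (hb : b ≠ ∞) :
    ((a : EReal) - b).toENNReal = a - b ∧ (-((a : EReal) - b)).toENNReal = b - a := by
  lift b to ℝ≥0 using hb
  induction a with
  | top =>
    simp
  | coe a =>
    have e : ((a : ℝ≥0∞) : EReal) - ((b : ℝ≥0∞) : EReal) = (((a : ℝ) - b : ℝ) : EReal) := rfl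
    rw [e, ← EReal.coe_neg, EReal.toENNReal_of_ne_top (EReal.coe_ne_top _),
      EReal.toENNReal_of_ne_top (EReal.coe_ne_top _), EReal.toReal_coe, EReal.toReal_coe, neg_sub,
      ENNReal.ofReal_sub _ b.coe_nonneg, ENNReal.ofReal_sub _ a.coe_nonneg]
    simp

/-- The extended integral of a difference of nonnegative functions, the second one integrable. -/
lemma extIntegral_coe_sub {f b : α → ℝ≥0∞} (hf : AEMeasurable f m) (hb : AEMeasurable b m)
    (hbfin : ∫⁻ a, b a ∂m ≠ ∞) :
    extIntegral m (fun a => (f a : EReal) - (b a : EReal)) =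
      ((∫⁻ a, f a ∂m : ℝ≥0∞) : EReal) - ((∫⁻ a, b a ∂m : ℝ≥0∞) : EReal) := by
  have hbae := ae_lt_top' hb hbfin
  have e1 : ∫⁻ a, ((f a : EReal) - (b a : EReal)).toENNReal ∂m = ∫⁻ a, f a - b a ∂m :=
    lintegral_congr_ae (hbae.mono fun a ha => (toENNReal_coe_sub ha.ne).1)
  have e2 : ∫⁻ a, (-((f a : EReal) - (b a : EReal))).toENNReal ∂m = ∫⁻ a, b a - f a ∂m :=
    lintegral_congr_ae (hbae.mono fun a ha => (toENNReal_coe_sub ha.ne).2)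
  unfold extIntegral
  rw [e1, e2]
  refine ereal_sub_eq_of_add_eq
    (ne_top_of_le_ne_top hbfin (lintegral_mono fun a => tsub_le_self)) hbfin ?_
  rw [← lintegral_add_right' _ hb, ← lintegral_add_right' _ hf]
  refine lintegral_congr fun a => ?_
  rw [tsub_add_eq_max, tsub_add_eq_max, max_comm]

end ExtIntegral

/-! ### Strongly continuous groups -/

namespace IsC0Group

variable {X : Type*} [NormedAddCommGroup X] [NormedSpace ℝ X] {S : ℝ → X →L[ℝ] X}

lemma apply_apply (hS : IsC0Group S) (s t : ℝ) (v : X) : S s (S t v) = S (s + t) v := by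
  rw [hS.add]; rfl

lemma exists_norm_le [CompleteSpace X] (hS : IsC0Group S) (a b : ℝ) :
    ∃ C, ∀ s ∈ Icc a b, ‖S s‖ ≤ C := by
  obtain ⟨C, hC⟩ := banach_steinhaus (g := fun s : Icc a b => S s) fun v => by
    obtain ⟨C, hC⟩ := isCompact_Icc.exists_bound_of_continuousOn
      (s := Icc a b) (hS.continuous v).continuousOn
    exact ⟨C, fun s => hC s s.2⟩
  exact ⟨C, fun s hs => hC ⟨s, hs⟩⟩

lemma continuous_uncurry [CompleteSpace X] (hS : IsC0Group S) :
    Continuous fun z : ℝ × X => S z.1 z.2 := by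
  refine continuous_iff_continuousAt.2 fun ⟨s₀, v₀⟩ => ?_
  obtain ⟨C, hC⟩ := hS.exists_norm_le (s₀ - 1) (s₀ + 1)
  have h1 : Tendsto (fun z : ℝ × X => S z.1 (z.2 - v₀)) (𝓝 (s₀, v₀)) (𝓝 0) := by
    have h2 : Tendsto (fun z : ℝ × X => C * ‖z.2 - v₀‖) (𝓝 (s₀, v₀)) (𝓝 0) := by
      have : Continuous fun z : ℝ × X => C * ‖z.2 - v₀‖ := by fun_prop
      simpa using this.tendsto (s₀, v₀)
    refine squeeze_zero_norm' ?_ h2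
    have h3 : ∀ᶠ z : ℝ × X in 𝓝 (s₀, v₀), z.1 ∈ Icc (s₀ - 1) (s₀ + 1) :=
      continuous_fst.continuousAt (Icc_mem_nhds (by simp) (by simp))
    filter_upwards [h3] with z hz
    exact (S z.1).le_of_opNorm_le (hC _ hz) _
  have h4 : Tendsto (fun z : ℝ × X => S z.1 v₀) (𝓝 (s₀, v₀)) (𝓝 (S s₀ v₀)) :=
    ((hS.continuous v₀).comp continuous_fst).tendsto (s₀, v₀)
  have h5 := h1.add h4
  simp only [map_sub, sub_add_cancel, zero_add] at h5
  exact h5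

lemma stronglyMeasurable_apply [CompleteSpace X] (hS : IsC0Group S) {α : Type*}
    [MeasurableSpace α] {τ : α → ℝ} {v : α → X} (hτ : Measurable τ) (hv : StronglyMeasurable v) :
    StronglyMeasurable fun a => S (τ a) (v a) :=
  hS.continuous_uncurry.comp_stronglyMeasurable (hτ.stronglyMeasurable.prodMk hv)

variable [CompleteSpace X] {T : ℝ≥0∞}

lemma measurable_coe_horizon : Measurable fun s : horizon T => ((s : ℝ≥0) : ℝ) :=
  measurable_coe_nnreal_real.comp measurable_subtype_coe

lemma isStronglyProgressive_apply (hS : IsC0Group S) {Ω : Type*} {mΩ : MeasurableSpace Ω}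
    {F : Filtration (horizon T) mΩ} {V : horizon T → Ω → X} (hV : IsStronglyProgressive F V) :
    IsStronglyProgressive F fun s ω => S ((s : ℝ≥0) : ℝ) (V s ω) := fun t =>
  @stronglyMeasurable_apply X _ _ S _ hS (Iic t × Ω) (@Prod.instMeasurableSpace _ _ _ (F t))
    (fun z => (((z.1 : horizon T) : ℝ≥0) : ℝ)) _
    (measurable_coe_horizon.comp (measurable_subtype_coe.comp (@measurable_fst _ _ _ (F t)))) (hV t)

lemma integrableOn_apply (hS : IsC0Group S) {m : Measure (horizon T)} {ρ : horizon T → X}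
    (hρ : StronglyMeasurable ρ) {t : horizon T} (hint : IntegrableOn ρ (Iic t) m) :
    IntegrableOn (fun s : horizon T => S ((s : ℝ≥0) : ℝ) (ρ s)) (Iic t) m := by
  obtain ⟨C, hC⟩ := hS.exists_norm_le 0 ((t : ℝ≥0) : ℝ)
  refine Integrable.mono' (hint.norm.const_mul C)
    (hS.stronglyMeasurable_apply measurable_coe_horizon hρ).aestronglyMeasurable ?_
  filter_upwards [ae_restrict_mem measurableSet_Iic] with s hs
  exact (S _).le_of_opNorm_le (hC _ ⟨NNReal.coe_nonneg _, NNReal.coe_le_coe.2 (mem_Iic.1 hs)⟩) _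

end IsC0Group

/-! ### Right-continuous processes -/

section RightContinuous

variable {T : ℝ≥0∞} {Ω : Type*} {mΩ : MeasurableSpace Ω} {F : Filtration (horizon T) mΩ}

lemma stronglyMeasurable_of_rightContinuous {β : Type*} [TopologicalSpace β]
    [TopologicalSpace.PseudoMetrizableSpace β] {u : horizon T → Ω → β} (hu : StronglyAdapted F u)
    (hrc : ∀ ω t, ContinuousWithinAt (fun s => u s ω) (Ici t) t) :
    StronglyMeasurable fun z : horizon T × Ω => u z.1 z.2 := by
  refine stronglyMeasurable_of_tendsto atTop
    (f := fun (n : ℕ) (z : horizon T × Ω) => u (roundUp n z.1) z.2) (fun n => ?_) ?_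
  · exact stronglyMeasurable_of_nat_index (h := fun k ω => u (gridPt T n k) ω)
      (fun k => (hu _).mono (F.le _)) ((measurable_cellIdx n).comp measurable_fst) measurable_snd
  · exact tendsto_pi_nhds.2 fun z => (hrc z.2 z.1).tendsto.comp (tendsto_roundUp z.1)

variable {X : Type*} [NormedAddCommGroup X] [NormedSpace ℝ X] [PartialOrder X]

/-- A cost process with values in the nonnegative cone and right-continuous paths, without
exceptional event. -/
structure IsRegularCost (F : Filtration (horizon T) mΩ) (Φ : horizon T → Ω → X →L[ℝ] ℝ) :
    Prop where
  adapted : StronglyAdapted F Φ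
  nonneg : ∀ t ω v, 0 ≤ v → 0 ≤ Φ t ω v
  rightContinuous : ∀ ω t, ContinuousWithinAt (fun s => Φ s ω) (Ici t) t

lemma IsCostProcess.exists_regular {P : Measure Ω} (hF : UsualConditions F P)
    {Φ : horizon T → Ω → X →L[ℝ] ℝ} (h : IsCostProcess F P Φ) :
    ∃ Φ', IsRegularCost F Φ' ∧ ∀ᵐ ω ∂P, ∀ t, Φ' t ω = Φ t ω := by
  have hgood := h.nonneg.and h.rightContinuous
  set N : Set Ω := {ω | ¬ ((∀ t v, 0 ≤ v → 0 ≤ Φ t ω v) ∧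
    ∀ t, ContinuousWithinAt (fun s => Φ s ω) (Ici t) t)} with hN
  refine ⟨fun t => Nᶜ.indicator (Φ t), ⟨fun t => ?_, fun t ω v hv => ?_, fun ω t => ?_⟩, ?_⟩
  · exact stronglyMeasurable_indicator_compl_null hF (ae_iff.1 hgood) (h.adapted t)
  · by_cases hω : ω ∈ N
    · simp only [indicator_of_notMem (show ω ∉ Nᶜ by simpa using hω)]
      exact le_rfl
    · simp only [indicator_of_mem (show ω ∈ Nᶜ from hω)]
      exact (not_not.1 hω).1 t v hv
  · by_cases hω : ω ∈ N
    · simp only [indicator_of_notMem (show ω ∉ Nᶜ by simpa using hω)]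
      exact continuousWithinAt_const
    · simp only [indicator_of_mem (show ω ∈ Nᶜ from hω)]
      exact (not_not.1 hω).2 t
  · filter_upwards [hgood] with ω hω t
    rw [indicator_of_mem]
    exact fun h => h hω

lemma IsRegularCost.stronglyMeasurable {Φ : horizon T → Ω → X →L[ℝ] ℝ}
    (h : IsRegularCost F Φ) : StronglyMeasurable fun z : horizon T × Ω => Φ z.1 z.2 :=
  stronglyMeasurable_of_rightContinuous h.adapted h.rightContinuous

lemma IsRegularCost.stronglyMeasurable_path {Φ : horizon T → Ω → X →L[ℝ] ℝ}
    (h : IsRegularCost F Φ) (ω : Ω) : StronglyMeasurable fun s => Φ s ω :=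
  h.stronglyMeasurable.comp_measurable measurable_prodMk_right

omit [NormedSpace ℝ X] in
lemma IsRegularControl.stronglyMeasurable {ν : horizon T → Ω → X} (h : IsRegularControl F ν) :
    StronglyMeasurable fun z : horizon T × Ω => ν z.1 z.2 :=
  stronglyMeasurable_of_rightContinuous h.adapted fun ω => (h.path ω).rightContinuous

end RightContinuous

/-! ### The gradient of the running profit -/

section Gradient

variable {X : Type*} [NormedAddCommGroup X] [NormedSpace ℝ X] [PartialOrder X]
  {Ω : Type*} {mΩ : MeasurableSpace Ω} {T : ℝ≥0∞} {F : Filtration (horizon T) mΩ}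
  {S : ℝ → X →L[ℝ] X} {y : X} {Pi : Ω → horizon T → X → ℝ}

lemma IsRunningProfit.tendsto_gradient (hPi : IsRunningProfit F S y Pi) {ω : Ω} {t : horizon T}
    {k w : X} (hk : k ∈ feasible S y t) {c : ℕ → ℝ} (hc0 : ∀ n, c n ≠ 0)
    (hc : Tendsto c atTop (𝓝 0)) (hkw : ∀ n, k + c n • w ∈ feasible S y t) :
    Tendsto (fun n => (c n)⁻¹ * (Pi ω t (k + c n • w) - Pi ω t k)) atTop
      (𝓝 (gradient S y Pi ω t k w)) := by
  have h := ((hPi.contDiff ω t).differentiableOn one_ne_zero k hk).hasFDerivWithinAt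
  have hc' : Tendsto (fun n => c n • w) atTop (𝓝 0) := by simpa using hc.smul_const w
  have hlim := h.lim (α := ℕ) (l := atTop) (c := fun n => (c n)⁻¹) (d := fun n => c n • w) (v := w)
    hc' (Eventually.of_forall hkw) (by
      refine tendsto_const_nhds.congr fun n => ?_
      rw [smul_smul, inv_mul_cancel₀ (hc0 n), one_smul])
  exact hlim

lemma tendsto_one_div_natCast_add_one :
    Tendsto (fun n : ℕ => 1 / ((n : ℝ) + 1)) atTop (𝓝 0) :=
  tendsto_one_div_add_atTop_nhds_zero_nat

variable [IsOrderedAddMonoid X] [IsOrderedModule ℝ X]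

omit [IsOrderedModule ℝ X] in
lemma add_mem_feasible {t : horizon T} {k w : X} (hk : k ∈ feasible S y t) (hw : 0 ≤ w) :
    k + w ∈ feasible S y t :=
  ⟨add_nonneg hk.1 hw, hk.2.trans (le_add_of_nonneg_right hw)⟩

lemma convex_feasible (t : horizon T) : Convex ℝ (feasible S y t) :=
  (convex_Ici 0).inter (convex_Ici _)

namespace IsRunningProfit

variable (hPi : IsRunningProfit F S y Pi)

include hPi

lemma tendsto_gradient_of_nonneg {ω : Ω} {t : horizon T} {k w : X} (hk : k ∈ feasible S y t)
    (hw : 0 ≤ w) :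
    Tendsto (fun n : ℕ => (1 / ((n : ℝ) + 1))⁻¹ * (Pi ω t (k + (1 / ((n : ℝ) + 1)) • w) - Pi ω t k))
      atTop (𝓝 (gradient S y Pi ω t k w)) :=
  hPi.tendsto_gradient hk (fun n => by positivity) tendsto_one_div_natCast_add_one fun n =>
    add_mem_feasible hk (smul_nonneg (by positivity) hw)

lemma gradient_nonneg {ω : Ω} {t : horizon T} {k w : X} (hk : k ∈ feasible S y t)
    (hw : 0 ≤ w) : 0 ≤ gradient S y Pi ω t k w := by
  refine ge_of_tendsto' (hPi.tendsto_gradient_of_nonneg hk hw) fun n => ?_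
  have h1 : 0 ≤ (1 / ((n : ℝ) + 1)) • w := smul_nonneg (by positivity) hw
  exact mul_nonneg (by positivity) (sub_nonneg.2 (hPi.monotone ω t hk.1
    (add_nonneg hk.1 h1) (le_add_of_nonneg_right h1)))

/-- The tangent to a concave function lies above its graph. -/
lemma le_add_gradient {ω : Ω} {t : horizon T} {k k' : X} (hk : k ∈ feasible S y t)
    (hk' : k' ∈ feasible S y t) : Pi ω t k' ≤ Pi ω t k + gradient S y Pi ω t k (k' - k) := by
  have hconv : ∀ n : ℕ, k + (1 / ((n : ℝ) + 1)) • (k' - k) =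
      (1 - 1 / ((n : ℝ) + 1)) • k + (1 / ((n : ℝ) + 1)) • k' := fun n => by module
  have hc : ∀ n : ℕ, 0 ≤ 1 - 1 / ((n : ℝ) + 1) := fun n => by
    rw [sub_nonneg, div_le_one (by positivity)]
    linarith [(Nat.cast_nonneg n : (0 : ℝ) ≤ n)]
  have hlim := hPi.tendsto_gradient (ω := ω) (w := k' - k) hk
    (c := fun n : ℕ => 1 / ((n : ℝ) + 1)) (fun n => by positivity)
    tendsto_one_div_natCast_add_one (fun n => by
      rw [hconv]
      exact convex_feasible t hk hk' (hc n) (by positivity) (by ring))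
  have : Pi ω t k' - Pi ω t k ≤ gradient S y Pi ω t k (k' - k) := by
    refine ge_of_tendsto' hlim fun n => ?_
    have h1 := (hPi.concave ω t).2 hk.1 hk'.1 (hc n) (by positivity : 0 ≤ 1 / ((n : ℝ) + 1))
      (by ring)
    simp only [smul_eq_mul] at h1
    have h2 : 0 < 1 / ((n : ℝ) + 1) := by positivity
    rw [hconv, le_inv_mul_iff₀ h2]
    linarith
  linarith

omit [IsOrderedAddMonoid X] [IsOrderedModule ℝ X] in
lemma measurable_comp {α : Type*} [MeasurableSpace α] {ω : α → Ω} (hω : Measurable ω)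
    {t : α → horizon T} (ht : Measurable t) {Z : α → X} (hZ : StronglyMeasurable Z)
    (hZ0 : ∀ a, 0 ≤ Z a) : Measurable fun a => Pi (ω a) (t a) (Z a) := by
  let _ : MeasurableSpace X := borel X
  have _ : BorelSpace X := ⟨rfl⟩
  have h1 : @Measurable α {k : X // 0 ≤ k} _ (borel _) fun a => ⟨Z a, hZ0 a⟩ := by
    rw [← (Subtype.borelSpace _ : BorelSpace {k : X // 0 ≤ k}).measurable_eq]
    exact hZ.measurable.subtype_mk
  have h2 := hPi.measurable
  let _ : MeasurableSpace {k : X // 0 ≤ k} := borel _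
  exact h2.comp (hω.prodMk (ht.prodMk h1))

lemma measurable_gradient {α : Type*} [MeasurableSpace α] {ω : α → Ω} (hω : Measurable ω)
    {t : α → horizon T} (ht : Measurable t) {Z w : α → X} (hZ : StronglyMeasurable Z)
    (hw : StronglyMeasurable w) (hZf : ∀ a, Z a ∈ feasible S y (t a)) (hw0 : ∀ a, 0 ≤ w a) :
    Measurable fun a => gradient S y Pi (ω a) (t a) (Z a) (w a) := by
  refine measurable_of_tendsto_metrizable (f := fun (n : ℕ) a => (1 / ((n : ℝ) + 1))⁻¹ *
    (Pi (ω a) (t a) (Z a + (1 / ((n : ℝ) + 1)) • w a) - Pi (ω a) (t a) (Z a))) (fun n => ?_)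
    (tendsto_pi_nhds.2 fun a => hPi.tendsto_gradient_of_nonneg (hZf a) (hw0 a))
  exact ((hPi.measurable_comp hω ht (hZ.add (hw.const_smul _)) fun a =>
    add_nonneg (hZf a).1 (smul_nonneg (by positivity) (hw0 a))).sub
      (hPi.measurable_comp hω ht hZ fun a => (hZf a).1)).const_mul _

end IsRunningProfit

end Gradient

/-! ### Gain, cost and marginal gain of a control -/

section Functionals

variable {X : Type*} [NormedAddCommGroup X] [NormedSpace ℝ X] [PartialOrder X]
  {Ω : Type*} {mΩ : MeasurableSpace Ω} {T : ℝ≥0∞} {F : Filtration (horizon T) mΩ}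

/-- `ρ` is a progressive process that is almost surely a density of the control `ν` with respect to
its variation. -/
structure IsProgressiveDensity (F : Filtration (horizon T) mΩ) (P : Measure Ω)
    (ν ρ : horizon T → Ω → X) : Prop where
  progressive : IsStronglyProgressive F ρ
  nonneg : ∀ s ω, 0 ≤ ρ s ω
  ae_isRepresentation : ∀ᵐ ω ∂P, IsRepresentation (fun t => ν t ω)
    (variationMeasure fun t => ν t ω) fun s => ρ s ω

/-- `E[∫_0^T Pi(t, e^{tA}(y + ν t)) q(dt)]`. -/
def runningGain (P : Measure Ω) (q : Measure (horizon T)) (S : ℝ → X →L[ℝ] X) (y : X)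
    (Pi : Ω → horizon T → X → ℝ) (ν : horizon T → Ω → X) : ℝ≥0∞ :=
  ∫⁻ z, ENNReal.ofReal (Pi z.1 z.2 (hatState S y ν z.2 z.1)) ∂(P.prod q)

/-- `E[∫_0^T ⟨∇Pi(t, e^{tA}(y + η t)), e^{tA} ν t⟩ q(dt)]`, the derivative of the gain at the control
`η` in the direction `ν`. -/
def marginalGain (P : Measure Ω) (q : Measure (horizon T)) (S : ℝ → X →L[ℝ] X) (y : X)
    (Pi : Ω → horizon T → X → ℝ) (η ν : horizon T → Ω → X) : ℝ≥0∞ :=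
  ∫⁻ z, ENNReal.ofReal (gradient S y Pi z.1 z.2 (hatState S y η z.2 z.1)
    (S ((z.2 : ℝ≥0) : ℝ) (ν z.2 z.1))) ∂(P.prod q)

/-- `E[∫_0^T ⟨Φ t, dν t⟩]`. -/
def expectedCost (P : Measure Ω) (Φ : horizon T → Ω → X →L[ℝ] ℝ) (ν : horizon T → Ω → X) : ℝ≥0∞ :=
  ∫⁻ ω, pairingIntegral (fun t => Φ t ω) (fun t => ν t ω) ∂P

lemma IsProgressiveDensity.stronglyMeasurable {P : Measure Ω} {ν ρ : horizon T → Ω → X}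
    (h : IsProgressiveDensity F P ν ρ) : StronglyMeasurable fun z : horizon T × Ω => ρ z.1 z.2 :=
  stronglyMeasurable_of_isStronglyProgressive h.progressive

lemma IsRepresentation.hasDensity {n ρ : horizon T → X}
    (h : IsRepresentation n (variationMeasure n) ρ) : HasDensity n :=
  ⟨h.finite, ρ, h.isDensity⟩

variable [IsOrderedAddMonoid X] {S : ℝ → X →L[ℝ] X} {y : X}

lemma hatState_mem_feasible (hS_pos : ∀ t v, 0 ≤ v → 0 ≤ S t v) (hy : 0 ≤ y)
    {ν : horizon T → Ω → X} {t : horizon T} {ω : Ω} (hν : 0 ≤ ν t ω) :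
    hatState S y ν t ω ∈ feasible S y t := by
  refine ⟨hS_pos _ _ (add_nonneg hy hν), ?_⟩
  rw [hatState, map_add]
  exact le_add_of_nonneg_right (hS_pos _ _ hν)

variable [CompleteSpace X]

omit [IsOrderedAddMonoid X] in
lemma stronglyMeasurable_hatState (hS : IsC0Group S) {ν : horizon T → Ω → X}
    (hν : IsRegularControl F ν) :
    StronglyMeasurable fun z : horizon T × Ω => hatState S y ν z.1 z.2 :=
  hS.stronglyMeasurable_apply (IsC0Group.measurable_coe_horizon.comp measurable_fst)
    (stronglyMeasurable_const.add hν.stronglyMeasurable)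

omit [IsOrderedAddMonoid X] in
lemma measurable_hatCost_apply (hS : IsC0Group S) {Φ : horizon T → Ω → X →L[ℝ] ℝ}
    (hΦ : IsRegularCost F Φ) (ω : Ω) (v : horizon T → X) (hv : StronglyMeasurable v) :
    Measurable fun s => hatCost S Φ s ω (v s) :=
  (stronglyMeasurable_clm_apply (hΦ.stronglyMeasurable_path ω)
    (hS.stronglyMeasurable_apply IsC0Group.measurable_coe_horizon hv)).measurable

omit [IsOrderedAddMonoid X] in
lemma ae_pairingIntegral_hatCost_eq [IsOrderedModule ℝ X] (hS : IsC0Group S)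
    {Φ : horizon T → Ω → X →L[ℝ] ℝ} (hΦ : IsRegularCost F Φ) {P : Measure Ω}
    {ν ρ : horizon T → Ω → X} (hρ : IsProgressiveDensity F P ν ρ) :
    ∀ᵐ ω ∂P, pairingIntegral (fun t => hatCost S Φ t ω) (fun t => ν t ω) =
      ∫⁻ s, ENNReal.ofReal (Φ s ω (S ((s : ℝ≥0) : ℝ) (ρ s ω)))
        ∂(variationMeasure fun t => ν t ω) := by
  filter_upwards [hρ.ae_isRepresentation] with ω hω
  exact pairingIntegral_eq hω.hasDensity hω (measurable_hatCost_apply hS hΦ ω)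

omit [IsOrderedAddMonoid X] in
lemma measurable_ofReal_cost (hS : IsC0Group S) {Φ : horizon T → Ω → X →L[ℝ] ℝ}
    (hΦ : IsRegularCost F Φ) {P : Measure Ω} {ν ρ : horizon T → Ω → X}
    (hρ : IsProgressiveDensity F P ν ρ) :
    Measurable fun z : horizon T × Ω =>
      ENNReal.ofReal (Φ z.1 z.2 (S ((z.1 : ℝ≥0) : ℝ) (ρ z.1 z.2))) :=
  (stronglyMeasurable_clm_apply hΦ.stronglyMeasurable
    (hS.stronglyMeasurable_apply (IsC0Group.measurable_coe_horizon.comp measurable_fst)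
      hρ.stronglyMeasurable)).measurable.ennreal_ofReal

omit [IsOrderedAddMonoid X] in
lemma aemeasurable_pairingIntegral_hatCost [IsOrderedModule ℝ X] (hS : IsC0Group S)
    {Φ : horizon T → Ω → X →L[ℝ] ℝ} (hΦ : IsRegularCost F Φ) {P : Measure Ω}
    {ν ρ : horizon T → Ω → X} (hν : IsRegularControl F ν) (hρ : IsProgressiveDensity F P ν ρ) :
    AEMeasurable (fun ω => pairingIntegral (fun t => hatCost S Φ t ω) (fun t => ν t ω)) P :=
  ⟨_, hν.isAdaptedMeasure.measurable_lintegral (measurable_ofReal_cost hS hΦ hρ),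
    ae_pairingIntegral_hatCost_eq hS hΦ hρ⟩

variable {Pi : Ω → horizon T → X → ℝ}

lemma IsRunningProfit.measurable_hatState (hS : IsC0Group S)
    (hS_pos : ∀ t v, 0 ≤ v → 0 ≤ S t v) (hy : 0 ≤ y) (hPi : IsRunningProfit F S y Pi)
    {ν : horizon T → Ω → X} (hν : IsRegularControl F ν) :
    Measurable fun z : Ω × horizon T => Pi z.1 z.2 (hatState S y ν z.2 z.1) :=
  hPi.measurable_comp measurable_fst measurable_snd
    ((stronglyMeasurable_hatState hS hν).comp_measurable measurable_swap) fun z =>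
      (hatState_mem_feasible hS_pos hy ((hν.path z.1).nonneg z.2)).1

variable [IsOrderedModule ℝ X]

lemma measurable_marginal (hS : IsC0Group S) (hS_pos : ∀ t v, 0 ≤ v → 0 ≤ S t v) (hy : 0 ≤ y)
    (hPi : IsRunningProfit F S y Pi) {η ν : horizon T → Ω → X} (hη : IsRegularControl F η)
    (hν : IsRegularControl F ν) :
    Measurable fun z : Ω × horizon T => gradient S y Pi z.1 z.2 (hatState S y η z.2 z.1)
      (S ((z.2 : ℝ≥0) : ℝ) (ν z.2 z.1)) :=
  hPi.measurable_gradient measurable_fst measurable_snd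
    ((stronglyMeasurable_hatState hS hη).comp_measurable measurable_swap)
    (hS.stronglyMeasurable_apply (IsC0Group.measurable_coe_horizon.comp measurable_snd)
      (hν.stronglyMeasurable.comp_measurable measurable_swap))
    (fun z => hatState_mem_feasible hS_pos hy ((hη.path z.1).nonneg z.2))
    (fun z => hS_pos _ _ ((hν.path z.1).nonneg z.2))

variable {P : Measure Ω} [SFinite P]
  {q : Measure (horizon T)} [IsFiniteMeasure q]

omit [SFinite P] in
/-- The performance of a control is its gain minus its cost. -/
lemma hatPerformance_eq (hS : IsC0Group S) (hS_pos : ∀ t v, 0 ≤ v → 0 ≤ S t v) (hy : 0 ≤ y)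
    (hPi : IsRunningProfit F S y Pi) {Φ : horizon T → Ω → X →L[ℝ] ℝ} (hΦ : IsRegularCost F Φ)
    {ν ρ : horizon T → Ω → X} (hν : IsRegularControl F ν) (hρ : IsProgressiveDensity F P ν ρ)
    (hfin : expectedCost P (hatCost S Φ) ν ≠ ∞) :
    hatPerformance P q S y Pi Φ ν =
      (runningGain P q S y Pi ν : EReal) - (expectedCost P (hatCost S Φ) ν : EReal) := by
  have hm := (hPi.measurable_hatState hS hS_pos hy hν).ennreal_ofReal
  rw [runningGain, lintegral_prod _ hm.aemeasurable]
  exact extIntegral_coe_sub hm.lintegral_prod_right'.aemeasurable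
    (aemeasurable_pairingIntegral_hatCost hS hΦ hν hρ) hfin

/-- The conditional expectation in the first order condition may be dropped: the density of the
control is progressive, so the marginal profit may be replaced by its optional projection. -/
lemma lintegral_condExpProcess_eq (hS : IsC0Group S) (hS_pos : ∀ t v, 0 ≤ v → 0 ≤ S t v)
    (hy : 0 ≤ y) (hPi : IsRunningProfit F S y Pi) {η : horizon T → Ω → X}
    (hη : IsRegularControl F η) {g : horizon T → Ω → X → ℝ≥0∞}
    (hg : IsCondExpProcess F P (marginalProfit q S y Pi η) g)
    {m : Ω → Measure (horizon T)} (hm : IsAdaptedMeasure F m) {V : horizon T → Ω → X}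
    (hV : IsStronglyProgressive F V) (hV0 : ∀ s ω, 0 ≤ V s ω) :
    ∫⁻ ω, ∫⁻ s, g s ω (V s ω) ∂(m ω) ∂P =
      ∫⁻ ω, ∫⁻ t, ∫⁻ s in Iic t, ENNReal.ofReal (gradient S y Pi ω t (hatState S y η t ω)
        (S (((t : ℝ≥0) : ℝ) - ((s : ℝ≥0) : ℝ)) (V s ω))) ∂(m ω) ∂q ∂P := by
  let h : horizon T → Ω → horizon T → ℝ≥0∞ := fun s ω t =>
    ENNReal.ofReal (gradient S y Pi ω t (hatState S y η t ω)
      (S (((t : ℝ≥0) : ℝ) - ((s : ℝ≥0) : ℝ)) (V s ω)))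
  have hVm := stronglyMeasurable_of_isStronglyProgressive hV
  have hh : Measurable fun z : (horizon T × Ω) × horizon T => h z.1.1 z.1.2 z.2 :=
    (hPi.measurable_gradient (α := (horizon T × Ω) × horizon T) (ω := fun z => z.1.2)
      (t := fun z => z.2) (Z := fun z => hatState S y η z.2 z.1.2)
      (w := fun z => S (((z.2 : ℝ≥0) : ℝ) - ((z.1.1 : ℝ≥0) : ℝ)) (V z.1.1 z.1.2))
      (measurable_snd.comp measurable_fst) measurable_snd
      ((stronglyMeasurable_hatState hS hη).comp_measurable
        (measurable_snd.prodMk (measurable_snd.comp measurable_fst)))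
      (hS.stronglyMeasurable_apply
        ((IsC0Group.measurable_coe_horizon.comp measurable_snd).sub
          (IsC0Group.measurable_coe_horizon.comp (measurable_fst.comp measurable_fst)))
        (hVm.comp_measurable measurable_fst))
      (fun z => hatState_mem_feasible hS_pos hy ((hη.path _).nonneg _))
      (fun z => hS_pos _ _ (hV0 _ _))).ennreal_ofReal
  have hind : Measurable fun z : (horizon T × Ω) × horizon T =>
      {z : (horizon T × Ω) × horizon T | z.1.1 ≤ z.2}.indicator
        (fun z => h z.1.1 z.1.2 z.2) z :=
    hh.indicator (measurableSet_le (measurable_fst.comp measurable_fst) measurable_snd)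
  have hG : ∀ s ω, marginalProfit q S y Pi η s ω (V s ω) =
      ∫⁻ t, {z : (horizon T × Ω) × horizon T | z.1.1 ≤ z.2}.indicator
        (fun z => h z.1.1 z.1.2 z.2) ((s, ω), t) ∂q := by
    intro s ω
    rw [marginalProfit, ← lintegral_indicator measurableSet_Ici]
    rfl
  have hGm : Measurable fun z : horizon T × Ω => marginalProfit q S y Pi η z.1 z.2 (V z.1 z.2) := by
    simp only [hG]
    exact hind.lintegral_prod_right'
  have hgm : Measurable fun z : horizon T × Ω => g z.1 z.2 (V z.1 z.2) :=
    (stronglyMeasurable_of_isStronglyProgressive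
      (hg.progressive V hV hV0).isStronglyProgressive).measurable
  rw [hm.lintegral_lintegral_congr P (f := fun s ω => g s ω (V s ω))
    (f' := fun s ω => marginalProfit q S y Pi η s ω (V s ω)) hgm hGm
    fun τ hτ => hg.stopping V hV hV0 τ hτ]
  refine lintegral_congr fun ω => ?_
  have := sigmaFinite_of_Iic (hm.finite ω)
  simp only [hG]
  rw [lintegral_lintegral_swap]
  · refine lintegral_congr fun t => ?_
    rw [← lintegral_indicator measurableSet_Iic]
    rfl
  · exact (hind.comp ((measurable_fst.prodMk measurable_const).prodMk
      measurable_snd)).aemeasurable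

/-- The value in the first order condition is the marginal gain minus the cost. -/
lemma focValue_eq [OrderClosedTopology X] (hS : IsC0Group S)
    (hS_pos : ∀ t v, 0 ≤ v → 0 ≤ S t v) (hy : 0 ≤ y)
    (hPi : IsRunningProfit F S y Pi) {Φ : horizon T → Ω → X →L[ℝ] ℝ} (hΦ : IsRegularCost F Φ)
    {η ν ρ : horizon T → Ω → X} (hη : IsRegularControl F η) {g : horizon T → Ω → X → ℝ≥0∞}
    (hg : IsCondExpProcess F P (marginalProfit q S y Pi η) g)
    (hν : IsRegularControl F ν) (hρ : IsProgressiveDensity F P ν ρ)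
    (hfin : expectedCost P (hatCost S Φ) ν ≠ ∞) :
    focValue P S Φ g ν =
      (marginalGain P q S y Pi η ν : EReal) - (expectedCost P (hatCost S Φ) ν : EReal) := by
  have hm := hν.isAdaptedMeasure
  set m : Ω → Measure (horizon T) := fun ω => variationMeasure fun t => ν t ω with hm_def
  let V : horizon T → Ω → X := fun s ω => S ((s : ℝ≥0) : ℝ) (ρ s ω)
  have hV : IsStronglyProgressive F V := hS.isStronglyProgressive_apply hρ.progressive
  have hV0 : ∀ s ω, 0 ≤ V s ω := fun s ω => hS_pos _ _ (hρ.nonneg s ω)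
  have hgm : Measurable fun z : horizon T × Ω => g z.1 z.2 (V z.1 z.2) :=
    (stronglyMeasurable_of_isStronglyProgressive
      (hg.progressive V hV hV0).isStronglyProgressive).measurable
  have hcost := measurable_ofReal_cost hS hΦ hρ
  have hpair := aemeasurable_pairingIntegral_hatCost hS hΦ hν hρ
  have hinner : (fun ω => extIntegral (m ω) fun s =>
      ((g s ω (S ((s : ℝ≥0) : ℝ) (density (fun t => ν t ω) s)) : ℝ≥0∞) : EReal) -
        ((hatCost S Φ s ω (density (fun t => ν t ω) s) : ℝ) : EReal)) =ᵐ[P] fun ω =>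
      ((∫⁻ s, g s ω (V s ω) ∂(m ω) : ℝ≥0∞) : EReal) -
        ((pairingIntegral (fun t => hatCost S Φ t ω) (fun t => ν t ω) : ℝ≥0∞) : EReal) := by
    filter_upwards [hρ.ae_isRepresentation, ae_pairingIntegral_hatCost_eq hS hΦ hρ,
      ae_lt_top' hpair hfin] with ω hω hpω hlt
    rw [hpω] at hlt ⊢
    have hd := hω.hasDensity.isRepresentation.ae_eq hω
    have e : (fun s => ((g s ω (S ((s : ℝ≥0) : ℝ) (density (fun t => ν t ω) s)) : ℝ≥0∞) : EReal) -
        ((hatCost S Φ s ω (density (fun t => ν t ω) s) : ℝ) : EReal)) =ᵐ[m ω] fun s =>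
        ((g s ω (V s ω) : ℝ≥0∞) : EReal) - ((ENNReal.ofReal (Φ s ω (V s ω)) : ℝ≥0∞) : EReal) := by
      filter_upwards [hd] with s hs
      rw [hs, EReal.coe_ennreal_ofReal, max_eq_left (hΦ.nonneg s ω _ (hV0 s ω))]
      rfl
    rw [extIntegral_congr_ae e]
    exact extIntegral_coe_sub (hgm.comp measurable_prodMk_right).aemeasurable
      (hcost.comp measurable_prodMk_right).aemeasurable hlt.ne
  rw [focValue, extIntegral_congr_ae hinner, extIntegral_coe_sub
    (hm.measurable_lintegral hgm).aemeasurable hpair hfin]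
  congr 2
  rw [lintegral_condExpProcess_eq hS hS_pos hy hPi hη hg hm hV hV0, marginalGain, lintegral_prod]
  · refine lintegral_congr_ae ?_
    filter_upwards [hρ.ae_isRepresentation] with ω hω
    refine lintegral_congr fun t => ?_
    set L : X →L[ℝ] ℝ := (gradient S y Pi ω t (hatState S y η t ω)).comp (S ((t : ℝ≥0) : ℝ)) with hL
    have hL0 : ∀ v, 0 ≤ v → 0 ≤ L v := fun v hv =>
      hPi.gradient_nonneg (hatState_mem_feasible hS_pos hy ((hη.path ω).nonneg t)) (hS_pos _ _ hv)
    have e1 : ∀ s : horizon T, gradient S y Pi ω t (hatState S y η t ω)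
        (S (((t : ℝ≥0) : ℝ) - ((s : ℝ≥0) : ℝ)) (V s ω)) = L (ρ s ω) := by
      intro s
      rw [hS.apply_apply, sub_add_cancel]
      rfl
    have e2 : gradient S y Pi ω t (hatState S y η t ω) (S ((t : ℝ≥0) : ℝ) (ν t ω)) = L (ν t ω) := rfl
    simp only [e1, e2]
    rw [hω.eq_integral t, ← L.integral_comp_comm (hω.integrableOn t),
      ofReal_integral_eq_lintegral_ofReal (L.integrable_comp (hω.integrableOn t))
        (Eventually.of_forall fun s => hL0 _ (hρ.nonneg s ω))]
  · exact (measurable_marginal hS hS_pos hy hPi hη hν).ennreal_ofReal.aemeasurable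

end Functionals

/-! ### The control of the original problem -/

section Dominated

variable {X : Type*} [NormedAddCommGroup X] {T : ℝ≥0∞} {n : horizon T → X}
  {m : Measure (horizon T)}

namespace IsDominated

lemma eVariationOn_ne_top (h : IsDominated n m) (t : horizon T) : eVariationOn n (Iic t) ≠ ∞ := by
  have hmono : MonotoneOn (fun s => (m (Iic s)).toReal) (Iic t) := fun a _ b _ hab =>
    ENNReal.toReal_mono (h.finite b).ne (measure_mono (Iic_subset_Iic.2 hab))
  have hle : eVariationOn n (Iic t) ≤ eVariationOn (fun s => (m (Iic s)).toReal) (Iic t) := by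
    refine iSup_le fun p => (Finset.sum_le_sum fun i _ => ?_).trans
      (eVariationOn.sum_le (n := p.1) p.2.2.1 fun i => p.2.2.2 i)
    have hi : (p.2 : ℕ → horizon T) i ≤ (p.2 : ℕ → horizon T) (i + 1) := p.2.2.1 (Nat.le_succ i)
    rw [edist_eq_enorm_sub]
    refine (h.sub_le _ _ hi).trans_eq ?_
    rw [← Iic_sdiff_Iic, measure_sdiff (Iic_subset_Iic.2 hi) measurableSet_Iic.nullMeasurableSet
      (h.finite _).ne, edist_dist, Real.dist_eq, abs_of_nonneg (sub_nonneg.2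
        (ENNReal.toReal_mono (h.finite _).ne (measure_mono (Iic_subset_Iic.2 hi)))),
      ENNReal.ofReal_sub _ ENNReal.toReal_nonneg, ENNReal.ofReal_toReal (h.finite _).ne,
      ENNReal.ofReal_toReal (h.finite _).ne]
  have h1 := hmono.eVariationOn_eq (a := ⊥) (b := t) (mem_Iic.2 _root_.bot_le) (mem_Iic.2 le_rfl)
  rw [Icc_bot, inter_self] at h1
  exact ne_top_of_le_ne_top ENNReal.ofReal_ne_top (hle.trans_eq h1)

lemma continuousWithinAt (h : IsDominated n m) (t : horizon T) :
    ContinuousWithinAt n (Ici t) t := by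
  rw [ContinuousWithinAt, tendsto_iff_edist_tendsto_0, ENNReal.tendsto_nhds_zero]
  intro ε hε
  have hlim := tendsto_measure_Iic_add m h.finite t
  obtain ⟨N, hN⟩ := (hlim.eventually_lt_const
    (ENNReal.lt_add_right (h.finite t).ne hε.ne')).exists
  have hnhds : (fun s : horizon T => (s : ℝ≥0)) ⁻¹' Iio ((t : ℝ≥0) + 1 / 2 ^ N) ∈ 𝓝 t :=
    continuous_subtype_val.continuousAt.preimage_mem_nhds
      (Iio_mem_nhds (lt_add_of_pos_right _ (by positivity)))
  filter_upwards [self_mem_nhdsWithin, mem_nhdsWithin_of_mem_nhds hnhds] with s hs hs'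
  have hs'' : s ≤ clamp T ((t : ℝ≥0) + 1 / 2 ^ N) := le_clamp_iff.2 (le_of_lt hs')
  rw [edist_eq_enorm_sub]
  refine (h.sub_le _ _ (mem_Ici.1 hs)).trans ?_
  rw [← Iic_sdiff_Iic, measure_sdiff (Iic_subset_Iic.2 (mem_Ici.1 hs))
    measurableSet_Iic.nullMeasurableSet (h.finite _).ne, tsub_le_iff_left]
  exact (measure_mono (Iic_subset_Iic.2 hs'')).trans hN.le

end IsDominated

variable [NormedSpace ℝ X]

lemma setIntegral_Iic_sub {V : horizon T → X} (hV : ∀ t, IntegrableOn V (Iic t) m) {a b : horizon T}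
    (hab : a ≤ b) :
    ∫ s in Iic b, V s ∂m - ∫ s in Iic a, V s ∂m = ∫ s in Ioc a b, V s ∂m := by
  rw [← Iic_sdiff_Iic, setIntegral_sdiff measurableSet_Iic (hV b) (Iic_subset_Iic.2 hab)]

lemma isDominated_setIntegral {V : horizon T → X} (hV : ∀ t, IntegrableOn V (Iic t) m) :
    IsDominated (fun t => ∫ s in Iic t, V s ∂m) (m.withDensity fun s => ‖V s‖ₑ) where
  finite t := by
    rw [withDensity_apply _ measurableSet_Iic]
    exact (hV t).2
  bot_le := by
    rw [withDensity_apply _ (measurableSet_singleton _), Iic_bot]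
    exact enorm_integral_le_lintegral_enorm _
  sub_le a b hab := by
    rw [withDensity_apply _ measurableSet_Ioc, setIntegral_Iic_sub hV hab]
    exact enorm_integral_le_lintegral_enorm _

lemma isControlPath_setIntegral [PartialOrder X] [IsOrderedAddMonoid X] [IsOrderedModule ℝ X]
    [OrderClosedTopology X] {V : horizon T → X} (hV : ∀ t, IntegrableOn V (Iic t) m)
    (hV0 : ∀ s, 0 ≤ V s) : IsControlPath fun t => ∫ s in Iic t, V s ∂m where
  nonneg t := integral_nonneg hV0
  monotone a b hab := by
    rw [← sub_nonneg, setIntegral_Iic_sub hV hab]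
    exact integral_nonneg hV0
  rightContinuous := (isDominated_setIntegral hV).continuousWithinAt
  finiteVariation := (isDominated_setIntegral hV).eVariationOn_ne_top

end Dominated

section Original

variable {X : Type*} [NormedAddCommGroup X] [NormedSpace ℝ X] [PartialOrder X] [CompleteSpace X]
  [IsOrderedAddMonoid X] [IsOrderedModule ℝ X] [OrderClosedTopology X]
  {Ω : Type*} {mΩ : MeasurableSpace Ω} {T : ℝ≥0∞} {F : Filtration (horizon T) mΩ}
  {S : ℝ → X →L[ℝ] X} {y : X} {Pi : Ω → horizon T → X → ℝ} {P : Measure Ω}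
  {q : Measure (horizon T)} [IsFiniteMeasure q]

/-- Every control of the reformulated problem with finite cost has a finite gain: it corresponds to
the control `t ↦ ∫_[0,t] e^{sA} dν s` of the original problem, with the same cost and state. -/
lemma runningGain_ne_top (hF : UsualConditions F P)
    (hdens : ∀ ν : horizon T → Ω → X, IsRegularControl F ν → ∃ ρ, IsProgressiveDensity F P ν ρ)
    (hS : IsC0Group S) (hS_pos : ∀ t v, 0 ≤ v → 0 ≤ S t v) (hy : 0 ≤ y)
    (hPi : IsRunningProfit F S y Pi) {Φ : horizon T → Ω → X →L[ℝ] ℝ} (hΦ : IsRegularCost F Φ)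
    (hfinite : ∀ ν, IsAdmissible F P Φ ν → performance P q S y Pi Φ ν < ⊤)
    {ν : horizon T → Ω → X} (hν : IsRegularControl F ν)
    (hfin : expectedCost P (hatCost S Φ) ν ≠ ∞) : runningGain P q S y Pi ν ≠ ∞ := by
  obtain ⟨ρ, hρ⟩ := hdens ν hν
  have hm := hν.isAdaptedMeasure
  set m : Ω → Measure (horizon T) := fun ω => variationMeasure fun t => ν t ω with hm_def
  let V : horizon T → Ω → X := fun s ω => S ((s : ℝ≥0) : ℝ) (ρ s ω)
  have hV : IsStronglyProgressive F V := hS.isStronglyProgressive_apply hρ.progressive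
  have hV0 : ∀ s ω, 0 ≤ V s ω := fun s ω => hS_pos _ _ (hρ.nonneg s ω)
  let η : horizon T → Ω → X := fun t ω => ∫ s in Iic t, V s ω ∂(m ω)
  have hVrep : ∀ᵐ ω ∂P, IsRepresentation (fun t => η t ω) (m ω) fun s => V s ω := by
    filter_upwards [hρ.ae_isRepresentation] with ω hω
    exact ⟨hω.finite, hS.stronglyMeasurable_apply IsC0Group.measurable_coe_horizon
      hω.stronglyMeasurable, fun s => hV0 s ω,
      fun t => hS.integrableOn_apply hω.stronglyMeasurable (hω.integrableOn t), fun t => rfl⟩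
  have hpath : ∀ᵐ ω ∂P, IsControlPath fun t => η t ω := by
    filter_upwards [hVrep] with ω hω
    exact isControlPath_setIntegral hω.integrableOn hω.nonneg
  have hη : IsControl F P η :=
    ⟨hm.stronglyAdapted_setIntegral hV, hpath.mono fun ω h => h.nonneg,
      hpath.mono fun ω h => h.monotone, hpath.mono fun ω h => h.rightContinuous,
      hpath.mono fun ω h => h.finiteVariation⟩
  obtain ⟨η', hη', hηη'⟩ := hη.exists_regular hF
  obtain ⟨ρ', hρ'⟩ := hdens η' hη'
  have hηd : ∀ᵐ ω ∂P, HasDensity fun t => η t ω := by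
    filter_upwards [hρ'.ae_isRepresentation, hηη'] with ω hω he
    rw [← funext he]
    exact hω.hasDensity
  have hpair : ∀ᵐ ω ∂P, pairingIntegral (fun t => Φ t ω) (fun t => η t ω) =
      pairingIntegral (fun t => hatCost S Φ t ω) (fun t => ν t ω) := by
    filter_upwards [hVrep, hηd, ae_pairingIntegral_hatCost_eq hS hΦ hρ] with ω hω hd hp
    rw [hp]
    exact pairingIntegral_eq hd hω fun v hv =>
      (stronglyMeasurable_clm_apply (hΦ.stronglyMeasurable_path ω) hv).measurable
  have hstate : ∀ᵐ ω ∂P, ∀ t, mildSolution S y (fun s => η s ω) t = hatState S y ν t ω := by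
    filter_upwards [hVrep, hηd, hρ.ae_isRepresentation] with ω hω hd hr t
    have h1 := hd.isRepresentation.setIntegral_apply_eq hω
      (fun s => S (((t : ℝ≥0) : ℝ) - ((s : ℝ≥0) : ℝ))) t
    have h2 : ∀ s : horizon T, S (((t : ℝ≥0) : ℝ) - ((s : ℝ≥0) : ℝ)) (V s ω) =
        S ((t : ℝ≥0) : ℝ) (ρ s ω) := fun s => by
      rw [hS.apply_apply, sub_add_cancel]
    simp only [h2] at h1
    rw [mildSolution, h1, (S ((t : ℝ≥0) : ℝ)).integral_comp_comm (hr.integrableOn t),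
      ← hr.eq_integral t, hatState, map_add]
  have hadm : IsAdmissible F P Φ η :=
    ⟨hη, by rw [lintegral_congr_ae hpair]; exact hfin.lt_top⟩
  have hperf : performance P q S y Pi Φ η = hatPerformance P q S y Pi Φ ν := by
    refine extIntegral_congr_ae ?_
    filter_upwards [hpair, hstate] with ω h1 h2
    simp only [h1, h2]
  have h := hfinite η hadm
  rw [hperf, hatPerformance_eq hS hS_pos hy hPi hΦ hν hρ hfin] at h
  intro htop
  rw [htop] at h
  lift expectedCost P (hatCost S Φ) ν to ℝ≥0 using hfin with c
  simp at h

end Original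

/-! ### The cone of controls -/

section Cone

variable {X : Type*} [NormedAddCommGroup X] {T : ℝ≥0∞} {n n' : horizon T → X}
  {m m' : Measure (horizon T)}

lemma IsDominated.add (h : IsDominated n m) (h' : IsDominated n' m') :
    IsDominated (fun t => n t + n' t) (m + m') where
  finite t := ENNReal.add_lt_top.2 ⟨h.finite t, h'.finite t⟩
  bot_le := (enorm_add_le _ _).trans (add_le_add h.bot_le h'.bot_le)
  sub_le a b hab := by
    rw [add_sub_add_comm]
    exact (enorm_add_le _ _).trans (add_le_add (h.sub_le a b hab) (h'.sub_le a b hab))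

variable [NormedSpace ℝ X]

lemma IsDominated.smul (h : IsDominated n m) (c : ℝ) :
    IsDominated (fun t => c • n t) (‖c‖ₑ • m) where
  finite t := ENNReal.mul_lt_top enorm_lt_top (h.finite t)
  bot_le := by
    rw [enorm_smul]
    exact mul_le_mul_right h.bot_le _
  sub_le a b hab := by
    rw [← smul_sub, enorm_smul]
    exact mul_le_mul_right (h.sub_le a b hab) _

variable [PartialOrder X] [IsOrderedAddMonoid X]
  {Ω : Type*} {mΩ : MeasurableSpace Ω} {F : Filtration (horizon T) mΩ}
  {ν ν' : horizon T → Ω → X}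

omit [NormedSpace ℝ X] in
lemma IsRegularControl.add (h : IsRegularControl F ν) (h' : IsRegularControl F ν') :
    IsRegularControl F fun t ω => ν t ω + ν' t ω where
  adapted t := (h.adapted t).add (h'.adapted t)
  path ω := by
    have hd := (h.isDominated ω).add (h'.isDominated ω)
    exact ⟨fun t => add_nonneg ((h.path ω).nonneg t) ((h'.path ω).nonneg t),
      fun a b hab => add_le_add ((h.path ω).monotone hab) ((h'.path ω).monotone hab),
      hd.continuousWithinAt, hd.eVariationOn_ne_top⟩

omit [IsOrderedAddMonoid X] in
lemma IsRegularControl.smul [IsOrderedModule ℝ X] (h : IsRegularControl F ν) {c : ℝ}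
    (hc : 0 ≤ c) : IsRegularControl F fun t ω => c • ν t ω where
  adapted t := (h.adapted t).const_smul c
  path ω := by
    have hd := (h.isDominated ω).smul c
    exact ⟨fun t => smul_nonneg hc ((h.path ω).nonneg t),
      fun a b hab => smul_le_smul_of_nonneg_left ((h.path ω).monotone hab) hc,
      hd.continuousWithinAt, hd.eVariationOn_ne_top⟩

end Cone

/-! ### The first order condition -/

section FirstOrder

variable {X : Type*} [NormedAddCommGroup X] [NormedSpace ℝ X] [PartialOrder X] [CompleteSpace X]
  [IsOrderedAddMonoid X] [IsOrderedModule ℝ X]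
  {Ω : Type*} {mΩ : MeasurableSpace Ω} {T : ℝ≥0∞} {F : Filtration (horizon T) mΩ}
  {S : ℝ → X →L[ℝ] X} {y : X} {Pi : Ω → horizon T → X → ℝ} {P : Measure Ω}
  {Φ : horizon T → Ω → X →L[ℝ] ℝ}

lemma expectedCost_add (hS : IsC0Group S) (hS_pos : ∀ t v, 0 ≤ v → 0 ≤ S t v)
    (hΦ : IsRegularCost F Φ)
    (hdens : ∀ ν : horizon T → Ω → X, IsRegularControl F ν → ∃ ρ, IsProgressiveDensity F P ν ρ)
    {ν ν' : horizon T → Ω → X} (hν : IsRegularControl F ν) (hν' : IsRegularControl F ν') :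
    expectedCost P (hatCost S Φ) (fun t ω => ν t ω + ν' t ω) =
      expectedCost P (hatCost S Φ) ν + expectedCost P (hatCost S Φ) ν' := by
  obtain ⟨ρ, hρ⟩ := hdens ν hν
  obtain ⟨ρ', hρ'⟩ := hdens ν' hν'
  obtain ⟨ρ'', hρ''⟩ := hdens _ (hν.add hν')
  unfold expectedCost
  rw [← lintegral_add_left' (aemeasurable_pairingIntegral_hatCost hS hΦ hν hρ)]
  refine lintegral_congr_ae ?_
  filter_upwards [hρ.ae_isRepresentation, hρ'.ae_isRepresentation, hρ''.ae_isRepresentation]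
    with ω h h' h''
  exact pairingIntegral_add h.hasDensity h'.hasDensity h''.hasDensity
    (measurable_hatCost_apply hS hΦ ω) fun s v hv => hΦ.nonneg s ω _ (hS_pos _ _ hv)

omit [IsOrderedAddMonoid X] in
lemma expectedCost_smul (hS : IsC0Group S) (hΦ : IsRegularCost F Φ)
    (hdens : ∀ ν : horizon T → Ω → X, IsRegularControl F ν → ∃ ρ, IsProgressiveDensity F P ν ρ)
    {ν : horizon T → Ω → X} (hν : IsRegularControl F ν) {c : ℝ} (hc : 0 ≤ c) :
    expectedCost P (hatCost S Φ) (fun t ω => c • ν t ω) =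
      ENNReal.ofReal c * expectedCost P (hatCost S Φ) ν := by
  obtain ⟨ρ, hρ⟩ := hdens ν hν
  obtain ⟨ρ', hρ'⟩ := hdens _ (hν.smul hc)
  unfold expectedCost
  rw [← lintegral_const_mul' _ _ ENNReal.ofReal_ne_top]
  refine lintegral_congr_ae ?_
  filter_upwards [hρ.ae_isRepresentation, hρ'.ae_isRepresentation] with ω h h'
  exact pairingIntegral_smul h.hasDensity hc h'.hasDensity (measurable_hatCost_apply hS hΦ ω)

variable {q : Measure (horizon T)} {η ν : horizon T → Ω → X}

/-- The gain is concave, so that it lies below its linearization at `η`. -/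
lemma runningGain_add_marginalGain_le (hS : IsC0Group S) (hS_pos : ∀ t v, 0 ≤ v → 0 ≤ S t v)
    (hy : 0 ≤ y) (hPi : IsRunningProfit F S y Pi) (hη : IsRegularControl F η)
    (hν : IsRegularControl F ν) :
    runningGain P q S y Pi ν + marginalGain P q S y Pi η η ≤
      runningGain P q S y Pi η + marginalGain P q S y Pi η ν := by
  unfold runningGain marginalGain
  rw [← lintegral_add_left (hPi.measurable_hatState hS hS_pos hy hν).ennreal_ofReal,
    ← lintegral_add_left (hPi.measurable_hatState hS hS_pos hy hη).ennreal_ofReal]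
  refine lintegral_mono fun z => ?_
  have hη0 := (hη.path z.1).nonneg z.2
  have hν0 := (hν.path z.1).nonneg z.2
  have hfη := hatState_mem_feasible (y := y) hS_pos hy hη0
  have hfν := hatState_mem_feasible (y := y) hS_pos hy hν0
  have e : hatState S y ν z.2 z.1 - hatState S y η z.2 z.1 =
      S ((z.2 : ℝ≥0) : ℝ) (ν z.2 z.1) - S ((z.2 : ℝ≥0) : ℝ) (η z.2 z.1) := by
    simp only [hatState, map_add]
    abel
  have h := hPi.le_add_gradient (ω := z.1) hfη hfν
  rw [e, map_sub] at h
  rw [← ENNReal.ofReal_add (hPi.nonneg _ _ _ hfν.1) (hPi.gradient_nonneg hfη (hS_pos _ _ hη0)),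
    ← ENNReal.ofReal_add (hPi.nonneg _ _ _ hfη.1) (hPi.gradient_nonneg hfη (hS_pos _ _ hν0))]
  exact ENNReal.ofReal_le_ofReal (by linarith)

omit [IsOrderedAddMonoid X] [CompleteSpace X] [IsOrderedModule ℝ X] [PartialOrder X] in
lemma hatState_add_smul (c : ℝ) (t : horizon T) (ω : Ω) :
    hatState S y (fun t ω => η t ω + c • ν t ω) t ω =
      hatState S y η t ω + c • S ((t : ℝ≥0) : ℝ) (ν t ω) := by
  simp only [hatState, map_add, map_smul]
  abel

/-- If the gain grows by at most `c * b` when `η` is replaced by `η + c • ν`, for all `c > 0`, then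
the marginal gain is at most `b` by Fatou's lemma. -/
lemma marginalGain_le_of_forall (hS : IsC0Group S) (hS_pos : ∀ t v, 0 ≤ v → 0 ≤ S t v)
    (hy : 0 ≤ y) (hPi : IsRunningProfit F S y Pi) (hη : IsRegularControl F η)
    (hν : IsRegularControl F ν) (hA : runningGain P q S y Pi η ≠ ∞) {b : ℝ≥0∞}
    (h : ∀ c : ℝ, 0 < c → runningGain P q S y Pi (fun t ω => η t ω + c • ν t ω) ≤
      runningGain P q S y Pi η + ENNReal.ofReal c * b) :
    marginalGain P q S y Pi η ν ≤ b := by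
  let c : ℕ → ℝ := fun n => 1 / ((n : ℝ) + 1)
  have hc : ∀ n, 0 < c n := fun n => by positivity
  let Y : Ω × horizon T → X := fun z => hatState S y η z.2 z.1
  let w : Ω × horizon T → X := fun z => S ((z.2 : ℝ≥0) : ℝ) (ν z.2 z.1)
  have hY : ∀ z, Y z ∈ feasible S y z.2 := fun z =>
    hatState_mem_feasible hS_pos hy ((hη.path z.1).nonneg z.2)
  have hw : ∀ z, 0 ≤ w z := fun z => hS_pos _ _ ((hν.path z.1).nonneg z.2)
  have hPη := hPi.measurable_hatState hS hS_pos hy hη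
  have hPn : ∀ n, Measurable fun z : Ω × horizon T => Pi z.1 z.2 (Y z + c n • w z) := by
    intro n
    have h1 := hPi.measurable_hatState hS hS_pos hy (hη.add (hν.smul (hc n).le))
    simp only [hatState_add_smul] at h1
    exact h1
  have hmono : ∀ n z, Pi z.1 z.2 (Y z) ≤ Pi z.1 z.2 (Y z + c n • w z) := fun n z => by
    have h1 : 0 ≤ c n • w z := smul_nonneg (hc n).le (hw z)
    exact hPi.monotone _ _ (hY z).1 (add_nonneg (hY z).1 h1) (le_add_of_nonneg_right h1)
  let D : ℕ → Ω × horizon T → ℝ≥0∞ := fun n z =>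
    ENNReal.ofReal ((c n)⁻¹ * (Pi z.1 z.2 (Y z + c n • w z) - Pi z.1 z.2 (Y z)))
  have hDm : ∀ n, Measurable (D n) := fun n => (((hPn n).sub hPη).const_mul _).ennreal_ofReal
  have hD : ∀ n, ∫⁻ z, D n z ∂(P.prod q) ≤ b := by
    intro n
    have h1 : runningGain P q S y Pi η + ENNReal.ofReal (c n) * ∫⁻ z, D n z ∂(P.prod q) =
        runningGain P q S y Pi (fun t ω => η t ω + c n • ν t ω) := by
      unfold runningGain
      rw [← lintegral_const_mul _ (hDm n), ← lintegral_add_left hPη.ennreal_ofReal]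
      refine lintegral_congr fun z => ?_
      rw [hatState_add_smul, ← ENNReal.ofReal_mul (hc n).le, mul_inv_cancel_left₀ (hc n).ne',
        ← ENNReal.ofReal_add (hPi.nonneg _ _ _ (hY z).1) (sub_nonneg.2 (hmono n z)),
        add_sub_cancel]
    have h2 := h1.trans_le (h _ (hc n))
    exact (ENNReal.mul_le_mul_iff_right (ENNReal.ofReal_pos.2 (hc n)).ne'
      ENNReal.ofReal_ne_top).1 (ENNReal.le_of_add_le_add_left hA h2)
  have hlim : ∀ z : Ω × horizon T, ENNReal.ofReal (gradient S y Pi z.1 z.2 (Y z) (w z)) =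
      liminf (fun n => D n z) atTop := fun z =>
    (((ENNReal.continuous_ofReal.tendsto _).comp
      (hPi.tendsto_gradient_of_nonneg (hY z) (hw z))).liminf_eq).symm
  calc marginalGain P q S y Pi η ν = ∫⁻ z, liminf (fun n => D n z) atTop ∂(P.prod q) :=
        lintegral_congr hlim
    _ ≤ liminf (fun n => ∫⁻ z, D n z ∂(P.prod q)) atTop := lintegral_liminf_le hDm
    _ ≤ liminf (fun _ : ℕ => b) atTop := liminf_le_liminf (Eventually.of_forall hD)
    _ = b := liminf_const b

/-- If the gain drops by at least `c * b` when `η` is replaced by `(1 - c) • η`, for all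
`c ∈ (0, 1]`, then the marginal gain in the direction `η` is at least `b`; by concavity the
difference quotients are dominated by the profit. -/
lemma le_marginalGain_of_forall (hS : IsC0Group S) (hS_pos : ∀ t v, 0 ≤ v → 0 ≤ S t v)
    (hy : 0 ≤ y) (hPi : IsRunningProfit F S y Pi) (hη : IsRegularControl F η)
    (hA : runningGain P q S y Pi η ≠ ∞) {b : ℝ≥0∞}
    (h : ∀ c : ℝ, 0 < c → c ≤ 1 → runningGain P q S y Pi (fun t ω => (1 - c) • η t ω) +
      ENNReal.ofReal c * b ≤ runningGain P q S y Pi η) :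
    b ≤ marginalGain P q S y Pi η η := by
  let c : ℕ → ℝ := fun n => 1 / ((n : ℝ) + 1)
  have hc : ∀ n, 0 < c n := fun n => by positivity
  have hc1 : ∀ n, c n ≤ 1 := fun n => by
    rw [div_le_one (by positivity)]
    linarith [(Nat.cast_nonneg n : (0 : ℝ) ≤ n)]
  let Y : Ω × horizon T → X := fun z => hatState S y η z.2 z.1
  let w : Ω × horizon T → X := fun z => S ((z.2 : ℝ≥0) : ℝ) (η z.2 z.1)
  have hstate : ∀ n z, hatState S y (fun t ω => (1 - c n) • η t ω) z.2 z.1 =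
      Y z + c n • (-w z) := fun n z => by
    simp only [Y, w, hatState, map_add, map_smul]
    module
  have hreg : ∀ n, IsRegularControl F fun t ω => (1 - c n) • η t ω := fun n =>
    hη.smul (sub_nonneg.2 (hc1 n))
  have hY : ∀ z, Y z ∈ feasible S y z.2 := fun z =>
    hatState_mem_feasible hS_pos hy ((hη.path z.1).nonneg z.2)
  have hYn : ∀ n z, Y z + c n • (-w z) ∈ feasible S y z.2 := fun n z => by
    rw [← hstate]
    exact hatState_mem_feasible hS_pos hy (((hreg n).path z.1).nonneg z.2)
  have hw : ∀ z, 0 ≤ w z := fun z => hS_pos _ _ ((hη.path z.1).nonneg z.2)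
  have hPη := hPi.measurable_hatState hS hS_pos hy hη
  have hPn : ∀ n, Measurable fun z : Ω × horizon T => Pi z.1 z.2 (Y z + c n • (-w z)) := by
    intro n
    have h1 := hPi.measurable_hatState hS hS_pos hy (hreg n)
    simp only [hstate] at h1
    exact h1
  have hmono : ∀ n z, Pi z.1 z.2 (Y z + c n • (-w z)) ≤ Pi z.1 z.2 (Y z) := fun n z => by
    refine hPi.monotone _ _ (hYn n z).1 (hY z).1 ?_
    rw [smul_neg]
    exact add_le_of_nonpos_right (neg_nonpos.2 (smul_nonneg (hc n).le (hw z)))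
  let D : ℕ → Ω × horizon T → ℝ≥0∞ := fun n z =>
    ENNReal.ofReal ((c n)⁻¹ * (Pi z.1 z.2 (Y z) - Pi z.1 z.2 (Y z + c n • (-w z))))
  have hDm : ∀ n, Measurable (D n) := fun n => ((hPη.sub (hPn n)).const_mul _).ennreal_ofReal
  have hD : ∀ n, b ≤ ∫⁻ z, D n z ∂(P.prod q) := by
    intro n
    have h1 : runningGain P q S y Pi (fun t ω => (1 - c n) • η t ω) +
        ENNReal.ofReal (c n) * ∫⁻ z, D n z ∂(P.prod q) = runningGain P q S y Pi η := by
      unfold runningGain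
      simp only [hstate]
      rw [← lintegral_const_mul _ (hDm n), ← lintegral_add_left (hPn n).ennreal_ofReal]
      refine lintegral_congr fun z => ?_
      rw [← ENNReal.ofReal_mul (hc n).le, mul_inv_cancel_left₀ (hc n).ne',
        ← ENNReal.ofReal_add (hPi.nonneg _ _ _ (hYn n z).1) (sub_nonneg.2 (hmono n z)),
        add_sub_cancel]
    have hfin : runningGain P q S y Pi (fun t ω => (1 - c n) • η t ω) ≠ ∞ :=
      ne_top_of_le_ne_top hA (h1 ▸ le_self_add)
    have h2 := (h _ (hc n) (hc1 n)).trans_eq h1.symm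
    exact (ENNReal.mul_le_mul_iff_right (ENNReal.ofReal_pos.2 (hc n)).ne'
      ENNReal.ofReal_ne_top).1 (ENNReal.le_of_add_le_add_left hfin h2)
  have hbound : ∀ n z, D n z ≤ ENNReal.ofReal (Pi z.1 z.2 (Y z)) := fun n z => by
    refine ENNReal.ofReal_le_ofReal ?_
    have hk : hatState S y (fun _ _ => (0 : X)) z.2 z.1 ∈ feasible S y z.2 :=
      hatState_mem_feasible hS_pos hy le_rfl
    have hconv : Y z + c n • (-w z) =
        (1 - c n) • Y z + c n • hatState S y (fun _ _ => (0 : X)) z.2 z.1 := by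
      simp only [Y, w, hatState, map_add, map_zero]
      module
    have h1 := (hPi.concave z.1 z.2).2 (hY z).1 hk.1 (sub_nonneg.2 (hc1 n)) (hc n).le (by ring)
    rw [← hconv, smul_eq_mul, smul_eq_mul] at h1
    have h2 := mul_nonneg (hc n).le (hPi.nonneg z.1 z.2 _ hk.1)
    rw [inv_mul_le_iff₀ (hc n)]
    linarith
  have hlim : ∀ z : Ω × horizon T, Tendsto (fun n => D n z) atTop
      (𝓝 (ENNReal.ofReal (gradient S y Pi z.1 z.2 (Y z) (w z)))) := fun z => by
    have h1 := (hPi.tendsto_gradient (ω := z.1) (hY z) (fun n => (hc n).ne')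
      tendsto_one_div_natCast_add_one fun n => hYn n z).neg
    rw [map_neg, neg_neg] at h1
    refine ((ENNReal.continuous_ofReal.tendsto _).comp h1).congr fun n => ?_
    simp only [Function.comp_apply, D]
    rw [← mul_neg, neg_sub]
  exact ge_of_tendsto' (tendsto_lintegral_of_dominated_convergence _ hDm
    (fun n => Eventually.of_forall (hbound n)) hA (Eventually.of_forall hlim)) hD

/-- The first order condition, for the gains and costs of regular controls. -/
theorem forall_runningGain_le_iff (hS : IsC0Group S) (hS_pos : ∀ t v, 0 ≤ v → 0 ≤ S t v)
    (hy : 0 ≤ y) (hPi : IsRunningProfit F S y Pi) (hΦ : IsRegularCost F Φ)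
    (hdens : ∀ ν : horizon T → Ω → X, IsRegularControl F ν → ∃ ρ, IsProgressiveDensity F P ν ρ)
    (hη : IsRegularControl F η) (hA : runningGain P q S y Pi η ≠ ∞)
    (hB : expectedCost P (hatCost S Φ) η ≠ ∞) :
    (∀ ν, IsRegularControl F ν → expectedCost P (hatCost S Φ) ν ≠ ∞ →
      runningGain P q S y Pi ν + expectedCost P (hatCost S Φ) η ≤
        runningGain P q S y Pi η + expectedCost P (hatCost S Φ) ν) ↔
    (∀ ν, IsRegularControl F ν → expectedCost P (hatCost S Φ) ν ≠ ∞ →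
      marginalGain P q S y Pi η ν ≤ expectedCost P (hatCost S Φ) ν) ∧
      marginalGain P q S y Pi η η = expectedCost P (hatCost S Φ) η := by
  constructor
  · intro h
    have h1 : ∀ ν, IsRegularControl F ν → expectedCost P (hatCost S Φ) ν ≠ ∞ →
        marginalGain P q S y Pi η ν ≤ expectedCost P (hatCost S Φ) ν := by
      intro ν hν hfin
      refine marginalGain_le_of_forall hS hS_pos hy hPi hη hν hA fun c hc => ?_
      have e : expectedCost P (hatCost S Φ) (fun t ω => η t ω + c • ν t ω) =
          expectedCost P (hatCost S Φ) η + ENNReal.ofReal c * expectedCost P (hatCost S Φ) ν := by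
        rw [expectedCost_add hS hS_pos hΦ hdens hη (hν.smul hc.le),
          expectedCost_smul hS hΦ hdens hν hc.le]
      have h2 := h _ (hη.add (hν.smul hc.le)) (by
        rw [e]
        exact ENNReal.add_ne_top.2 ⟨hB, ENNReal.mul_ne_top ENNReal.ofReal_ne_top hfin⟩)
      rw [e, ← add_assoc, add_right_comm] at h2
      exact ENNReal.le_of_add_le_add_right hB h2
    refine ⟨h1, le_antisymm (h1 η hη hB) ?_⟩
    refine le_marginalGain_of_forall hS hS_pos hy hPi hη hA fun c hc hc1 => ?_
    have e := expectedCost_smul hS hΦ hdens hη (sub_nonneg.2 hc1)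
    have hfin : ENNReal.ofReal (1 - c) * expectedCost P (hatCost S Φ) η ≠ ∞ :=
      ENNReal.mul_ne_top ENNReal.ofReal_ne_top hB
    have h2 := h _ (hη.smul (sub_nonneg.2 hc1)) (by rw [e]; exact hfin)
    have e1 : expectedCost P (hatCost S Φ) η = ENNReal.ofReal c * expectedCost P (hatCost S Φ) η +
        ENNReal.ofReal (1 - c) * expectedCost P (hatCost S Φ) η := by
      rw [← add_mul, ← ENNReal.ofReal_add hc.le (sub_nonneg.2 hc1), add_sub_cancel,
        ENNReal.ofReal_one, one_mul]
    rw [e] at h2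
    nth_rw 1 [e1] at h2
    rw [← add_assoc] at h2
    exact ENNReal.le_of_add_le_add_right hfin h2
  · rintro ⟨h1, h2⟩ ν hν hfin
    rw [← h2]
    exact (runningGain_add_marginalGain_le hS hS_pos hy hPi hη hν).trans (by gcongr; exact h1 ν hν hfin)

end FirstOrder

/-! ### Changes on a null event -/

section Congr

variable {X : Type*} [NormedAddCommGroup X] [NormedSpace ℝ X] [PartialOrder X]
  {Ω : Type*} {mΩ : MeasurableSpace Ω} {T : ℝ≥0∞} {F : Filtration (horizon T) mΩ}
  {P : Measure Ω} {q : Measure (horizon T)} {S : ℝ → X →L[ℝ] X} {y : X}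
  {Pi : Ω → horizon T → X → ℝ} {Φ Φ' : horizon T → Ω → X →L[ℝ] ℝ} {ν ν' : horizon T → Ω → X}

lemma expectedCost_congr (hΦ : ∀ᵐ ω ∂P, ∀ t, Φ' t ω = Φ t ω) (hν : ∀ᵐ ω ∂P, ∀ t, ν' t ω = ν t ω) :
    expectedCost P Φ' ν' = expectedCost P Φ ν := by
  refine lintegral_congr_ae ?_
  filter_upwards [hΦ, hν] with ω h1 h2
  simp only [h1, h2]

omit [PartialOrder X] in
lemma ae_hatCost_eq (hΦ : ∀ᵐ ω ∂P, ∀ t, Φ' t ω = Φ t ω) :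
    ∀ᵐ ω ∂P, ∀ t, hatCost S Φ' t ω = hatCost S Φ t ω :=
  hΦ.mono fun ω h t => by rw [hatCost, hatCost, h]

lemma performance_congr (hΦ : ∀ᵐ ω ∂P, ∀ t, Φ' t ω = Φ t ω) :
    performance P q S y Pi Φ' ν = performance P q S y Pi Φ ν := by
  refine extIntegral_congr_ae ?_
  filter_upwards [hΦ] with ω h1
  simp only [h1]

lemma hatPerformance_congr (hΦ : ∀ᵐ ω ∂P, ∀ t, Φ' t ω = Φ t ω)
    (hν : ∀ᵐ ω ∂P, ∀ t, ν' t ω = ν t ω) :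
    hatPerformance P q S y Pi Φ' ν' = hatPerformance P q S y Pi Φ ν := by
  refine extIntegral_congr_ae ?_
  filter_upwards [ae_hatCost_eq (S := S) hΦ, hν] with ω h1 h2
  simp only [h1, h2, hatState]

lemma focValue_congr (hΦ : ∀ᵐ ω ∂P, ∀ t, Φ' t ω = Φ t ω) (hν : ∀ᵐ ω ∂P, ∀ t, ν' t ω = ν t ω)
    (g : horizon T → Ω → X → ℝ≥0∞) : focValue P S Φ' g ν' = focValue P S Φ g ν := by
  refine extIntegral_congr_ae ?_
  filter_upwards [ae_hatCost_eq (S := S) hΦ, hν] with ω h1 h2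
  simp only [h1, h2]

lemma IsCondExpProcess.congr {g : horizon T → Ω → X → ℝ≥0∞}
    (hg : IsCondExpProcess F P (marginalProfit q S y Pi ν) g)
    (hν : ∀ᵐ ω ∂P, ∀ t, ν' t ω = ν t ω) :
    IsCondExpProcess F P (marginalProfit q S y Pi ν') g where
  progressive := hg.progressive
  stopping V hV hV0 τ hτ := by
    rw [hg.stopping V hV hV0 τ hτ]
    refine lintegral_congr_ae (ae_restrict_of_ae ?_)
    filter_upwards [hν] with ω h
    simp only [stoppedValue, marginalProfit, hatState, h]

end Congr

/-! ### Optimality -/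

section EReal

variable {a b a' b' : ℝ≥0∞}

lemma ereal_sub_le_sub_iff (ha : a ≠ ∞) (hb : b ≠ ∞) (ha' : a' ≠ ∞) (hb' : b' ≠ ∞) :
    (a : EReal) - b ≤ (a' : EReal) - b' ↔ a + b' ≤ a' + b := by
  lift a to ℝ≥0 using ha
  lift b to ℝ≥0 using hb
  lift a' to ℝ≥0 using ha'
  lift b' to ℝ≥0 using hb'
  change (((a : ℝ) - b : ℝ) : EReal) ≤ (((a' : ℝ) - b' : ℝ) : EReal) ↔ _
  rw [EReal.coe_le_coe_iff, sub_le_sub_iff]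
  exact_mod_cast Iff.rfl

lemma ereal_sub_eq_zero_iff (hb : b ≠ ∞) : (a : EReal) - b = 0 ↔ a = b := by
  lift b to ℝ≥0 using hb
  constructor
  · intro h
    induction a with
    | top => exact absurd h (by simp)
    | coe a =>
      change (((a : ℝ) - b : ℝ) : EReal) = 0 at h
      rw [EReal.coe_eq_zero, sub_eq_zero] at h
      exact_mod_cast h
  · rintro rfl
    exact EReal.sub_self (by simp) (by simp)

end EReal

section Optimality

variable {X : Type*} [NormedAddCommGroup X] [NormedSpace ℝ X] [PartialOrder X] [CompleteSpace X]
  [IsOrderedAddMonoid X] [IsOrderedModule ℝ X] [OrderClosedTopology X]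
  {Ω : Type*} {mΩ : MeasurableSpace Ω} {T : ℝ≥0∞} {F : Filtration (horizon T) mΩ}
  {P : Measure Ω} [SFinite P] {q : Measure (horizon T)} [IsFiniteMeasure q]
  {S : ℝ → X →L[ℝ] X} {y : X} {Pi : Ω → horizon T → X → ℝ} {Φ : horizon T → Ω → X →L[ℝ] ℝ}

/-- The characterization of optimal controls, in an ordered Banach space in which controls have
progressive densities. -/
theorem isHatOptimal_iff (hF : UsualConditions F P)
    (hdens : ∀ ν : horizon T → Ω → X, IsRegularControl F ν → ∃ ρ, IsProgressiveDensity F P ν ρ)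
    (hS : IsC0Group S) (hS_pos : ∀ t v, 0 ≤ v → 0 ≤ S t v) (hy : 0 ≤ y)
    (hPi : IsRunningProfit F S y Pi) (hΦ : IsCostProcess F P Φ)
    (hfinite : ∀ ν, IsAdmissible F P Φ ν → performance P q S y Pi Φ ν < ⊤)
    {η : horizon T → Ω → X} (hη : IsAdmissible F P (hatCost S Φ) η)
    {g : horizon T → Ω → X → ℝ≥0∞} (hg : IsCondExpProcess F P (marginalProfit q S y Pi η) g) :
    IsHatOptimal F P q S y Pi Φ η ↔
      (∀ ν, IsAdmissible F P (hatCost S Φ) ν → focValue P S Φ g ν ≤ 0) ∧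
        focValue P S Φ g η = 0 := by
  obtain ⟨Φ', hΦ', hΦΦ'⟩ := hΦ.exists_regular hF
  obtain ⟨η', hη', hηη'⟩ := hη.1.exists_regular hF
  have hfinite' : ∀ ν, IsAdmissible F P Φ' ν → performance P q S y Pi Φ' ν < ⊤ := fun ν hν => by
    rw [performance_congr hΦΦ']
    refine hfinite ν ⟨hν.1, lt_of_eq_of_lt ?_ hν.2⟩
    exact (expectedCost_congr hΦΦ' (ν := ν) (Eventually.of_forall fun _ _ => rfl)).symm
  have hcost : ∀ {ν ν' : horizon T → Ω → X}, (∀ᵐ ω ∂P, ∀ t, ν' t ω = ν t ω) →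
      expectedCost P (hatCost S Φ') ν' = expectedCost P (hatCost S Φ) ν := fun h =>
    expectedCost_congr (ae_hatCost_eq hΦΦ') h
  have hA : ∀ {ν : horizon T → Ω → X}, IsRegularControl F ν →
      expectedCost P (hatCost S Φ') ν ≠ ∞ → runningGain P q S y Pi ν ≠ ∞ := fun hν hfin =>
    runningGain_ne_top hF hdens hS hS_pos hy hPi hΦ' hfinite' hν hfin
  have hperf : ∀ {ν : horizon T → Ω → X}, IsRegularControl F ν →
      expectedCost P (hatCost S Φ') ν ≠ ∞ → hatPerformance P q S y Pi Φ' ν =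
      (runningGain P q S y Pi ν : EReal) - (expectedCost P (hatCost S Φ') ν : EReal) :=
    fun hν hfin => hatPerformance_eq hS hS_pos hy hPi hΦ' hν (hdens _ hν).choose_spec hfin
  have hfoc : ∀ {ν : horizon T → Ω → X}, IsRegularControl F ν →
      expectedCost P (hatCost S Φ') ν ≠ ∞ → focValue P S Φ' g ν =
      (marginalGain P q S y Pi η' ν : EReal) - (expectedCost P (hatCost S Φ') ν : EReal) :=
    fun hν hfin => focValue_eq hS hS_pos hy hPi hΦ' hη' (hg.congr hηη') hν
      (hdens _ hν).choose_spec hfin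
  have hBη : expectedCost P (hatCost S Φ') η' ≠ ∞ := by
    rw [hcost hηη']
    exact hη.2.ne
  have hadm : ∀ {ν : horizon T → Ω → X}, IsRegularControl F ν →
      expectedCost P (hatCost S Φ') ν ≠ ∞ → IsAdmissible F P (hatCost S Φ) ν := fun hν hfin =>
    ⟨hν.isControl P, lt_of_eq_of_lt (hcost (Eventually.of_forall fun _ _ => rfl)).symm hfin.lt_top⟩
  -- quantification over admissible controls reduces to regular ones
  have hall : ∀ {p : (horizon T → Ω → X) → Prop},
      (∀ ν ν', (∀ᵐ ω ∂P, ∀ t, ν' t ω = ν t ω) → p ν' → p ν) →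
      ((∀ ν, IsAdmissible F P (hatCost S Φ) ν → p ν) ↔
        ∀ ν, IsRegularControl F ν → expectedCost P (hatCost S Φ') ν ≠ ∞ → p ν) := by
    intro p hp
    refine ⟨fun h ν hν hfin => h ν (hadm hν hfin), fun h ν hν => ?_⟩
    obtain ⟨ν', hν', hνν'⟩ := hν.1.exists_regular hF
    refine hp ν ν' hνν' (h ν' hν' ?_)
    rw [hcost hνν']
    exact hν.2.ne
  have hopt : IsHatOptimal F P q S y Pi Φ η ↔ ∀ ν, IsAdmissible F P (hatCost S Φ) ν →
      hatPerformance P q S y Pi Φ ν ≤ hatPerformance P q S y Pi Φ η := by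
    refine ⟨fun h ν hν => ?_, fun h => ⟨hη, le_antisymm ?_ (iSup₂_le h)⟩⟩
    · rw [h.2]
      exact le_iSup₂ (f := fun ν _ => hatPerformance P q S y Pi Φ ν) ν hν
    · exact le_iSup₂ (f := fun ν _ => hatPerformance P q S y Pi Φ ν) η hη
  rw [hopt, hall (p := fun ν => hatPerformance P q S y Pi Φ ν ≤ hatPerformance P q S y Pi Φ η)
      fun ν ν' h h' => ?_, hall (p := fun ν => focValue P S Φ g ν ≤ 0) fun ν ν' h h' => ?_]
  · have hrefl : ∀ ν : horizon T → Ω → X, ∀ᵐ ω ∂P, ∀ t, ν t ω = ν t ω := fun ν =>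
      Eventually.of_forall fun _ _ => rfl
    have key := forall_runningGain_le_iff hS hS_pos hy hPi hΦ' hdens hη' (hA hη' hBη) hBη
    rw [← focValue_congr hΦΦ' hηη' g, hfoc hη' hBη, ereal_sub_eq_zero_iff hBη,
      ← hatPerformance_congr hΦΦ' hηη', hperf hη' hBη]
    refine Iff.trans ?_ (key.trans (and_congr ?_ Iff.rfl))
    · refine forall_congr' fun ν => forall_congr' fun hν => forall_congr' fun hfin => ?_
      rw [← hatPerformance_congr hΦΦ' (hrefl ν), hperf hν hfin,
        ereal_sub_le_sub_iff (hA hν hfin) hfin (hA hη' hBη) hBη]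
    · refine forall_congr' fun ν => forall_congr' fun hν => forall_congr' fun hfin => ?_
      rw [← focValue_congr hΦΦ' (hrefl ν) g, hfoc hν hfin, EReal.sub_nonpos,
        EReal.coe_ennreal_le_coe_ennreal_iff]
  · rwa [← focValue_congr (Eventually.of_forall fun _ _ => rfl) h]
  · rwa [← hatPerformance_congr (Eventually.of_forall fun _ _ => rfl) h]

end Optimality

end SingularControl

end

open SingularControl in
theorem corollary4p1 {D : Type*} [MeasurableSpace D] (μ : Measure D) (p : ℝ≥0∞) [Fact (1 ≤ p)]
    (hp_one : 1 < p) (hp_top : p ≠ ∞)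
    {Ω : Type*} {mΩ : MeasurableSpace Ω} (P : Measure Ω) [IsProbabilityMeasure P]
    (T : ℝ≥0∞) (F : Filtration (horizon T) mΩ) (hF : UsualConditions F P)
    (q : Measure (horizon T)) [IsFiniteMeasure q]
    (A : Lp ℝ p μ →ₗ.[ℝ] Lp ℝ p μ) (S : ℝ → Lp ℝ p μ →L[ℝ] Lp ℝ p μ)
    (hS : IsC0Group S) (hA : IsGenerator A S) (hS_pos : ∀ t v, 0 ≤ v → 0 ≤ S t v)
    (y : Lp ℝ p μ) (hy : 0 ≤ y)
    (Φ : horizon T → Ω → Lp ℝ p μ →L[ℝ] ℝ) (hΦ : IsCostProcess F P Φ)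
    (Pi : Ω → horizon T → Lp ℝ p μ → ℝ) (hPi : IsRunningProfit F S y Pi)
    (hfinite : ∀ ν, IsAdmissible F P Φ ν → performance P q S y Pi Φ ν < ⊤)
    (νstar : horizon T → Ω → Lp ℝ p μ) (hνstar : IsAdmissible F P (hatCost S Φ) νstar)
    (g : horizon T → Ω → Lp ℝ p μ → ℝ≥0∞)
    (hg : IsCondExpProcess F P (marginalProfit q S y Pi νstar) g) :
    IsHatOptimal F P q S y Pi Φ νstar ↔
      (∀ ν, IsAdmissible F P (hatCost S Φ) ν → focValue P S Φ g ν ≤ 0) ∧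
        focValue P S Φ g νstar = 0 := by
  have : IsOrderedModule ℝ (Lp ℝ p μ) := isOrderedModule_Lp
  refine isHatOptimal_iff hF (fun ν hν => ?_) hS hS_pos hy hPi hΦ hfinite hνstar hg
  obtain ⟨ρ, h1, h2, h3⟩ := hν.exists_progressive_density (P := P) hF.rightContinuous
    (by simpa using ENNReal.toReal_mono hp_top hp_one.le) (uniformlyConvexNormPow_Lp hp_one hp_top)
  exact ⟨ρ, h1, h2, h3⟩
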